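/- Setting. A directed graph is $G=(V,E)$ with $V$ finite, $|V|\ge 3$, $E\subseteq V\times V$, $n=|V|$, $m=|E|$; $G^R=(V,E^R)$ is its reversal. $G$ is strongly connected if every vertex reaches every vertex. In a strongly connected graph, a vertex $w$ is a strong articulation point if $G\setminus\{w\}$ is not strongly connected, and an edge $e$ is a strong bridge if $(V,E\setminus\{e\})$ is not strongly connected. A strongly connected $G$ is $2$-edge-connected if it has no strong bridge, $2$-vertex-connected if it has no strong articulation point, and, for $T\subseteq V$, $2$-$T$-connected if it is $2$-edge-connected and no vertex of $T$ is a strong articulation point. A subgraph $(V,F)$ with one of these properties is minimal if deleting any single edge of $F$ destroys the property. A spanning tree rooted at $r$ has its edges directed away from $r$. A vertex $z$ dominates $x$ in $G$ with start vertex $w$ if $z$ lies on all paths from $w$ to $x$; two spanning trees of $G$ rooted at $w$ are independent if for each $x\neq w$ the two tree paths from $w$ to $x$ have only dominators of $x$ in common. Algorithm 1. Input: $G=(V,E)$ and $T\subseteq V$ such that $G$ is $2$-$T$-connected. Output: $G_\alpha=(V,E_\alpha)$. 1. If $T=\emptyset$: let $E_\alpha$ be the edge set of a minimal $2$-edge-connected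 subgraph of $G$. 2. Else if $T=V$: let $E_\alpha$ be the edge set of a minimal $2$-vertex-connected subgraph of $G$. 3. Else: let $E_\alpha$ be the edge set of a minimal $2$-edge-connected subgraph of $G$, and then: - (a) if $0<|T|\le 2$: for each $y\in T$, choose $q\in V\setminus\{y\}$; find a spanning tree $T^1$ rooted at $q$ of $G\setminus\{y\}$ and add its edges to $E_\alpha$; find a spanning tree $T^2$ rooted at $q$ of $G^R\setminus\{y\}$ and for each edge $(v,w)$ of $T^2$ add $(w,v)$ to $E_\alpha$; - (b) otherwise: select $w\in V\setminus T$; determine two independent trees $T_1^w,T_2^w$ rooted at $w$ of $G$ and add their edges to $E_\alpha$; determine two independent trees $T_1^R,T_2^R$ rooted at $w$ of $G^R$ and for each of their edges $(v,u)$ add $(u,v)$ to $E_\alpha$. 4. Output $(V,E_\alpha)$. Theorem. The running time of Algorithm 1 is $O(m^2)$. That is, on a unit-cost random access machine (whose arithmetic may be restricted to adding and subtracting $1$), the steps that Algorithm 1 leaves open (finding the minimal subgraphs, the choices of $q$ and $w$, finding the spanning trees and the independent trees) can be implemented by correct subroutines such that, for some constant $C$, Algorithm 1 with these subroutines halts after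 at most $C\,m^2$ elementary steps on every input $(G,T)$ with $|V|\ge3$ and $G$ $2$-$T$-connected, where $V=\{0,\dots,n-1\}$, $G$ is given as a list of its edges and $T$ as a list of its elements. -/

import Mathlib

namespace TwoT

/-! ## Directed graphs `(V, E)`, with `E` a set of ordered pairs -/

section Graphs

variable {V : Type*}

/-- There is a directed path from `u` to `v` in `(V, E)`. -/
def Reach (E : Set (V × V)) (u v : V) : Prop :=
  Relation.ReflTransGen (fun a b => (a, b) ∈ E) u v

/-- The graph with vertex set `S` and edge set `E` is strongly connected. -/
def StronglyConnectedOn (S : Set V) (E : Set (V × V)) : Prop :=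
  ∀ u ∈ S, ∀ v ∈ S, Reach E u v

/-- `(V, E)` is strongly connected. -/
def StronglyConnected (E : Set (V × V)) : Prop :=
  StronglyConnectedOn Set.univ E

/-- The edges of `G \ {w}`; its vertex set is `{w}ᶜ`. -/
def delVertex (E : Set (V × V)) (w : V) : Set (V × V) :=
  {a | a ∈ E ∧ a.1 ≠ w ∧ a.2 ≠ w}

/-- `w` is a strong articulation point: `G \ {w}` is not strongly connected. -/
def IsStrongArticulationPoint (E : Set (V × V)) (w : V) : Prop :=
  ¬ StronglyConnectedOn {w}ᶜ (delVertex E w)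

/-- `a` is a strong bridge: deleting the edge `a` destroys strong connectivity. -/
def IsStrongBridge (E : Set (V × V)) (a : V × V) : Prop :=
  a ∈ E ∧ ¬ StronglyConnected (E \ {a})

def Is2EdgeConnected (E : Set (V × V)) : Prop :=
  StronglyConnected E ∧ ∀ a ∈ E, ¬ IsStrongBridge E a

def Is2VertexConnected (E : Set (V × V)) : Prop :=
  StronglyConnected E ∧ 3 ≤ Nat.card V ∧ ∀ w : V, ¬ IsStrongArticulationPoint E w

def Is2TConnected (E : Set (V × V)) (T : Set V) : Prop :=
  Is2EdgeConnected E ∧ ∀ w ∈ T, ¬ IsStrongArticulationPoint E w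

/-- `(V, F)` is a minimal `P`-subgraph of `(V, E)`: it satisfies `P`, and no longer does so when
any one of its edges is deleted. -/
def IsMinimalSubgraph (P : Set (V × V) → Prop) (E F : Set (V × V)) : Prop :=
  F ⊆ E ∧ P F ∧ ∀ a ∈ F, ¬ P (F \ {a})

/-- `A` is the edge set of a spanning tree rooted at `r` (all edges directed away from `r`)
of the graph with vertex set `S` and edge set `E`. -/
structure IsSpanningTree (S : Set V) (E : Set (V × V)) (r : V) (A : Set (V × V)) : Prop where
  root_mem : r ∈ S
  subset : A ⊆ E
  within : ∀ a ∈ A, a.1 ∈ S ∧ a.2 ∈ S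
  root_no_parent : ∀ a ∈ A, a.2 ≠ r
  unique_parent : ∀ v ∈ S, v ≠ r → ∃! u, (u, v) ∈ A
  reach : ∀ v ∈ S, Reach A r v

/-- `p` lists the vertices of a path from `u` to `v` in `(V, E)`. -/
def IsPath (E : Set (V × V)) (u v : V) (p : List V) : Prop :=
  p.IsChain (fun a b => (a, b) ∈ E) ∧ p.head? = some u ∧ p.getLast? = some v

/-- `z` is a dominator of `x` in the flowgraph `(V, E, u)`: it lies on all paths from `u` to `x`. -/
def IsDominator (E : Set (V × V)) (u z x : V) : Prop :=
  ∀ p, IsPath E u x p → z ∈ p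

/-- `A` and `B` are two independent spanning trees of the flowgraph `(V, E, u)`: for each vertex
`x ≠ u`, the paths from `u` to `x` in `A` and `B` have only the dominators of `x` in common. -/
def AreIndependentTrees (E : Set (V × V)) (u : V) (A B : Set (V × V)) : Prop :=
  IsSpanningTree Set.univ E u A ∧ IsSpanningTree Set.univ E u B ∧
  ∀ x, x ≠ u → ∀ p p', IsPath A u x p → IsPath B u x p' →
    ∀ z, z ∈ p → z ∈ p' → IsDominator E u z x

end Graphs

/-! ## The machine: a unit-cost random access machine in structured form

The memory consists of scalar variables and of arrays of natural numbers. The only arithmetic is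
`+ 1` and `- 1` (a successor RAM), so that no computed number can exceed the numbers in the input
and the constants in the program by more than the number of steps made: the numbers have
logarithmically many bits, and the unit cost measure is realistic. -/

/-- Scalar variables. `tmp k` is the workspace of the subroutines. -/
inductive Var where
  | n | m | t | i | j | y | q | w
  | tmp (k : ℕ)
  deriving DecidableEq

/-- Arrays. `tmp k` is the workspace of the subroutines. -/
inductive Arr where
  | src | dst | ter | out | tree₁ | tree₂ | rtree₁ | rtree₂
  | tmp (k : ℕ)
  deriving DecidableEq

structure State where
  var : Var → ℕ
  arr : Arr → ℕ → ℕ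

def State.setVar (σ : State) (x : Var) (k : ℕ) : State :=
  { σ with var := Function.update σ.var x k }

def State.setArr (σ : State) (a : Arr) (i k : ℕ) : State :=
  { σ with arr := Function.update σ.arr a (Function.update (σ.arr a) i k) }

inductive Expr where
  | lit (k : ℕ)
  | var (x : Var)
  | get (a : Arr) (i : Expr)
  | succ (e : Expr)
  | pred (e : Expr)

def Expr.eval (σ : State) : Expr → ℕ
  | lit k => k
  | var x => σ.var x
  | get a i => σ.arr a (i.eval σ)
  | succ e => e.eval σ + 1
  | pred e => e.eval σ - 1

/-- Number of elementary operations needed to evaluate an expression. -/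
def Expr.cost : Expr → ℕ
  | lit _ => 1
  | var _ => 1
  | get _ i => i.cost + 1
  | succ e => e.cost + 1
  | pred e => e.cost + 1

inductive Test where
  | eq (e f : Expr)
  | lt (e f : Expr)
  | not (b : Test)
  | and (b c : Test)

def Test.holds (σ : State) : Test → Prop
  | eq e f => e.eval σ = f.eval σ
  | lt e f => e.eval σ < f.eval σ
  | not b => ¬ b.holds σ
  | and b c => b.holds σ ∧ c.holds σ

/-- Number of elementary operations needed to evaluate a test. -/
def Test.cost : Test → ℕ
  | eq e f => e.cost + f.cost + 1
  | lt e f => e.cost + f.cost + 1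
  | not b => b.cost + 1
  | and b c => b.cost + c.cost + 1

inductive Cmd where
  | skip
  | assign (x : Var) (e : Expr)
  | store (a : Arr) (i e : Expr)
  | seq (c d : Cmd)
  | ite (b : Test) (c d : Cmd)
  | loop (b : Test) (c : Cmd)

/-- `Exec c σ k τ`: started in the state `σ`, the program `c` halts after exactly `k` elementary
steps, in the state `τ`. (`Cmd.loop b c` is "while `b` do `c`".) -/
inductive Exec : Cmd → State → ℕ → State → Prop where
  | skip (σ : State) : Exec Cmd.skip σ 1 σ
  | assign (σ : State) (x : Var) (e : Expr) :
      Exec (Cmd.assign x e) σ (e.cost + 1) (σ.setVar x (e.eval σ))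
  | store (σ : State) (a : Arr) (i e : Expr) :
      Exec (Cmd.store a i e) σ (i.cost + e.cost + 1) (σ.setArr a (i.eval σ) (e.eval σ))
  | seq {c d : Cmd} {σ ρ τ : State} {k l : ℕ} (h₁ : Exec c σ k ρ) (h₂ : Exec d ρ l τ) :
      Exec (Cmd.seq c d) σ (k + l) τ
  | ite_true {b : Test} {c d : Cmd} {σ τ : State} {k : ℕ} (hb : b.holds σ) (h : Exec c σ k τ) :
      Exec (Cmd.ite b c d) σ (b.cost + k) τ
  | ite_false {b : Test} {c d : Cmd} {σ τ : State} {k : ℕ} (hb : ¬ b.holds σ) (h : Exec d σ k τ) :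
      Exec (Cmd.ite b c d) σ (b.cost + k) τ
  | loop_true {b : Test} {c : Cmd} {σ ρ τ : State} {k l : ℕ} (hb : b.holds σ)
      (h₁ : Exec c σ k ρ) (h₂ : Exec (Cmd.loop b c) ρ l τ) :
      Exec (Cmd.loop b c) σ (b.cost + k + l) τ
  | loop_false {b : Test} {c : Cmd} {σ : State} (hb : ¬ b.holds σ) :
      Exec (Cmd.loop b c) σ b.cost σ

/-! ## Representation of graphs, vertex sets and edge sets in memory -/

/-- The memory holds the graph with vertices `0, …, n - 1` and edges `e 0, …, e (m - 1)`,
as an edge list. -/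
def HoldsGraph {n m : ℕ} (σ : State) (e : Fin m → Fin n × Fin n) : Prop :=
  σ.var Var.n = n ∧ σ.var Var.m = m ∧
  ∀ i : Fin m, σ.arr Arr.src i = ((e i).1 : ℕ) ∧ σ.arr Arr.dst i = ((e i).2 : ℕ)

/-- The memory holds the vertex set `{T 0, …, T (t - 1)}`, as a list. -/
def HoldsTerminals {n t : ℕ} (σ : State) (T : Fin t → Fin n) : Prop :=
  σ.var Var.t = t ∧ ∀ i : Fin t, σ.arr Arr.ter i = (T i : ℕ)

/-- The set of edges in the list `e` that are marked (by a nonzero entry) in the array `a`. -/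
def marked {n m : ℕ} (σ : State) (a : Arr) (e : Fin m → Fin n × Fin n) : Set (Fin n × Fin n) :=
  {x | ∃ i : Fin m, σ.arr a i ≠ 0 ∧ e i = x}

/-- The edge list of the reversal `Gᴿ`. -/
def rev {n m : ℕ} (e : Fin m → Fin n × Fin n) : Fin m → Fin n × Fin n :=
  fun i => (e i).swap

/-- From `σ` to `τ`, no scalar variable outside `X` and no array outside `A` has changed, the
workspace excepted. -/
def OnlyChanges (X : Set Var) (A : Set Arr) (σ τ : State) : Prop :=
  (∀ x, x ∉ X → (∀ k, x ≠ Var.tmp k) → τ.var x = σ.var x) ∧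
  (∀ a, a ∉ A → (∀ k, a ≠ Arr.tmp k) → τ.arr a = σ.arr a)

/-- Total correctness of a subroutine: started in `σ` (with arbitrary contents of the workspace)
it halts, leaves everything except `X`, `A` and the workspace unchanged, and establishes `Q`. -/
def Achieves (c : Cmd) (X : Set Var) (A : Set Arr) (σ : State) (Q : State → Prop) : Prop :=
  ∃ k τ, Exec c σ k τ ∧ OnlyChanges X A σ τ ∧ Q τ

/-! ## The algorithm -/

/-- Programs for the steps that the algorithm leaves open. -/
structure Subroutines where
  /-- find a minimal 2-edge-connected subgraph -/
  min2EC : Cmd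
  /-- calculate a minimal 2-vertex-connected subgraph -/
  min2VC : Cmd
  /-- choose a vertex `q ∈ V \ {y}` -/
  chooseQ : Cmd
  /-- find a spanning tree rooted at `q` of `G \ {y}` -/
  tree : Cmd
  /-- find a spanning tree rooted at `q` of `Gᴿ \ {y}` -/
  treeRev : Cmd
  /-- select a vertex `w ∈ V \ T` -/
  chooseW : Cmd
  /-- determine two independent trees rooted at `w` of `G` -/
  indep : Cmd
  /-- determine two independent trees rooted at `w` of `Gᴿ` -/
  indepRev : Cmd

/-- Each subroutine does what its name says. -/
structure Subroutines.Correct (S : Subroutines) : Prop where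
  min2EC : ∀ {n m : ℕ} (e : Fin m → Fin n × Fin n) (σ : State), 3 ≤ n → Function.Injective e →
    HoldsGraph σ e → Is2EdgeConnected (Set.range e) →
    Achieves S.min2EC ∅ {Arr.out} σ fun τ =>
      IsMinimalSubgraph Is2EdgeConnected (Set.range e) (marked τ Arr.out e)
  min2VC : ∀ {n m : ℕ} (e : Fin m → Fin n × Fin n) (σ : State), 3 ≤ n → Function.Injective e →
    HoldsGraph σ e → Is2VertexConnected (Set.range e) →
    Achieves S.min2VC ∅ {Arr.out} σ fun τ =>
      IsMinimalSubgraph Is2VertexConnected (Set.range e) (marked τ Arr.out e)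
  chooseQ : ∀ {n m : ℕ} (e : Fin m → Fin n × Fin n) (σ : State) (y : Fin n), 3 ≤ n →
    HoldsGraph σ e → σ.var Var.y = y →
    Achieves S.chooseQ {Var.q} ∅ σ fun τ => ∃ q : Fin n, q ≠ y ∧ τ.var Var.q = q
  tree : ∀ {n m : ℕ} (e : Fin m → Fin n × Fin n) (σ : State) (y q : Fin n), 3 ≤ n →
    Function.Injective e → HoldsGraph σ e → σ.var Var.y = y → σ.var Var.q = q → q ≠ y →
    (∀ v, v ≠ y → Reach (delVertex (Set.range e) y) q v) →
    Achieves S.tree ∅ {Arr.tree₁} σ fun τ =>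
      IsSpanningTree {y}ᶜ (delVertex (Set.range e) y) q (marked τ Arr.tree₁ e)
  treeRev : ∀ {n m : ℕ} (e : Fin m → Fin n × Fin n) (σ : State) (y q : Fin n), 3 ≤ n →
    Function.Injective e → HoldsGraph σ e → σ.var Var.y = y → σ.var Var.q = q → q ≠ y →
    (∀ v, v ≠ y → Reach (delVertex (Set.range (rev e)) y) q v) →
    Achieves S.treeRev ∅ {Arr.tree₂} σ fun τ =>
      IsSpanningTree {y}ᶜ (delVertex (Set.range (rev e)) y) q (marked τ Arr.tree₂ (rev e))
  chooseW : ∀ {n m t : ℕ} (e : Fin m → Fin n × Fin n) (T : Fin t → Fin n) (σ : State), 3 ≤ n →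
    Function.Injective T → HoldsGraph σ e → HoldsTerminals σ T → Set.range T ≠ Set.univ →
    Achieves S.chooseW {Var.w} ∅ σ fun τ => ∃ w : Fin n, w ∉ Set.range T ∧ τ.var Var.w = w
  indep : ∀ {n m : ℕ} (e : Fin m → Fin n × Fin n) (σ : State) (w : Fin n), 3 ≤ n →
    Function.Injective e → HoldsGraph σ e → σ.var Var.w = w →
    (∀ v, Reach (Set.range e) w v) →
    Achieves S.indep ∅ {Arr.tree₁, Arr.tree₂} σ fun τ =>
      AreIndependentTrees (Set.range e) w (marked τ Arr.tree₁ e) (marked τ Arr.tree₂ e)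
  indepRev : ∀ {n m : ℕ} (e : Fin m → Fin n × Fin n) (σ : State) (w : Fin n), 3 ≤ n →
    Function.Injective e → HoldsGraph σ e → σ.var Var.w = w →
    (∀ v, Reach (Set.range (rev e)) w v) →
    Achieves S.indepRev ∅ {Arr.rtree₁, Arr.rtree₂} σ fun τ =>
      AreIndependentTrees (Set.range (rev e)) w
        (marked τ Arr.rtree₁ (rev e)) (marked τ Arr.rtree₂ (rev e))

/-- "for `x = 0, …, b - 1` do `c`" -/
def forLoop (x b : Var) (c : Cmd) : Cmd :=
  Cmd.seq (Cmd.assign x (Expr.lit 0))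
    (Cmd.loop (Test.lt (Expr.var x) (Expr.var b))
      (Cmd.seq c (Cmd.assign x (Expr.succ (Expr.var x)))))

/-- "for each edge marked in `a`, add this edge to `E_α`"; here `E_α` is marked in `Arr.out`.
For a tree of `Gᴿ`, whose edges `(v, w)` are represented by the edges `(w, v)` of `G`, this adds
the edges `(w, v)`. -/
def addEdges (a : Arr) : Cmd :=
  forLoop Var.j Var.m
    (Cmd.ite (Test.lt (Expr.lit 0) (Expr.get a (Expr.var Var.j)))
      (Cmd.store Arr.out (Expr.var Var.j) (Expr.lit 1))
      Cmd.skip)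

/-- For each `y ∈ T`: choose `q ≠ y`, add a spanning tree of `G \ {y}` rooted at `q` and the
reversal of a spanning tree of `Gᴿ \ {y}` rooted at `q`. -/
def smallCase (S : Subroutines) : Cmd :=
  forLoop Var.i Var.t
    (Cmd.seq (Cmd.assign Var.y (Expr.get Arr.ter (Expr.var Var.i)))
    (Cmd.seq S.chooseQ
    (Cmd.seq S.tree
    (Cmd.seq (addEdges Arr.tree₁)
    (Cmd.seq S.treeRev
      (addEdges Arr.tree₂))))))

/-- Select `w ∉ T`, add two independent trees of `G` rooted at `w`, and the reversals of two
independent trees of `Gᴿ` rooted at `w`. -/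
def largeCase (S : Subroutines) : Cmd :=
  Cmd.seq S.chooseW
  (Cmd.seq S.indep
  (Cmd.seq (Cmd.seq (addEdges Arr.tree₁) (addEdges Arr.tree₂))
  (Cmd.seq S.indepRev
  (Cmd.seq (Cmd.seq (addEdges Arr.tree₁) (addEdges Arr.tree₂))
    (Cmd.seq (addEdges Arr.rtree₁) (addEdges Arr.rtree₂))))))

/-- The approximation algorithm. Input: `Var.n`, `Var.m`, `Arr.src`, `Arr.dst` (the graph) and
`Var.t`, `Arr.ter` (the set `T`, of `t` elements). Output: the edges marked in `Arr.out`. -/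
def algorithm1 (S : Subroutines) : Cmd :=
  Cmd.ite (Test.eq (Expr.var Var.t) (Expr.lit 0))
    S.min2EC
    (Cmd.ite (Test.eq (Expr.var Var.t) (Expr.var Var.n))
      S.min2VC
      (Cmd.seq S.min2EC
        (Cmd.ite (Test.and (Test.lt (Expr.lit 0) (Expr.var Var.t))
            (Test.not (Test.lt (Expr.lit 2) (Expr.var Var.t))))
          (smallCase S)
          (largeCase S))))

end TwoT

/-! The open steps are filled by explicit programs, each shown to be correct and to run in time
O((n+m)m) or better. A strongly connected graph on at least two vertices has n ≤ m
(`StronglyConnected.le_card_edges`), so all these bounds are O(m²). The basic tool is a linear-time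
graph search on an edge list (`search_spec`); costs are tracked by `Runs`, where a loop is charged
through a decreasing measure.

Minimal subgraphs. Both connectivity properties are monotone in the edge set, so one pass that
deletes every edge whose deletion is harmless ends in a minimal subgraph (`deleteLoop_spec`). It
makes at most m tests, each of which must take linear time. An edge (u,v) of a 2-edge-connected
graph may be deleted iff afterwards no single edge separates v from u (`Is2EdgeConnected.diff_iff`).
Two searches decide this: the first finds a path, the second looks for v after that path has been
reversed (`twoConn_iff_residual`, the augmenting path criterion for flow value two). For
2-vertex-connectivity the same test is made in the graph whose vertices are split into edges
(`IsSplit.twoConn_iff`).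

Spanning trees of G minus y are search trees.

Independent trees. Here O(n(n+m)) steps are affordable, so one search per vertex yields all
dominators. For an edge (p,v) such that v does not dominate p, the source is replaced by the topmost
dominator of p that does not dominate v, which is a sibling of v in the dominator tree, or by the
root if there is none. In this derived graph no vertex other than the root separates another vertex
from the root (`IsDerived.reach`). Its vertices are now removed one at a time, always the last one
in search order that has an edge from the root or from a removed vertex. The remaining vertices stay
reachable (`ShellInv.step`), so each v receives one derived edge from the root or an earlier vertex,
and one from the root or a later vertex. The corresponding original edges form two trees. Parents in
the first precede their children in a strict order combining dominance with the order of siblings;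
parents in the second do so for the opposite order of siblings. A vertex that precedes v in both
orders dominates v (`dom_of_precedes`), whence independence (`areIndependentTrees`). -/

namespace TwoT

/-! ## Program logic -/

/-- Started in `σ`, the program `c` halts after at most `K` steps in a state satisfying `Q`. -/
def Runs (c : Cmd) (σ : State) (K : ℕ) (Q : State → Prop) : Prop :=
  ∃ k τ, Exec c σ k τ ∧ k ≤ K ∧ Q τ

/-- The program `c` contains an assignment to the scalar `x`. -/
def Cmd.writesVar (x : Var) : Cmd → Bool
  | .skip => false
  | .assign y _ => decide (x = y)
  | .store _ _ _ => false
  | .seq c d => c.writesVar x || d.writesVar x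
  | .ite _ c d => c.writesVar x || d.writesVar x
  | .loop _ c => c.writesVar x

/-- The program `c` contains a store into the array `a`. -/
def Cmd.writesArr (a : Arr) : Cmd → Bool
  | .skip => false
  | .assign _ _ => false
  | .store b _ _ => decide (a = b)
  | .seq c d => c.writesArr a || d.writesArr a
  | .ite _ c d => c.writesArr a || d.writesArr a
  | .loop _ c => c.writesArr a

/-- `τ` agrees with `σ` on everything that `c` does not write. -/
structure Frame (c : Cmd) (σ τ : State) : Prop where
  var : ∀ x, c.writesVar x = false → τ.var x = σ.var x
  arr : ∀ a, c.writesArr a = false → τ.arr a = σ.arr a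

/-- The frame is read off the program text, so for concrete programs its side conditions reduce by
computation, and loop invariants need mention only what changes. -/
theorem Exec.frame {c : Cmd} {σ τ : State} {k : ℕ} (h : Exec c σ k τ) : Frame c σ τ := by
  induction h with
  | skip σ => exact ⟨fun _ _ => rfl, fun _ _ => rfl⟩
  | assign σ x e =>
    refine ⟨fun y hy => ?_, fun _ _ => rfl⟩
    have : y ≠ x := by simpa [Cmd.writesVar] using hy
    simp [State.setVar, this]
  | store σ a i e =>
    refine ⟨fun _ _ => rfl, fun b hb => ?_⟩
    have : b ≠ a := by simpa [Cmd.writesArr] using hb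
    simp [State.setArr, this]
  | seq _ _ ih₁ ih₂ =>
    refine ⟨fun x hx => ?_, fun a ha => ?_⟩
    · simp only [Cmd.writesVar, Bool.or_eq_false_iff] at hx
      rw [ih₂.var x hx.2, ih₁.var x hx.1]
    · simp only [Cmd.writesArr, Bool.or_eq_false_iff] at ha
      rw [ih₂.arr a ha.2, ih₁.arr a ha.1]
  | ite_true _ _ ih =>
    refine ⟨fun x hx => ?_, fun a ha => ?_⟩
    · simp only [Cmd.writesVar, Bool.or_eq_false_iff] at hx
      exact ih.var x hx.1
    · simp only [Cmd.writesArr, Bool.or_eq_false_iff] at ha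
      exact ih.arr a ha.1
  | ite_false _ _ ih =>
    refine ⟨fun x hx => ?_, fun a ha => ?_⟩
    · simp only [Cmd.writesVar, Bool.or_eq_false_iff] at hx
      exact ih.var x hx.2
    · simp only [Cmd.writesArr, Bool.or_eq_false_iff] at ha
      exact ih.arr a ha.2
  | loop_true _ _ _ ih₁ ih₂ =>
    refine ⟨fun x hx => ?_, fun a ha => ?_⟩
    · rw [ih₂.var x hx, ih₁.var x hx]
    · rw [ih₂.arr a ha, ih₁.arr a ha]
  | loop_false _ => exact ⟨fun _ _ => rfl, fun _ _ => rfl⟩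

namespace Runs

variable {c d : Cmd} {σ : State} {K L : ℕ} {Q R : State → Prop}

theorem mono (h : Runs c σ K Q) (hK : K ≤ L) (hQ : ∀ τ, Q τ → R τ) : Runs c σ L R := by
  obtain ⟨k, τ, h₁, h₂, h₃⟩ := h
  exact ⟨k, τ, h₁, h₂.trans hK, hQ τ h₃⟩

/-- The postcondition may use the frame of the program. -/
theorem consequence (h : Runs c σ K Q) (hK : K ≤ L) (hQ : ∀ τ, Frame c σ τ → Q τ → R τ) :
    Runs c σ L R := by
  obtain ⟨k, τ, h₁, h₂, h₃⟩ := h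
  exact ⟨k, τ, h₁, h₂.trans hK, hQ τ h₁.frame h₃⟩

theorem seq (h : Runs c σ K fun ρ => Runs d ρ L Q) : Runs (Cmd.seq c d) σ (K + L) Q := by
  obtain ⟨k, ρ, h₁, h₂, l, τ, h₃, h₄, h₅⟩ := h
  exact ⟨k + l, τ, Exec.seq h₁ h₃, Nat.add_le_add h₂ h₄, h₅⟩

/-- Sequential composition; the second program may use the frame of the first. -/
theorem bind (h : Runs c σ K R) (h' : ∀ ρ, Frame c σ ρ → R ρ → Runs d ρ L Q) :
    Runs (Cmd.seq c d) σ (K + L) Q :=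
  seq (h.consequence le_rfl h')

theorem ite {b : Test} (h₁ : b.holds σ → Runs c σ K Q) (h₂ : ¬ b.holds σ → Runs d σ K Q) :
    Runs (Cmd.ite b c d) σ (b.cost + K) Q := by
  by_cases hb : b.holds σ
  · obtain ⟨k, τ, h, hk, hQ⟩ := h₁ hb
    exact ⟨_, τ, Exec.ite_true hb h, by omega, hQ⟩
  · obtain ⟨k, τ, h, hk, hQ⟩ := h₂ hb
    exact ⟨_, τ, Exec.ite_false hb h, by omega, hQ⟩

theorem assign {x : Var} {e : Expr} (h : Q (σ.setVar x (e.eval σ))) :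
    Runs (Cmd.assign x e) σ (e.cost + 1) Q :=
  ⟨_, _, Exec.assign σ x e, le_rfl, h⟩

/-- Every iteration lowers the measure and is paid for by one unit of it; the extra unit pays for
the final failing test. -/
theorem loop_aux {b : Test} {I : ℕ → State → Prop} {k : ℕ} {B : ℕ}
    (hstep : ∀ k ≤ B, ∀ σ, I k σ → b.holds σ → Runs c σ K fun τ => ∃ k' < k, I k' τ)
    (hkB : k ≤ B) (h : I k σ) :
    Runs (Cmd.loop b c) σ ((K + b.cost) * (k + 1)) fun τ => (∃ k' ≤ B, I k' τ) ∧ ¬ b.holds τ := by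
  induction k using Nat.strong_induction_on generalizing σ with
  | _ k ih =>
    by_cases hb : b.holds σ
    · obtain ⟨t, ρ, h₁, h₂, k', hk', hI⟩ := hstep k hkB σ h hb
      obtain ⟨l, τ, h₃, h₄, h₅⟩ := ih k' hk' (by omega) hI
      refine ⟨_, τ, Exec.loop_true hb h₁ h₃, ?_, h₅⟩
      have : (K + b.cost) * (k' + 1 + 1) ≤ (K + b.cost) * (k + 1) :=
        Nat.mul_le_mul_left _ (by omega)
      have h₆ : (K + b.cost) * (k' + 1 + 1) = (K + b.cost) * (k' + 1) + (K + b.cost) := by ring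
      omega
    · refine ⟨_, σ, Exec.loop_false hb, ?_, ⟨k, hkB, h⟩, hb⟩
      calc b.cost ≤ (K + b.cost) * 1 := by omega
        _ ≤ _ := Nat.mul_le_mul_left _ (by omega)

theorem loop {b : Test} {I : ℕ → State → Prop} {B : ℕ}
    (hstep : ∀ k ≤ B, ∀ σ, I k σ → b.holds σ → Runs c σ K fun τ => ∃ k' < k, I k' τ)
    (h : ∃ k ≤ B, I k σ) :
    Runs (Cmd.loop b c) σ ((K + b.cost) * (B + 1)) fun τ =>
      (∃ k' ≤ B, I k' τ) ∧ ¬ b.holds τ := by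
  obtain ⟨k, hk, hI⟩ := h
  exact (loop_aux hstep hk hI).mono (Nat.mul_le_mul_left _ (by omega)) fun _ => id

end Runs

/-- Bound on the running time of a program without loops. -/
def Cmd.bound : Cmd → ℕ
  | .skip => 1
  | .assign _ e => e.cost + 1
  | .store _ i e => i.cost + e.cost + 1
  | .seq c d => c.bound + d.bound
  | .ite b c d => b.cost + (c.bound + d.bound)
  | .loop _ _ => 0

/-- Weakest precondition of a program without loops. -/
def Cmd.wp (Q : State → Prop) : Cmd → State → Prop
  | .skip, σ => Q σ
  | .assign x e, σ => Q (σ.setVar x (e.eval σ))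
  | .store a i e, σ => Q (σ.setArr a (i.eval σ) (e.eval σ))
  | .seq c d, σ => c.wp (fun τ => d.wp Q τ) σ
  | .ite b c d, σ => (b.holds σ → c.wp Q σ) ∧ (¬ b.holds σ → d.wp Q σ)
  | .loop _ _, _ => False

theorem Cmd.runs_of_wp {c : Cmd} {σ : State} {Q : State → Prop} (h : c.wp Q σ) :
    Runs c σ c.bound Q := by
  induction c generalizing σ Q with
  | skip => exact ⟨_, _, Exec.skip σ, le_rfl, h⟩
  | assign x e => exact ⟨_, _, Exec.assign σ x e, le_rfl, h⟩
  | store a i e => exact ⟨_, _, Exec.store σ a i e, le_rfl, h⟩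
  | seq c d ihc ihd => exact Runs.seq ((ihc h).mono le_rfl fun τ hτ => ihd hτ)
  | ite b c d ihc ihd =>
    exact Runs.ite (fun hb => (ihc (h.1 hb)).mono (Nat.le_add_right _ _) fun _ => id)
      (fun hb => (ihd (h.2 hb)).mono (Nat.le_add_left _ _) fun _ => id)
  | loop b c _ => exact h.elim

@[simp] theorem State.setVar_var (σ : State) (x y : Var) (k : ℕ) :
    (σ.setVar x k).var y = if y = x then k else σ.var y := by
  simp [State.setVar, Function.update_apply]

@[simp] theorem State.setVar_arr (σ : State) (x : Var) (k : ℕ) :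
    (σ.setVar x k).arr = σ.arr := rfl

@[simp] theorem State.setArr_var (σ : State) (a : Arr) (i k : ℕ) :
    (σ.setArr a i k).var = σ.var := rfl

@[simp] theorem State.setArr_arr (σ : State) (a b : Arr) (i k : ℕ) :
    (σ.setArr a i k).arr b = if b = a then Function.update (σ.arr a) i k else σ.arr b := by
  simp [State.setArr, Function.update_apply]

attribute [simp] Cmd.wp Expr.eval Test.holds

/-- The body may assume the frame of the whole loop relative to the initial state, so data that the
loop never writes stay out of the invariant. -/
theorem runs_forLoop {x b : Var} {c : Cmd} {K B : ℕ} {σ : State} (I : ℕ → State → Prop)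
    (hxb : b ≠ x) (hx : c.writesVar x = false) (hb : c.writesVar b = false) (hB : σ.var b = B)
    (h0 : I 0 (σ.setVar x 0))
    (hstep : ∀ i < B, ∀ ρ, Frame (forLoop x b c) σ ρ → ρ.var x = i → I i ρ →
      Runs c ρ K fun τ => I (i + 1) (τ.setVar x (i + 1))) :
    Runs (forLoop x b c) σ ((K + 8) * (B + 1)) (I B) := by
  have hbf : (forLoop x b c).writesVar b = false := by simp [forLoop, Cmd.writesVar, hb, hxb]
  have hfr : ∀ ρ τ, Frame (Cmd.seq c (Cmd.assign x (Expr.succ (Expr.var x)))) ρ τ →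
      Frame (forLoop x b c) σ ρ → Frame (forLoop x b c) σ τ := by
    intro ρ τ h h'
    refine ⟨fun y hy => ?_, fun a ha => ?_⟩
    · rw [h.var y, h'.var y hy]
      simp only [forLoop, Cmd.writesVar, Bool.or_eq_false_iff] at hy ⊢
      exact hy.2
    · rw [h.arr a, h'.arr a ha]
      simp only [forLoop, Cmd.writesArr, Bool.or_eq_false_iff] at ha ⊢
      exact ha.2
  -- The initial assignment costs 2, each increment 3 and each test 3. The measure is the number of
  -- iterations left.
  have key : Runs (forLoop x b c) σ (2 + (K + 3 + 3) * (B + 1)) fun τ =>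
      (∃ k' ≤ B, (Frame (forLoop x b c) σ τ ∧ τ.var x = B - k' ∧ I (B - k') τ)) ∧
        ¬ (Test.lt (Expr.var x) (Expr.var b)).holds τ := by
    refine Runs.bind (R := fun ρ => ρ = σ.setVar x 0) (Runs.assign rfl) ?_
    rintro ρ hρ rfl
    refine Runs.loop (b := Test.lt (Expr.var x) (Expr.var b))
      (I := fun k τ => Frame (forLoop x b c) σ τ ∧ τ.var x = B - k ∧ I (B - k) τ) ?_
      ⟨B, le_rfl, ?_⟩
    · rintro k hk ρ ⟨hf, hvx, hI⟩ hlt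
      have hvb : ρ.var b = B := by rw [hf.var b hbf, hB]
      simp only [Test.holds, Expr.eval, hvx, hvb] at hlt
      have h₁ := hstep (B - k) hlt ρ hf hvx hI
      have : Runs (Cmd.seq c (Cmd.assign x (Expr.succ (Expr.var x)))) ρ (K + 3) fun τ =>
          τ.var x = B - k + 1 ∧ I (B - k + 1) τ := by
        refine Runs.bind h₁ fun τ hτ hIτ => Runs.assign ?_
        have : τ.var x = B - k := by rw [hτ.var x hx, hvx]
        simpa [this] using hIτ
      refine this.consequence le_rfl fun τ hτ h => ⟨k - 1, by omega, hfr ρ τ hτ hf, ?_⟩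
      rwa [show B - (k - 1) = B - k + 1 by omega]
    · refine ⟨⟨fun y hy => ?_, fun a ha => rfl⟩, ?_, ?_⟩
      · have : y ≠ x := by
          rintro rfl
          simp [forLoop, Cmd.writesVar] at hy
        simp [this]
      · simp
      · simpa using h0
  refine key.mono ?_ ?_
  · nlinarith [Nat.zero_le (K * B)]
  · rintro τ ⟨⟨k, hk, hf, hx', hI⟩, hlt⟩
    have hvb : τ.var b = B := by rw [hf.var b hbf, hB]
    simp only [Test.holds, Expr.eval, hx', hvb] at hlt
    rwa [show B - k = B by omega] at hI

theorem runs_simpleLoop {x b : Var} {c : Cmd} {B : ℕ} {σ : State} (K : ℕ) (I : ℕ → State → Prop)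
    (hxb : b ≠ x) (hx : c.writesVar x = false) (hb : c.writesVar b = false) (hK : c.bound ≤ K)
    (hB : σ.var b = B) (h0 : I 0 (σ.setVar x 0))
    (hstep : ∀ i < B, ∀ ρ, Frame (forLoop x b c) σ ρ → ρ.var x = i → I i ρ →
      c.wp (fun τ => I (i + 1) (τ.setVar x (i + 1))) ρ) :
    Runs (forLoop x b c) σ ((K + 8) * (B + 1)) (I B) :=
  runs_forLoop I hxb hx hb hB h0 fun i hi ρ hρ hi' hI =>
    (Cmd.runs_of_wp (hstep i hi ρ hρ hi' hI)).mono hK fun _ => id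

theorem Runs.simple {c : Cmd} {σ : State} {Q : State → Prop} (K : ℕ) (hK : c.bound ≤ K)
    (h : c.wp Q σ) : Runs c σ K Q :=
  (Cmd.runs_of_wp h).mono hK fun _ => id

theorem onlyChanges_of_frame {c : Cmd} {σ τ : State} {X : Set Var} {A : Set Arr}
    (h : Frame c σ τ) (hX : ∀ x, x ∉ X → (∀ k, x ≠ Var.tmp k) → c.writesVar x = false)
    (hA : ∀ a, a ∉ A → (∀ k, a ≠ Arr.tmp k) → c.writesArr a = false) : OnlyChanges X A σ τ :=
  ⟨fun x h₁ h₂ => h.var x (hX x h₁ h₂), fun a h₁ h₂ => h.arr a (hA a h₁ h₂)⟩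

/-! ## Graph search on an edge list -/

-- Queue positions below `vHead` have been taken, those below `vCount` are filled. `vPtr` is the
-- number plus one of the edge to be looked at next, and 0 when the current adjacency list is
-- exhausted.
@[simp] abbrev vN : Var := Var.tmp 0
@[simp] abbrev vM : Var := Var.tmp 1
@[simp] abbrev vRoot : Var := Var.tmp 2
@[simp] abbrev vX : Var := Var.tmp 3
@[simp] abbrev vHead : Var := Var.tmp 4
@[simp] abbrev vCount : Var := Var.tmp 5
@[simp] abbrev vPtr : Var := Var.tmp 6
@[simp] abbrev aS : Arr := Arr.tmp 0
@[simp] abbrev aD : Arr := Arr.tmp 1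
@[simp] abbrev aAlive : Arr := Arr.tmp 2
@[simp] abbrev aHead : Arr := Arr.tmp 3
@[simp] abbrev aNext : Arr := Arr.tmp 4
@[simp] abbrev aPar : Arr := Arr.tmp 5
@[simp] abbrev aQueue : Arr := Arr.tmp 6

/-- Build the adjacency lists of the alive edges: `head x` is the last edge with source `x`, and
`next i` is the previous edge with the same source as `i` (edge numbers are stored plus one). -/
def buildLists : Cmd :=
  Cmd.seq (forLoop vX vN (Cmd.seq (Cmd.store aHead (Expr.var vX) (Expr.lit 0))
      (Cmd.store aPar (Expr.var vX) (Expr.lit 0))))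
    (forLoop vX vM (Cmd.ite (Test.eq (Expr.get aAlive (Expr.var vX)) (Expr.lit 0)) Cmd.skip
      (Cmd.seq (Cmd.store aNext (Expr.var vX) (Expr.get aHead (Expr.get aS (Expr.var vX))))
        (Cmd.store aHead (Expr.get aS (Expr.var vX)) (Expr.succ (Expr.var vX))))))

/-- The root is marked as found by M + 1, a nonzero value that encodes no edge. -/
def searchInit : Cmd :=
  Cmd.seq (Cmd.store aQueue (Expr.lit 0) (Expr.var vRoot))
  (Cmd.seq (Cmd.store aPar (Expr.var vRoot) (Expr.succ (Expr.var vM)))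
  (Cmd.seq (Cmd.assign vHead (Expr.lit 0))
  (Cmd.seq (Cmd.assign vCount (Expr.lit 1)) (Cmd.assign vPtr (Expr.lit 0)))))

/-- Take the next vertex from the queue, or look at the next edge of the current vertex. -/
def searchStep : Cmd :=
  Cmd.ite (Test.eq (Expr.var vPtr) (Expr.lit 0))
    (Cmd.seq (Cmd.assign vPtr (Expr.get aHead (Expr.get aQueue (Expr.var vHead))))
      (Cmd.assign vHead (Expr.succ (Expr.var vHead))))
    (Cmd.seq
      (Cmd.ite (Test.eq (Expr.get aPar (Expr.get aD (Expr.pred (Expr.var vPtr)))) (Expr.lit 0))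
        (Cmd.seq (Cmd.store aPar (Expr.get aD (Expr.pred (Expr.var vPtr))) (Expr.var vPtr))
        (Cmd.seq (Cmd.store aQueue (Expr.var vCount) (Expr.get aD (Expr.pred (Expr.var vPtr))))
          (Cmd.assign vCount (Expr.succ (Expr.var vCount)))))
        Cmd.skip)
      (Cmd.assign vPtr (Expr.get aNext (Expr.pred (Expr.var vPtr)))))

def searchTest : Test :=
  Test.not (Test.and (Test.eq (Expr.var vPtr) (Expr.lit 0))
    (Test.not (Test.lt (Expr.var vHead) (Expr.var vCount))))

/-- Search the graph with vertices `0, …, vN - 1` and edges `(aS i, aD i)` for those `i < vM`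
with `aAlive i ≠ 0`, starting at `vRoot`. -/
def search : Cmd :=
  Cmd.seq buildLists (Cmd.seq searchInit (Cmd.loop searchTest searchStep))

/-- `q 0, …, q (c - 1)` are the vertices found by a search from `r`, in this order, and `par x - 1`
is the edge through which `x` was found. -/
structure Found (N M : ℕ) (S D al : ℕ → ℕ) (r : ℕ) (q : ℕ → ℕ) (c : ℕ) (par : ℕ → ℕ) :
    Prop where
  root : q 0 = r
  pos : 0 < c
  lt : ∀ j < c, q j < N
  inj : ∀ j < c, ∀ j' < c, q j = q j' → j = j'
  par_iff : ∀ x < N, par x ≠ 0 ↔ ∃ j < c, q j = x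
  tree : ∀ j, 0 < j → j < c →
    ∃ i < M, par (q j) = i + 1 ∧ al i ≠ 0 ∧ D i = q j ∧ ∃ j' < j, S i = q j'

/-- The search is complete. -/
structure Searched (N M : ℕ) (S D al : ℕ → ℕ) (r : ℕ) (q : ℕ → ℕ) (c : ℕ) (par : ℕ → ℕ) : Prop
    extends Found N M S D al r q c par where
  closed : ∀ i < M, al i ≠ 0 → ∀ j < c, S i = q j → ∃ j' < c, D i = q j'

/-- `head` and `next` are adjacency lists of the first `k` edges. -/
structure AdjLists (N k : ℕ) (S al head next : ℕ → ℕ) : Prop where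
  head_edge : ∀ x < N, ∀ p, head x = p + 1 → p < k ∧ al p ≠ 0 ∧ S p = x
  head_top : ∀ j < k, al j ≠ 0 → j < head (S j)
  next_edge : ∀ p < k, al p ≠ 0 → ∀ p', next p = p' + 1 → p' < p ∧ al p' ≠ 0 ∧ S p' = S p
  next_top : ∀ p < k, al p ≠ 0 → ∀ j < p, al j ≠ 0 → S j = S p → j < next p

theorem AdjLists.succ_dead {N k : ℕ} {S al head next : ℕ → ℕ} (h : AdjLists N k S al head next)
    (hk : al k = 0) : AdjLists N (k + 1) S al head next := by
  have aux : ∀ j < k + 1, al j ≠ 0 → j < k := fun j hj hj' => by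
    rcases Nat.lt_succ_iff_lt_or_eq.1 hj with h | rfl
    · exact h
    · exact absurd hk hj'
  refine ⟨fun x hx p hp => ?_, fun j hj hj' => h.head_top j (aux j hj hj') hj',
    fun p hp hp' => h.next_edge p (aux p hp hp') hp',
    fun p hp hp' => h.next_top p (aux p hp hp') hp'⟩
  obtain ⟨h₁, h₂⟩ := h.head_edge x hx p hp
  exact ⟨by omega, h₂⟩

/-- The new edge has the largest number so far, so putting it at the front keeps every list
decreasing and complete. -/
theorem AdjLists.succ_alive {N k : ℕ} {S al head next : ℕ → ℕ} (h : AdjLists N k S al head next)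
    (hk : al k ≠ 0) (hS : S k < N) :
    AdjLists N (k + 1) S al (Function.update head (S k) (k + 1))
      (Function.update next k (head (S k))) := by
  refine ⟨fun x hx p hp => ?_, fun j hj hj' => ?_, fun p hp hp' p' hpp' => ?_,
    fun p hp hp' j hj hj' hS' => ?_⟩
  · by_cases hxk : x = S k
    · subst hxk
      simp only [Function.update_self, Nat.add_right_cancel_iff] at hp
      subst hp
      exact ⟨by omega, hk, rfl⟩
    · rw [Function.update_of_ne hxk] at hp
      obtain ⟨h₁, h₂⟩ := h.head_edge x hx p hp
      exact ⟨by omega, h₂⟩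
  · by_cases hxk : S j = S k
    · rw [hxk, Function.update_self]; omega
    · rw [Function.update_of_ne hxk]
      refine h.head_top j ?_ hj'
      have : j ≠ k := fun h => hxk (h ▸ rfl)
      omega
  · by_cases hpk : p = k
    · subst hpk
      rw [Function.update_self] at hpp'
      exact h.head_edge _ hS p' hpp'
    · rw [Function.update_of_ne hpk] at hpp'
      exact h.next_edge p (by omega) hp' p' hpp'
  · by_cases hpk : p = k
    · subst hpk
      rw [Function.update_self, ← hS']
      exact h.head_top j hj hj'
    · rw [Function.update_of_ne hpk]
      exact h.next_top p (by omega) hp' j hj hj' hS'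

/-- The edges already looked at. -/
def Done (S al : ℕ → ℕ) (q : ℕ → ℕ) (h ptr i : ℕ) : Prop :=
  al i ≠ 0 ∧ ∃ j < h, S i = q j ∧ (j + 1 < h ∨ ptr ≤ i)

/-- The first h queue vertices have been taken, and q (h - 1) is the one being scanned. Lists are
decreasing, so its edges with numbers at least `ptr` are those already handled. -/
structure SearchInv (N M : ℕ) (S D al : ℕ → ℕ) (r : ℕ) (q : ℕ → ℕ) (c : ℕ) (par : ℕ → ℕ)
    (h ptr : ℕ) : Prop extends Found N M S D al r q c par where
  h_le : h ≤ c
  ptr_edge : ∀ p, ptr = p + 1 → 0 < h ∧ p < M ∧ al p ≠ 0 ∧ S p = q (h - 1)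
  done : ∀ i < M, Done S al q h ptr i → ∃ j < c, D i = q j

open Classical in
/-- The number of steps that a search will still make. -/
noncomputable def searchMeasure (N M : ℕ) (S al q : ℕ → ℕ) (h ptr : ℕ) : ℕ :=
  (N - h) + ((Finset.range M).filter fun i => ¬ Done S al q h ptr i).card

theorem Found.count_le {N M : ℕ} {S D al : ℕ → ℕ} {r : ℕ} {q : ℕ → ℕ} {c : ℕ} {par : ℕ → ℕ}
    (h : Found N M S D al r q c par) : c ≤ N := by
  have := Finset.card_le_card_of_injOn (s := Finset.range c) (t := Finset.range N) q
    (fun j hj => by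
      simp only [Finset.coe_range, Set.mem_Iio] at hj ⊢
      exact h.lt j hj)
    (fun j hj j' hj' => by
      simp only [Finset.coe_range, Set.mem_Iio] at hj hj'
      exact h.inj j hj j' hj')
  simpa using this

-- With pointer 0 the current list is exhausted, and every alive edge of the vertex taken next lies
-- below its list head. Hence no edge gains or loses the status `Done`, while h grows; it stays at
-- most N by `Found.count_le`.
open Classical in
theorem SearchInv.pop {N M : ℕ} {S D al : ℕ → ℕ} {r : ℕ} {q : ℕ → ℕ} {c : ℕ} {par : ℕ → ℕ}
    {h : ℕ} {head next : ℕ → ℕ} (hL : AdjLists N M S al head next)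
    (H : SearchInv N M S D al r q c par h 0) (hc : h < c) :
    SearchInv N M S D al r q c par (h + 1) (head (q h)) ∧
      searchMeasure N M S al q (h + 1) (head (q h)) < searchMeasure N M S al q h 0 := by
  have hN := H.count_le
  have hd : ∀ i < M, Done S al q (h + 1) (head (q h)) i → Done S al q h 0 i := by
    rintro i hi ⟨h₁, j, hj, hS, h₂⟩
    refine ⟨h₁, j, ?_, hS, Or.inr (Nat.zero_le _)⟩
    rcases h₂ with h₂ | h₂
    · omega
    · by_contra hjh
      have : j = h := by omega
      subst this
      have := hL.head_top i hi h₁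
      rw [hS] at this
      omega
  have hd' : ∀ i, Done S al q h 0 i → Done S al q (h + 1) (head (q h)) i := by
    rintro i ⟨h₁, j, hj, hS, h₂⟩
    exact ⟨h₁, j, by omega, hS, Or.inl (by omega)⟩
  refine ⟨⟨H.toFound, hc, fun p hp => ?_, fun i hi hi' => H.done i hi (hd i hi hi')⟩, ?_⟩
  · obtain ⟨h₁, h₂, h₃⟩ := hL.head_edge (q h) (H.lt h hc) p hp
    exact ⟨by omega, h₁, h₂, by simpa using h₃⟩
  · unfold searchMeasure
    have : ((Finset.range M).filter fun i => ¬ Done S al q (h + 1) (head (q h)) i).card ≤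
        ((Finset.range M).filter fun i => ¬ Done S al q h 0 i).card := by
      refine Finset.card_le_card fun i hi => ?_
      simp only [Finset.mem_filter] at hi ⊢
      exact ⟨hi.1, fun h => hi.2 (hd' i h)⟩
    omega

-- The edge p turns from unhandled to handled and nothing turns back. The queue may change beyond
-- position h, as it does when a vertex is appended.
open Classical in
theorem searchMeasure_lt {N M : ℕ} {S al q q' : ℕ → ℕ} {h p ptr : ℕ} (hpM : p < M)
    (hal : al p ≠ 0) (hh : 0 < h) (hp : S p = q (h - 1)) (hq : ∀ j < h, q' j = q j)
    (hinj : ∀ j < h, q j = q (h - 1) → j = h - 1) (hptr : ptr ≤ p) :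
    searchMeasure N M S al q' h ptr < searchMeasure N M S al q h (p + 1) := by
  unfold searchMeasure
  refine Nat.add_lt_add_left (Finset.card_lt_card ⟨fun i hi => ?_, fun hsub => ?_⟩) _
  · simp only [Finset.mem_filter] at hi ⊢
    refine ⟨hi.1, fun ⟨h₁, j, hj, hS, h₂⟩ => hi.2 ⟨h₁, j, hj, by rw [hq j hj, hS], ?_⟩⟩
    rcases h₂ with h₂ | h₂
    · exact Or.inl h₂
    · exact Or.inr (by omega)
  · have : p ∈ (Finset.range M).filter fun i => ¬ Done S al q h (p + 1) i := by
      simp only [Finset.mem_filter, Finset.mem_range]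
      refine ⟨hpM, fun ⟨_, j, hj, hS, h₂⟩ => ?_⟩
      have := hinj j hj (by rw [← hS, hp])
      omega
    have := hsub this
    simp only [Finset.mem_filter, Finset.mem_range] at this
    exact this.2 ⟨hal, h - 1, by omega, by rw [hq _ (by omega), hp], Or.inr hptr⟩

/-- The list skips no alive edge of the current vertex between p and its successor, so p is the only
edge that becomes handled. -/
theorem Done.of_next {N M : ℕ} {S al : ℕ → ℕ} {q : ℕ → ℕ} {h p : ℕ} {head next : ℕ → ℕ}
    (hL : AdjLists N M S al head next) (hpM : p < M) (hal : al p ≠ 0) (hp : S p = q (h - 1))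
    {i : ℕ} (hd : Done S al q h (next p) i) : Done S al q h (p + 1) i ∨ i = p := by
  obtain ⟨h₁, j, hj, hS, h₂⟩ := hd
  by_cases hjh : j + 1 < h
  · exact Or.inl ⟨h₁, j, hj, hS, Or.inl hjh⟩
  · have hj' : j = h - 1 := by omega
    subst hj'
    have h₃ : next p ≤ i := by omega
    by_cases hip : i < p
    · have := hL.next_top p hpM hal i hip h₁ (by rw [hS, hp])
      omega
    · by_cases hip' : i = p
      · exact Or.inr hip'
      · exact Or.inl ⟨h₁, _, hj, hS, Or.inr (by omega)⟩

theorem AdjLists.next_le {N M : ℕ} {S al head next : ℕ → ℕ} (hL : AdjLists N M S al head next)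
    {p : ℕ} (hpM : p < M) (hal : al p ≠ 0) : next p ≤ p := by
  rcases hn : next p with _ | p'
  · omega
  · exact (hL.next_edge p hpM hal p' hn).1

theorem SearchInv.inj_head {N M : ℕ} {S D al : ℕ → ℕ} {r : ℕ} {q : ℕ → ℕ} {c : ℕ}
    {par : ℕ → ℕ} {h ptr : ℕ} (H : SearchInv N M S D al r q c par h ptr) :
    ∀ j < h, q j = q (h - 1) → j = h - 1 := fun j hj hq => by
  have := H.h_le
  exact H.inj j (by omega) (h - 1) (by omega) hq

theorem SearchInv.scan_old {N M : ℕ} {S D al : ℕ → ℕ} {r : ℕ} {q : ℕ → ℕ} {c : ℕ} {par : ℕ → ℕ}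
    {h p : ℕ} {head next : ℕ → ℕ} (hL : AdjLists N M S al head next)
    (H : SearchInv N M S D al r q c par h (p + 1)) (hD : D p < N) (hpar : par (D p) ≠ 0) :
    SearchInv N M S D al r q c par h (next p) ∧
      searchMeasure N M S al q h (next p) < searchMeasure N M S al q h (p + 1) := by
  obtain ⟨hh, hpM, hal, hp⟩ := H.ptr_edge p rfl
  refine ⟨⟨H.toFound, H.h_le, fun p' hp' => ?_, fun i hi hi' => ?_⟩,
    searchMeasure_lt hpM hal hh hp (fun _ _ => rfl) H.inj_head (hL.next_le hpM hal)⟩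
  · obtain ⟨h₁, h₂, h₃⟩ := hL.next_edge p hpM hal p' hp'
    exact ⟨hh, by omega, h₂, by rw [h₃, hp]⟩
  · rcases hi'.of_next hL hpM hal hp with h₁ | rfl
    · exact H.done i hi h₁
    · obtain ⟨j, hj, hj'⟩ := (H.par_iff _ hD).1 hpar
      exact ⟨j, hj, hj'.symm⟩

/-- An unmarked end is not yet in the queue, so appending it keeps the queue injective; the source q
(h - 1) of its tree edge stands earlier. -/
theorem SearchInv.scan_new {N M : ℕ} {S D al : ℕ → ℕ} {r : ℕ} {q : ℕ → ℕ} {c : ℕ} {par : ℕ → ℕ}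
    {h p : ℕ} {head next : ℕ → ℕ} (hL : AdjLists N M S al head next)
    (H : SearchInv N M S D al r q c par h (p + 1)) (hD : D p < N) (hpar : par (D p) = 0) :
    SearchInv N M S D al r (Function.update q c (D p)) (c + 1)
        (Function.update par (D p) (p + 1)) h (next p) ∧
      searchMeasure N M S al (Function.update q c (D p)) h (next p) <
        searchMeasure N M S al q h (p + 1) := by
  obtain ⟨hh, hpM, hal, hp⟩ := H.ptr_edge p rfl
  have hhc := H.h_le
  have hc := H.pos
  have hq : ∀ j < c, Function.update q c (D p) j = q j := fun j hj =>
    Function.update_of_ne (by omega) _ _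
  have hnew : ∀ j < c, q j ≠ D p := fun j hj he =>
    (H.par_iff _ hD).2 ⟨j, hj, he⟩ hpar
  have hlast : Function.update q c (D p) c = D p := Function.update_self _ _ _
  refine ⟨⟨⟨?_, by omega, fun j hj => ?_, fun j hj j' hj' he => ?_, fun x hx => ?_,
    fun j hj hj' => ?_⟩, by omega, fun p' hp' => ?_, fun i hi hi' => ?_⟩,
    searchMeasure_lt hpM hal hh hp (fun j hj => hq j (by omega)) H.inj_head (hL.next_le hpM hal)⟩
  · rw [hq 0 hc, H.root]
  · rcases Nat.lt_succ_iff_lt_or_eq.1 hj with hj | rfl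
    · rw [hq j hj]; exact H.lt j hj
    · rwa [hlast]
  · rcases Nat.lt_succ_iff_lt_or_eq.1 hj with hj | rfl <;>
    rcases Nat.lt_succ_iff_lt_or_eq.1 hj' with hj' | rfl
    · rw [hq j hj, hq j' hj'] at he
      exact H.inj j hj j' hj' he
    · rw [hq j hj, hlast] at he
      exact absurd he (hnew j hj)
    · rw [hq j' hj', hlast] at he
      exact absurd he.symm (hnew j' hj')
    · rfl
  · by_cases hxD : x = D p
    · subst hxD
      simp only [Function.update_self, ne_eq, Nat.add_eq_zero_iff, one_ne_zero, and_false,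
        not_false_eq_true, true_iff]
      exact ⟨c, by omega, hlast⟩
    · rw [Function.update_of_ne hxD, H.par_iff x hx]
      constructor
      · rintro ⟨j, hj, hj'⟩
        exact ⟨j, by omega, by rw [hq j hj, hj']⟩
      · rintro ⟨j, hj, hj'⟩
        rcases Nat.lt_succ_iff_lt_or_eq.1 hj with hj | rfl
        · exact ⟨j, hj, by rw [← hj', hq j hj]⟩
        · exact absurd (hj'.symm.trans hlast) hxD
  · rcases Nat.lt_succ_iff_lt_or_eq.1 hj' with hj' | rfl
    · rw [hq j hj', Function.update_of_ne (hnew j hj')]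
      obtain ⟨i, hi, h₁, h₂, h₃, j', hj₁, hj₂⟩ := H.tree j hj hj'
      exact ⟨i, hi, h₁, h₂, h₃, j', hj₁, by rw [hq j' (by omega), hj₂]⟩
    · rw [hlast, Function.update_self]
      exact ⟨p, hpM, rfl, hal, rfl, h - 1, by omega, by rw [hq _ (by omega), hp]⟩
  · obtain ⟨h₁, h₂, h₃⟩ := hL.next_edge p hpM hal p' hp'
    exact ⟨hh, by omega, h₂, by rw [h₃, hp, hq _ (by omega)]⟩
  · have hi'' : Done S al q h (next p) i := by
      obtain ⟨h₁, j, hj, hS, h₂⟩ := hi'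
      exact ⟨h₁, j, hj, by rw [hS, hq _ (by omega)], h₂⟩
    rcases hi''.of_next hL hpM hal hp with h₁ | rfl
    · obtain ⟨j, hj, hj'⟩ := H.done i hi h₁
      exact ⟨j, by omega, by rw [hj', hq j hj]⟩
    · exact ⟨c, by omega, hlast.symm⟩

theorem SearchInv.searched {N M : ℕ} {S D al : ℕ → ℕ} {r : ℕ} {q : ℕ → ℕ} {c : ℕ} {par : ℕ → ℕ}
    {h : ℕ} (H : SearchInv N M S D al r q c par h 0) (hc : c ≤ h) :
    Searched N M S D al r q c par :=
  ⟨H.toFound, fun i hi hi' j hj hS =>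
    H.done i hi ⟨hi', j, by omega, hS, Or.inr (Nat.zero_le _)⟩⟩

theorem buildLists_spec {σ : State} {N M : ℕ} (hN : σ.var vN = N) (hM : σ.var vM = M)
    (hS : ∀ i < M, σ.arr aAlive i ≠ 0 → σ.arr aS i < N) :
    Runs buildLists σ (100 * (N + M + 1)) fun τ =>
      AdjLists N M (σ.arr aS) (σ.arr aAlive) (τ.arr aHead) (τ.arr aNext) ∧
        ∀ x < N, τ.arr aPar x = 0 := by
  refine (Runs.bind (runs_simpleLoop 20
      (I := fun k τ => (∀ x < k, τ.arr aHead x = 0) ∧ ∀ x < k, τ.arr aPar x = 0)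
      (by simp) rfl rfl (by decide) hN ?_ ?_) fun ρ hρ hIρ => (runs_simpleLoop 30
      (I := fun k τ => AdjLists N k (σ.arr aS) (σ.arr aAlive) (τ.arr aHead) (τ.arr aNext) ∧
        ∀ x < N, τ.arr aPar x = 0)
      (by simp) rfl rfl (by decide) (by rw [hρ.var _ rfl, hM]) ?_ ?_)).mono (by omega) fun _ => id
  · simp
  · intro i hi ρ hρ hx hI
    simp [hx]
    refine ⟨fun x hxi => ?_, fun x hxi => ?_⟩
    · by_cases h : x = i
      · simp [h]
      · simpa [h] using hI.1 x (by omega)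
    · by_cases h : x = i
      · simp [h]
      · simpa [h] using hI.2 x (by omega)
  · refine ⟨⟨fun x hx p hp => ?_, by simp, by simp, by simp⟩, by simpa using hIρ.2⟩
    have := hIρ.1 x hx
    simp at this hp
    omega
  · intro i hi τ hτ hx hI
    have h₁ : τ.arr aS = σ.arr aS := by rw [hτ.arr _ rfl, hρ.arr _ rfl]
    have h₂ : τ.arr aAlive = σ.arr aAlive := by rw [hτ.arr _ rfl, hρ.arr _ rfl]
    simp at h₁ h₂ hI hS
    simp [hx, h₁, h₂]
    exact ⟨fun h => ⟨hI.1.succ_dead h, hI.2⟩,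
      fun h => ⟨hI.1.succ_alive h (hS i hi h), hI.2⟩⟩

theorem searchInv_init {N M : ℕ} {S D al par : ℕ → ℕ} {r : ℕ} {q : ℕ → ℕ} (hr : r < N)
    (hpar : ∀ x < N, par x = 0) :
    SearchInv N M S D al r (Function.update q 0 r) 1 (Function.update par r (M + 1)) 0 0 := by
  have h1 : ∀ j, j < 1 → j = 0 := fun j hj => by omega
  refine ⟨⟨by simp, by simp, fun j hj => ?_, fun j hj j' hj' _ => ?_, fun x hx => ?_,
    fun j hj hj' => ?_⟩, by simp, by simp, ?_⟩
  · simpa [h1 j hj] using hr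
  · rw [h1 j hj, h1 j' hj']
  · by_cases h : x = r
    · simp [h]
    · simp [h, hpar x hx, Ne.symm h]
  · omega
  · rintro i hi ⟨_, j, hj, _⟩
    omega

theorem search_spec {σ : State} {N M r : ℕ} (hN : σ.var vN = N) (hM : σ.var vM = M)
    (hroot : σ.var vRoot = r) (hr : r < N)
    (hE : ∀ i < M, σ.arr aAlive i ≠ 0 → σ.arr aS i < N ∧ σ.arr aD i < N) :
    Runs search σ (300 * (N + M + 1)) fun τ =>
      Searched N M (σ.arr aS) (σ.arr aD) (σ.arr aAlive) r (τ.arr aQueue) (τ.var vCount)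
        (τ.arr aPar) := by
  refine (Runs.bind (buildLists_spec hN hM fun i hi h => (hE i hi h).1) fun ρ hρ hL =>
    (Runs.bind (R := fun τ =>
      AdjLists N M (σ.arr aS) (σ.arr aAlive) (τ.arr aHead) (τ.arr aNext) ∧
      τ.arr aAlive = σ.arr aAlive ∧ τ.arr aD = σ.arr aD ∧
      SearchInv N M (σ.arr aS) (σ.arr aD) (σ.arr aAlive) r (τ.arr aQueue) (τ.var vCount)
        (τ.arr aPar) (τ.var vHead) (τ.var vPtr))
      (Runs.simple 20 (by decide) ?_) fun τ₀ hτ₀ hI =>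
    -- At most N vertices are taken and at most M edges scanned, which bounds the initial measure.
    (Runs.loop (c := searchStep) (b := searchTest) (K := 60) (B := N + M) (I := fun k τ =>
      (AdjLists N M (σ.arr aS) (σ.arr aAlive) (τ.arr aHead) (τ.arr aNext) ∧
      τ.arr aAlive = σ.arr aAlive ∧ τ.arr aD = σ.arr aD ∧
      SearchInv N M (σ.arr aS) (σ.arr aD) (σ.arr aAlive) r (τ.arr aQueue) (τ.var vCount)
        (τ.arr aPar) (τ.var vHead) (τ.var vPtr)) ∧
      searchMeasure N M (σ.arr aS) (σ.arr aAlive) (τ.arr aQueue) (τ.var vHead) (τ.var vPtr) = k)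
      ?_ ⟨_, ?_, hI, rfl⟩))).mono (L := 300 * (N + M + 1)) ?_ ?_
  · have h₁ : ρ.arr aAlive = σ.arr aAlive := hρ.arr _ rfl
    have h₂ : ρ.arr aD = σ.arr aD := hρ.arr _ rfl
    have h₃ : ρ.var vRoot = r := by rw [hρ.var _ rfl, hroot]
    have h₄ : ρ.var vM = M := by rw [hρ.var _ rfl, hM]
    simp at h₁ h₂ h₃ h₄ hL
    simp [searchInit, h₁, h₂, h₃, h₄]
    exact ⟨hL.1, searchInv_init hr hL.2⟩
  · rintro k - τ ⟨⟨hL, hal, hD, H⟩, hk⟩ hb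
    refine Runs.simple _ (by decide) ?_
    simp [searchTest] at hb
    simp at H hL hal hD hk hE
    simp [searchStep, hal, hD]
    refine ⟨fun h0 => ?_, fun h0 => ?_⟩
    · rw [h0] at H hk
      obtain ⟨h₁, h₂⟩ := H.pop hL (hb h0)
      exact ⟨by omega, hL, h₁⟩
    · obtain ⟨p, hp⟩ := Nat.exists_eq_succ_of_ne_zero h0
      rw [Nat.succ_eq_add_one] at hp
      rw [hp] at H hk
      simp only [hp, Nat.add_sub_cancel]
      obtain ⟨_, hpM, hal', _⟩ := H.ptr_edge p rfl
      have hDp := (hE p hpM hal').2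
      refine ⟨fun h => ?_, fun h => ?_⟩
      · obtain ⟨h₁, h₂⟩ := H.scan_new hL hDp h
        exact ⟨by omega, hL, h₁⟩
      · obtain ⟨h₁, h₂⟩ := H.scan_old hL hDp h
        exact ⟨by omega, hL, h₁⟩
  · classical
    unfold searchMeasure
    have := Finset.card_filter_le (Finset.range M)
      fun i => ¬ Done (σ.arr aS) (σ.arr aAlive) (τ₀.arr aQueue) (τ₀.var vHead) (τ₀.var vPtr) i
    rw [Finset.card_range] at this
    convert Nat.add_le_add (Nat.sub_le N (τ₀.var vHead)) this using 1
  · rw [show searchTest.cost = 9 from rfl]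
    omega
  · rintro τ ⟨⟨k, _, ⟨_, _, _, H⟩, _⟩, hb⟩
    simp [searchTest] at hb
    simp at H ⊢
    rw [hb.1] at H
    exact H.searched hb.2

/-! ## Two edge-disjoint paths -/

/-- The edges in use. -/
def live (M : ℕ) (al : ℕ → ℕ) : Set ℕ := {i | i < M ∧ al i ≠ 0}

/-- There is a path from `u` to `v` along the edges `(S i, D i)`, `i ∈ A`. -/
def Conn (A : Set ℕ) (S D : ℕ → ℕ) (u v : ℕ) : Prop :=
  Relation.ReflTransGen (fun x y => ∃ i ∈ A, S i = x ∧ D i = y) u v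

theorem Conn.mono {A B : Set ℕ} {S D : ℕ → ℕ} {u v : ℕ} (h : Conn A S D u v) (hAB : A ⊆ B) :
    Conn B S D u v :=
  Relation.ReflTransGen.mono (fun _ _ ⟨i, hi, h⟩ => ⟨i, hAB hi, h⟩) _ _ h

theorem Conn.mem_of_closed {A : Set ℕ} {S D : ℕ → ℕ} {u v : ℕ} (h : Conn A S D u v) {R : Set ℕ}
    (hu : u ∈ R) (hR : ∀ i ∈ A, S i ∈ R → D i ∈ R) : v ∈ R := by
  induction h with
  | refl => exact hu
  | tail _ hs ih =>
    obtain ⟨i, hi, rfl, rfl⟩ := hs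
    exact hR i hi ih

/-- If `v` cannot be reached, then there is a cut. -/
theorem exists_cut {A : Set ℕ} {S D : ℕ → ℕ} {u v : ℕ} (h : ¬ Conn A S D u v) :
    ∃ R : Set ℕ, u ∈ R ∧ v ∉ R ∧ ∀ i ∈ A, S i ∈ R → D i ∈ R :=
  ⟨{x | Conn A S D u x}, Relation.ReflTransGen.refl, h,
    fun i hi hS => Relation.ReflTransGen.tail hS ⟨i, hi, rfl, rfl⟩⟩

/-- Found vertices are connected to the root through their tree edges, by induction on the queue
position. Conversely the found set contains the root and is closed under live edges. -/
theorem Searched.par_ne_zero_iff {N M : ℕ} {S D al : ℕ → ℕ} {r : ℕ} {q : ℕ → ℕ} {c : ℕ}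
    {par : ℕ → ℕ} (h : Searched N M S D al r q c par) {x : ℕ} (hx : x < N) :
    par x ≠ 0 ↔ Conn (live M al) S D r x := by
  rw [h.par_iff x hx]
  constructor
  · rintro ⟨j, hj, rfl⟩
    clear hx
    induction j using Nat.strong_induction_on with
    | _ j ih =>
      rcases Nat.eq_zero_or_pos j with rfl | hpos
      · rw [h.root]; exact Relation.ReflTransGen.refl
      · obtain ⟨i, hi, _, hal, hD, j', hj', hS⟩ := h.tree j hpos hj
        exact (ih j' hj' (by omega)).tail ⟨i, ⟨hi, hal⟩, hS, hD⟩
  · intro hc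
    exact hc.mem_of_closed (R := {x | ∃ j < c, q j = x}) ⟨0, h.pos, h.root⟩
      fun i hi ⟨j, hj, hS⟩ => by
        obtain ⟨j', hj', hD⟩ := h.closed i hi.1 hi.2 j hj hS.symm
        exact ⟨j', hj', hD.symm⟩

/-- Searches run on a working copy of the edge list; this carries their result over to the original.
-/
theorem Searched.congr {N M : ℕ} {S D S' D' al : ℕ → ℕ} {r : ℕ} {q : ℕ → ℕ} {c : ℕ}
    {par : ℕ → ℕ} (h : Searched N M S D al r q c par) (he : ∀ i < M, S i = S' i ∧ D i = D' i) :
    Searched N M S' D' al r q c par where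
  root := h.root
  pos := h.pos
  lt := h.lt
  inj := h.inj
  par_iff := h.par_iff
  tree j h₁ h₂ := by
    obtain ⟨i, hi, h₃, h₄, h₅, j', h₆, h₇⟩ := h.tree j h₁ h₂
    exact ⟨i, hi, h₃, h₄, by rw [← (he i hi).2, h₅], j', h₆, by rw [← (he i hi).1, h₇]⟩
  closed i hi hal j hj hS := by
    obtain ⟨j', h₁, h₂⟩ := h.closed i hi hal j hj (by rw [(he i hi).1, hS])
    exact ⟨j', h₁, by rw [← (he i hi).2, h₂]⟩

/-- `l` lists the edges of a walk from `u` to `v`. -/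
def EdgeWalk (S D : ℕ → ℕ) : ℕ → List ℕ → ℕ → Prop
  | u, [], v => u = v
  | u, i :: l, v => S i = u ∧ EdgeWalk S D (D i) l v

/-- A walk that never enters R stays outside once it has left, so its first exit is its only one. -/
theorem EdgeWalk.exists_unique_exit {S D : ℕ → ℕ} {R : Set ℕ} {l : List ℕ} {u v : ℕ}
    (h : EdgeWalk S D u l v) (hu : u ∈ R) (hv : v ∉ R) (hR : ∀ i ∈ l, D i ∈ R → S i ∈ R) :
    ∃ b ∈ l, S b ∈ R ∧ D b ∉ R ∧ ∀ i ∈ l, S i ∈ R → D i ∉ R → i = b := by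
  induction l generalizing u with
  | nil => exact absurd ((show u = v from h) ▸ hu) hv
  | cons i l ih =>
    obtain ⟨rfl, h⟩ := h
    by_cases hD : D i ∈ R
    · obtain ⟨b, hb, h₁, h₂, h₃⟩ := ih h hD fun j hj => hR j (List.mem_cons_of_mem _ hj)
      refine ⟨b, List.mem_cons_of_mem _ hb, h₁, h₂, fun j hj hS hD' => ?_⟩
      rcases List.mem_cons.1 hj with rfl | hj
      · exact absurd hD hD'
      · exact h₃ j hj hS hD'
    · refine ⟨i, List.mem_cons_self, hu, hD, fun j hj hS _ => ?_⟩
      rcases List.mem_cons.1 hj with rfl | hj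
      · rfl
      · exfalso
        have aux : ∀ (l : List ℕ) (x : ℕ), EdgeWalk S D x l v → x ∉ R →
            (∀ i ∈ l, D i ∈ R → S i ∈ R) → ∀ j ∈ l, S j ∉ R := by
          intro l
          induction l with
          | nil => simp
          | cons k l ih =>
            rintro x ⟨rfl, h⟩ hx hl j hj
            rcases List.mem_cons.1 hj with rfl | hj
            · exact hx
            · exact ih (D k) h (fun h' => hx (hl k List.mem_cons_self h'))
                (fun i hi => hl i (List.mem_cons_of_mem _ hi)) j hj
        exact aux l _ h hD (fun i hi => hR i (List.mem_cons_of_mem _ hi)) j hj hS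

/-- After a return to R the walk would have to leave again by b, which it cannot use twice. The
disjunction `u ∈ R ∨ b ∉ l` makes the induction work: behind the exit the walk starts outside R, but
b no longer occurs. -/
theorem EdgeWalk.no_entry {S D : ℕ → ℕ} {R : Set ℕ} {l : List ℕ} {u v b : ℕ}
    (h : EdgeWalk S D u l v) (hv : v ∉ R) (hl : l.Nodup)
    (hb : ∀ i ∈ l, S i ∈ R → D i ∉ R → i = b) (hu : u ∈ R ∨ b ∉ l) :
    ∀ i ∈ l, D i ∈ R → S i ∈ R := by
  induction l generalizing u with
  | nil => simp
  | cons i l ih =>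
    obtain ⟨rfl, h⟩ := h
    rw [List.nodup_cons] at hl
    have hb' : ∀ j ∈ l, S j ∈ R → D j ∉ R → j = b := fun j hj => hb j (List.mem_cons_of_mem _ hj)
    by_cases hD : D i ∈ R
    · have aux : S i ∈ R ∧ ∀ j ∈ l, D j ∈ R → S j ∈ R := by
        rcases hu with hu | hu
        · exact ⟨hu, ih h hl.2 hb' (Or.inl hD)⟩
        · exfalso
          have : ∀ (l : List ℕ) (x : ℕ), EdgeWalk S D x l v → x ∈ R →
              (∀ i ∈ l, S i ∈ R → D i ∉ R → i = b) → b ∈ l := by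
            intro l
            induction l with
            | nil => exact fun x hx hxR _ => absurd ((show x = v from hx) ▸ hxR) hv
            | cons k l ih =>
              rintro x ⟨rfl, h⟩ hx hl
              by_cases hk : D k ∈ R
              · exact List.mem_cons_of_mem _
                  (ih (D k) h hk fun i hi => hl i (List.mem_cons_of_mem _ hi))
              · rw [hl k List.mem_cons_self hx hk]
                exact List.mem_cons_self
          exact hu (List.mem_cons_of_mem _ (this l _ h hD hb'))
      intro j hj
      rcases List.mem_cons.1 hj with rfl | hj
      · exact fun _ => aux.1
      · exact aux.2 j hj
    · intro j hj
      rcases List.mem_cons.1 hj with rfl | hj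
      · exact fun h => absurd h hD
      · refine ih h hl.2 hb' (Or.inr ?_) j hj
        rcases hu with hu | hu
        · rw [← hb i List.mem_cons_self hu hD]
          exact hl.1
        · exact fun h => hu (List.mem_cons_of_mem _ h)

/-- No single edge of `A` separates `v` from `u`. -/
def TwoConn (A : Set ℕ) (S D : ℕ → ℕ) (u v : ℕ) : Prop :=
  Conn A S D u v ∧ ∀ b ∈ A, Conn (A \ {b}) S D u v

/-- Augmenting path criterion: `S'`, `D'` arise by reversing the edges of the walk `l`. -/
theorem twoConn_iff_residual {A : Set ℕ} {S D S' D' : ℕ → ℕ} {u v : ℕ} {l : List ℕ}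
    (hw : EdgeWalk S D u l v) (hlA : ∀ i ∈ l, i ∈ A) (hnd : l.Nodup)
    (hin : ∀ i ∈ l, S' i = D i ∧ D' i = S i) (hout : ∀ i ∈ A, i ∉ l → S' i = S i ∧ D' i = D i) :
    TwoConn A S D u v ↔ Conn A S' D' u v := by
  have hconn : Conn A S D u v := by
    clear hnd hin hout
    induction l generalizing u with
    | nil => rw [show u = v from hw]; exact Relation.ReflTransGen.refl
    | cons i l ih =>
      obtain ⟨rfl, hw⟩ := hw
      exact Relation.ReflTransGen.head ⟨i, hlA i List.mem_cons_self, rfl, rfl⟩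
        (ih hw fun j hj => hlA j (List.mem_cons_of_mem _ hj))
  constructor
  · rintro ⟨_, h⟩
    by_contra hc
    -- In the residual graph nothing leaves R. So the walk never enters R, and its unique exit b is
    -- the only edge of A leaving R; deleting b then disconnects v.
    obtain ⟨R, hu, hv, hR⟩ := exists_cut hc
    obtain ⟨b, hbl, -, -, hb⟩ := hw.exists_unique_exit hu hv fun i hi hD => by
      have := hR i (hlA i hi)
      rw [(hin i hi).1, (hin i hi).2] at this
      exact this hD
    refine hv ((h b (hlA b hbl)).mem_of_closed hu ?_)
    rintro i ⟨hi, hib⟩ hS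
    by_contra hD
    by_cases hil : i ∈ l
    · exact hib (hb i hil hS hD)
    · have := hR i hi
      rw [(hout i hi hil).1, (hout i hi hil).2] at this
      exact hD (this hS)
  · intro h
    refine ⟨hconn, fun b hb => ?_⟩
    by_contra hc
    -- Now b is the only edge of A that can leave R, so R turns out to be closed in the residual
    -- graph too.
    obtain ⟨R, hu, hv, hR⟩ := exists_cut hc
    have hb' : ∀ i ∈ A, S i ∈ R → D i ∉ R → i = b := fun i hi hS hD => by
      by_contra hib
      exact hD (hR i ⟨hi, hib⟩ hS)
    have hne := hw.no_entry hv hnd (fun i hi => hb' i (hlA i hi)) (Or.inl hu)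
    refine hv (h.mem_of_closed hu fun i hi hS => ?_)
    by_cases hil : i ∈ l
    · rw [(hin i hil).1] at hS
      rw [(hin i hil).2]
      exact hne i hil hS
    · rw [(hout i hi hil).1] at hS
      rw [(hout i hi hil).2]
      by_contra hD
      obtain rfl := hb' i hi hS hD
      -- The walk itself has to leave R, necessarily by this same edge, which was assumed to lie off
      -- the walk.
      obtain ⟨j, hj, hSj, hDj, -⟩ := hw.exists_unique_exit hu hv hne
      exact hil (hb' j (hlA j hj) hSj hDj ▸ hj)

@[simp] abbrev vU : Var := Var.tmp 7
@[simp] abbrev vV : Var := Var.tmp 8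
@[simp] abbrev vRes : Var := Var.tmp 9
@[simp] abbrev vY : Var := Var.tmp 10
@[simp] abbrev vE : Var := Var.tmp 11
@[simp] abbrev aS₀ : Arr := Arr.tmp 7
@[simp] abbrev aD₀ : Arr := Arr.tmp 8

/-- Make a working copy of the edge list. -/
def copyEdges : Cmd :=
  forLoop vX vM (Cmd.seq (Cmd.store aS (Expr.var vX) (Expr.get aS₀ (Expr.var vX)))
    (Cmd.store aD (Expr.var vX) (Expr.get aD₀ (Expr.var vX))))

/-- Reverse the edge through which `vY` was found, and go to its source. -/
def flipStep : Cmd :=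
  Cmd.seq (Cmd.assign vE (Expr.pred (Expr.get aPar (Expr.var vY))))
  (Cmd.seq (Cmd.store aS (Expr.var vE) (Expr.get aD₀ (Expr.var vE)))
  (Cmd.seq (Cmd.store aD (Expr.var vE) (Expr.get aS₀ (Expr.var vE)))
    (Cmd.assign vY (Expr.get aS₀ (Expr.var vE)))))

def setRes : Cmd :=
  Cmd.ite (Test.eq (Expr.get aPar (Expr.var vV)) (Expr.lit 0))
    (Cmd.assign vRes (Expr.lit 0)) (Cmd.assign vRes (Expr.lit 1))

def flipPath : Cmd :=
  Cmd.seq (Cmd.assign vY (Expr.var vV))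
    (Cmd.loop (Test.not (Test.eq (Expr.var vY) (Expr.var vRoot))) flipStep)

/-- Decide whether no single edge separates `vV` from `vU`: search for a path, reverse it, and
search again. -/
def testTwoConn : Cmd :=
  Cmd.seq copyEdges
  (Cmd.seq (Cmd.assign vRoot (Expr.var vU))
  (Cmd.seq search
    (Cmd.ite (Test.eq (Expr.get aPar (Expr.var vV)) (Expr.lit 0))
      (Cmd.assign vRes (Expr.lit 0))
      (Cmd.seq flipPath (Cmd.seq search setRes)))))

theorem copyEdges_spec {σ : State} {M : ℕ} (hM : σ.var vM = M) :
    Runs copyEdges σ (40 * (M + 1)) fun τ =>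
      ∀ i < M, τ.arr aS i = σ.arr aS₀ i ∧ τ.arr aD i = σ.arr aD₀ i := by
  refine (runs_simpleLoop 20 (I := fun k τ =>
    ∀ i < k, τ.arr aS i = σ.arr aS₀ i ∧ τ.arr aD i = σ.arr aD₀ i)
    (by simp) rfl rfl (by decide) hM (by simp) ?_).mono (by omega) fun _ => id
  intro i hi ρ hρ hx hI
  have h₁ : ρ.arr aS₀ = σ.arr aS₀ := hρ.arr _ rfl
  have h₂ : ρ.arr aD₀ = σ.arr aD₀ := hρ.arr _ rfl
  simp at h₁ h₂ hI
  simp [hx, h₁, h₂]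
  intro j hj
  by_cases h : j = i
  · simp [h]
  · simpa [h] using hI j (by omega)

/-- The measure is the queue position of the current vertex, which drops because a tree edge starts
at an earlier position. The edges reversed so far end at later positions, so the next edge is not
among them. -/
theorem flipPath_spec {σ : State} {N M u v : ℕ} {S D al : ℕ → ℕ} {q : ℕ → ℕ} {c : ℕ}
    (hS : σ.arr aS₀ = S) (hD : σ.arr aD₀ = D)
    (hroot : σ.var vRoot = u) (hv : σ.var vV = v) (hvN : v < N)
    (hcopy : ∀ i < M, σ.arr aS i = S i ∧ σ.arr aD i = D i)
    (hs : Searched N M S D al u q c (σ.arr aPar)) (hpar : σ.arr aPar v ≠ 0) :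
    Runs flipPath σ (60 * (N + 1)) fun τ =>
      ∃ l, EdgeWalk S D u l v ∧ (∀ i ∈ l, i ∈ live M al) ∧ l.Nodup ∧
        (∀ i ∈ l, τ.arr aS i = D i ∧ τ.arr aD i = S i) ∧
        ∀ i < M, i ∉ l → τ.arr aS i = S i ∧ τ.arr aD i = D i := by
  obtain ⟨j₀, hj₀, hq₀⟩ := (hs.par_iff v hvN).1 hpar
  have hcN := hs.count_le
  refine (Runs.bind (R := fun τ => τ = σ.setVar vY v) (Runs.assign (by simp at hv; simp [hv]))
    ?_ (L := 40 * (N + 1))).mono (by simp [Expr.cost]; try omega) fun _ => id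
  rintro ρ hρ rfl
  refine (Runs.loop (c := flipStep) (b := Test.not (Test.eq (Expr.var vY) (Expr.var vRoot)))
    (K := 20) (B := N) (I := fun k τ => τ.arr aS₀ = S ∧ τ.arr aD₀ = D ∧
      τ.arr aPar = σ.arr aPar ∧ τ.var vRoot = u ∧ k < c ∧ τ.var vY = q k ∧
      ∃ l, EdgeWalk S D (q k) l v ∧ (∀ i ∈ l, i ∈ live M al) ∧ l.Nodup ∧
        (∀ i ∈ l, ∃ j, k < j ∧ j < c ∧ D i = q j) ∧
        (∀ i ∈ l, τ.arr aS i = D i ∧ τ.arr aD i = S i) ∧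
        ∀ i < M, i ∉ l → τ.arr aS i = S i ∧ τ.arr aD i = D i) ?_ ⟨j₀, by omega, ?_⟩).mono
    (by simp [Test.cost, Expr.cost]) ?_
  · rintro k hk τ ⟨h₁, h₂, h₃, h₄, hkc, hY, l, hw, hl, hnd, hpos, hin, hout⟩ hb
    refine Runs.simple _ (by decide) ?_
    simp at h₁ h₂ h₃ h₄ hY hb hin hout
    have hk0 : 0 < k := by
      rcases Nat.eq_zero_or_pos k with rfl | h
      · exact absurd (by rw [hY, h₄, hs.root]) hb
      · exact h
    obtain ⟨i, hi, hpi, hal, hDi, j, hjk, hSi⟩ := hs.tree k hk0 hkc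
    simp at hpi
    have hil : i ∉ l := fun h => by
      obtain ⟨j', hj', hj'c, hD'⟩ := hpos i h
      have := hs.inj k hkc j' hj'c (by rw [← hDi, hD'])
      omega
    simp [flipStep, h₁, h₂, h₃, h₄, hY, hpi]
    refine ⟨j, hjk, by omega, hSi, i :: l, ⟨hSi, by rwa [hDi]⟩, ?_, ?_, ?_, ?_, ?_⟩
    · intro i' hi'
      rcases List.mem_cons.1 hi' with rfl | h
      · exact ⟨hi, hal⟩
      · exact hl i' h
    · exact List.nodup_cons.2 ⟨hil, hnd⟩
    · intro i' hi'
      rcases List.mem_cons.1 hi' with rfl | h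
      · exact ⟨k, hjk, hkc, hDi⟩
      · obtain ⟨j', hj', h'⟩ := hpos i' h
        exact ⟨j', by omega, h'⟩
    · intro i' hi'
      rcases List.mem_cons.1 hi' with rfl | h
      · simp
      · have : i' ≠ i := fun h' => hil (h' ▸ h)
        simpa [this] using hin i' h
    · intro i' hi' hni
      rw [List.mem_cons, not_or] at hni
      simpa [hni.1] using hout i' hi' hni.2
  · simp at hroot hS hD hcopy
    simp [hroot, hS, hD, hj₀, hq₀]
    exact ⟨[], by simp [EdgeWalk], by simp, by simp, by simp, by simp, by simpa using hcopy⟩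
  · rintro τ ⟨⟨k, _, h₁, h₂, h₃, h₄, hkc, hY, l, hw, hl, hnd, hpos, hin, hout⟩, hb⟩
    simp at hb hY h₄
    rw [← hY, hb, h₄] at hw
    exact ⟨l, hw, hl, hnd, hin, hout⟩

theorem testTwoConn_spec {σ : State} {N M u v : ℕ} (hN : σ.var vN = N) (hM : σ.var vM = M)
    (hu : σ.var vU = u) (huN : u < N) (hv : σ.var vV = v) (hvN : v < N)
    (hE : ∀ i < M, σ.arr aAlive i ≠ 0 → σ.arr aS₀ i < N ∧ σ.arr aD₀ i < N) :
    Runs testTwoConn σ (1000 * (N + M + 1)) fun τ =>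
      τ.var vRes ≠ 0 ↔ TwoConn (live M (σ.arr aAlive)) (σ.arr aS₀) (σ.arr aD₀) u v := by
  refine (Runs.bind (copyEdges_spec hM) fun σ₁ hσ₁ hcopy =>
    Runs.bind (R := fun τ => τ = σ₁.setVar vRoot u)
      (Runs.assign (by have := hσ₁.var vU rfl; simp at this hu; simp [this, hu]))
      fun σ₂ hσ₂ he => Runs.bind (search_spec (σ := σ₂) (N := N) (M := M) (r := u) ?_ ?_ ?_ huN ?_)
        fun σ₃ hσ₃ hs => Runs.ite (K := 60 * (N + 1) + (300 * (N + M + 1) + 20)) ?_ ?_).mono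
        ?_ fun _ => id
  rotate_right
  · simp only [Test.cost, Expr.cost]
    omega
  · rw [hσ₂.var _ rfl, hσ₁.var _ rfl, hN]
  · rw [hσ₂.var _ rfl, hσ₁.var _ rfl, hM]
  · simp [he]
  · intro i hi
    rw [hσ₂.arr _ rfl, hσ₁.arr _ rfl, hσ₂.arr _ rfl, hσ₂.arr _ rfl, (hcopy i hi).1,
      (hcopy i hi).2]
    exact hE i hi
  all_goals
    have hM₃ : σ₃.var vM = M := by rw [hσ₃.var _ rfl, hσ₂.var _ rfl, hσ₁.var _ rfl, hM]
    have hN₃ : σ₃.var vN = N := by rw [hσ₃.var _ rfl, hσ₂.var _ rfl, hσ₁.var _ rfl, hN]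
    have hv₃ : σ₃.var vV = v := by rw [hσ₃.var _ rfl, hσ₂.var _ rfl, hσ₁.var _ rfl, hv]
    have hu₃ : σ₃.var vRoot = u := by rw [hσ₃.var _ rfl, he]; simp
    have hS₃ : σ₃.arr aS₀ = σ.arr aS₀ := by rw [hσ₃.arr _ rfl, hσ₂.arr _ rfl, hσ₁.arr _ rfl]
    have hD₃ : σ₃.arr aD₀ = σ.arr aD₀ := by rw [hσ₃.arr _ rfl, hσ₂.arr _ rfl, hσ₁.arr _ rfl]
    have hal₂ : σ₂.arr aAlive = σ.arr aAlive := by rw [hσ₂.arr _ rfl, hσ₁.arr _ rfl]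
    have hal₃ : σ₃.arr aAlive = σ.arr aAlive := by rw [hσ₃.arr _ rfl, hal₂]
    have hcopy₂ : ∀ i < M, σ₂.arr aS i = σ.arr aS₀ i ∧ σ₂.arr aD i = σ.arr aD₀ i := fun i hi => by
      rw [hσ₂.arr _ rfl, hσ₂.arr _ rfl]; exact hcopy i hi
    have hcopy₃ : ∀ i < M, σ₃.arr aS i = σ.arr aS₀ i ∧ σ₃.arr aD i = σ.arr aD₀ i := fun i hi => by
      rw [hσ₃.arr _ rfl, hσ₃.arr _ rfl]; exact hcopy₂ i hi
    have hs' : Searched N M (σ.arr aS₀) (σ.arr aD₀) (σ.arr aAlive) u (σ₃.arr aQueue)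
        (σ₃.var vCount) (σ₃.arr aPar) := by
      rw [hal₂] at hs
      exact hs.congr hcopy₂
    intro hb
    simp only [Test.holds, Expr.eval, hv₃] at hb
  · refine Runs.simple _ (Nat.le_trans (by decide : _ ≤ 2) (by omega)) ?_
    have : ¬ Conn (live M (σ.arr aAlive)) (σ.arr aS₀) (σ.arr aD₀) u v := fun h =>
      (hs'.par_ne_zero_iff hvN).2 h hb
    simp [TwoConn, this]
  · refine Runs.bind (flipPath_spec hS₃ hD₃ hu₃ hv₃ hvN hcopy₃ hs' hb)
      fun σ₄ hσ₄ ⟨l, hw, hl, hnd, hin, hout⟩ => ?_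
    refine Runs.bind (search_spec (σ := σ₄) (N := N) (M := M) (r := u) ?_ ?_ ?_ huN ?_)
      fun σ₅ hσ₅ hs₅ => Runs.simple _ (by decide) ?_
    · rw [hσ₄.var _ rfl, hN₃]
    · rw [hσ₄.var _ rfl, hM₃]
    · rw [hσ₄.var _ rfl, hu₃]
    · intro i hi
      rw [hσ₄.arr _ rfl, hal₃]
      intro h
      by_cases hil : i ∈ l
      · rw [(hin i hil).1, (hin i hil).2]
        exact (hE i hi h).symm
      · rw [(hout i hi hil).1, (hout i hi hil).2]
        exact hE i hi h
    · have hal₄ : σ₄.arr aAlive = σ.arr aAlive := by rw [hσ₄.arr _ rfl, hal₃]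
      have hv₅ : σ₅.var vV = v := by rw [hσ₅.var _ rfl, hσ₄.var _ rfl, hv₃]
      -- The second search decides reachability in the residual graph, which is the criterion
      -- wanted.
      rw [twoConn_iff_residual hw hl hnd hin fun i hi => hout i hi.1]
      have := hs₅.par_ne_zero_iff hvN
      rw [hal₄] at this
      rw [← this]
      simp at hv₅
      simp [setRes, hv₅]

/-! ## Greedy deletion of edges -/

@[simp] abbrev vA : Var := Var.tmp 12

/-- Delete the edge `vA`, unless this separates its end from its source. -/
def deleteStep : Cmd :=
  Cmd.ite (Test.eq (Expr.get aAlive (Expr.var vA)) (Expr.lit 0)) Cmd.skip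
    (Cmd.seq
      (Cmd.seq (Cmd.store aAlive (Expr.var vA) (Expr.lit 0))
        (Cmd.seq (Cmd.assign vU (Expr.get aS₀ (Expr.var vA)))
          (Cmd.assign vV (Expr.get aD₀ (Expr.var vA)))))
      (Cmd.seq testTwoConn
        (Cmd.ite (Test.eq (Expr.var vRes) (Expr.lit 0))
          (Cmd.store aAlive (Expr.var vA) (Expr.lit 1)) Cmd.skip)))

/-- Delete edges greedily, and copy the result to the output. -/
def minimize : Cmd :=
  Cmd.seq (forLoop vA Var.m deleteStep)
    (forLoop vX Var.m (Cmd.store Arr.out (Expr.var vX) (Expr.get aAlive (Expr.var vX))))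

theorem live_update_zero (M : ℕ) (al : ℕ → ℕ) (a : ℕ) :
    live M (Function.update al a 0) = live M al \ {a} := by
  ext i
  by_cases h : i = a <;> simp [live, h]

/-- An edge is restored with mark 1 whatever its former nonzero mark was; only the support of the
marks matters. -/
theorem live_update_one {M : ℕ} {al : ℕ → ℕ} {a : ℕ} (ha : a ∈ live M al) :
    live M (Function.update (Function.update al a 0) a 1) = live M al := by
  ext i
  by_cases h : i = a
  · subst h; simpa [live] using fun h => ha.2
  · simp [live, h]

/-- The result of greedy deletion: a minimal set with the property `P`. -/
structure Minimized (P : Set ℕ → Prop) (A₀ : Set ℕ) (m : ℕ) (A : Set ℕ) : Prop where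
  subset : A ⊆ A₀
  prop : P A
  minimal : ∀ a ∈ A, a < m → ¬ P (A \ {a})

/-- A single pass suffices: by monotonicity, an edge that is indispensable when tested remains so
after further deletions. Edges numbered from m on are never offered for deletion; in the split graph
these are the vertex edges. -/
theorem deleteLoop_spec {σ : State} {N M m : ℕ} {S D : ℕ → ℕ} {A₀ : Set ℕ} (P : Set ℕ → Prop)
    (hN : σ.var vN = N) (hM : σ.var vM = M) (hm : σ.var Var.m = m)
    (hS : σ.arr aS₀ = S) (hD : σ.arr aD₀ = D) (hA₀ : live M (σ.arr aAlive) = A₀)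
    (hE : ∀ i ∈ A₀, S i < N ∧ D i < N) (hP : P A₀)
    (hmono : ∀ A B, A ⊆ B → B ⊆ A₀ → P A → P B)
    (htest : ∀ A ⊆ A₀, P A → ∀ a ∈ A, a < m →
      (TwoConn (A \ {a}) S D (S a) (D a) ↔ P (A \ {a}))) (hmM : m ≤ M) :
    Runs (forLoop vA Var.m deleteStep) σ ((1000 * (N + M + 1) + 58) * (m + 1)) fun τ =>
      Minimized P A₀ m (live M (τ.arr aAlive)) := by
  refine (runs_forLoop (K := 1000 * (N + M + 1) + 50)
    (I := fun k τ => Minimized P A₀ k (live M (τ.arr aAlive)))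
    (by simp) rfl rfl hm ⟨hA₀.subset, ?_, by simp⟩ ?_).mono le_rfl fun _ => id
  · simpa using hA₀ ▸ hP
  intro a ha ρ hρ hx hI
  have hN' : ρ.var vN = N := by rw [hρ.var _ rfl, hN]
  have hM' : ρ.var vM = M := by rw [hρ.var _ rfl, hM]
  have hS' : ρ.arr aS₀ = S := by rw [hρ.arr _ rfl, hS]
  have hD' : ρ.arr aD₀ = D := by rw [hρ.arr _ rfl, hD]
  set A := live M (ρ.arr aAlive) with hA
  refine (Runs.ite (K := 1000 * (N + M + 1) + 40) ?_ ?_).mono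
    (by simp [Test.cost, Expr.cost]; omega) fun _ => id
  · intro hb
    refine Runs.simple _ (Nat.le_trans (by decide : _ ≤ 10) (by omega)) ?_
    simp only [Test.holds, Expr.eval, hx] at hb
    simp only [Cmd.wp, State.setVar_arr]
    refine ⟨hI.subset, hI.prop, fun i hi hia => hI.minimal i hi ?_⟩
    have : i ≠ a := fun h => hi.2 (h ▸ hb)
    omega
  · intro hb
    simp only [Test.holds, Expr.eval, hx] at hb
    have haA : a ∈ A := ⟨by omega, hb⟩
    have haA₀ := hI.subset haA
    refine (Runs.bind (R := fun τ => τ.arr aAlive = Function.update (ρ.arr aAlive) a 0 ∧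
        τ.var vU = S a ∧ τ.var vV = D a) (Runs.simple 20 (by decide) ?_) fun ρ₁ hρ₁ ⟨h₁, h₂, h₃⟩ =>
      Runs.bind (testTwoConn_spec (σ := ρ₁) (N := N) (M := M) (u := S a) (v := D a)
        (by rw [hρ₁.var _ rfl, hN']) (by rw [hρ₁.var _ rfl, hM']) h₂ (hE a haA₀).1 h₃
        (hE a haA₀).2 ?_)
        fun ρ₂ hρ₂ h => Runs.simple 20 (by decide) ?_).mono (by omega) fun _ => id
    · simp at hS' hD' hx
      simp [hx, hS', hD']
    · intro i hi hal
      rw [hρ₁.arr _ rfl, hρ₁.arr _ rfl, hS', hD']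
      refine hE i (hI.subset ⟨hi, fun h0 => hal ?_⟩)
      rw [h₁]
      by_cases hia : i = a <;> simp [hia]
      simpa [hia] using h0
    · have hal₂ : ρ₂.arr aAlive = Function.update (ρ.arr aAlive) a 0 := by rw [hρ₂.arr _ rfl, h₁]
      have hx₂ : ρ₂.var vA = a := by rw [hρ₂.var _ rfl, hρ₁.var _ rfl, hx]
      rw [hρ₁.arr aS₀ rfl, hρ₁.arr aD₀ rfl, hS', hD', h₁, live_update_zero, ← hA,
        htest A hI.subset hI.prop a haA ha] at h
      simp at hal₂ hx₂ h
      simp [hx₂, hal₂]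
      refine ⟨fun h0 => ?_, fun h0 => ?_⟩
      · have hPn := (not_congr h).1 (not_not.2 h0)
        have := live_update_one haA
        simp at this hA
        rw [this, ← hA]
        refine ⟨hI.subset, hI.prop, fun i hi hia => ?_⟩
        by_cases hia' : i = a
        · rwa [hia']
        · exact hI.minimal i hi (by omega)
      · have hPa := h.1 h0
        have := live_update_zero M (ρ.arr aAlive) a
        simp at this hA
        rw [this, ← hA]
        refine ⟨fun i hi => hI.subset hi.1, hPa, fun i hi hia hPi => ?_⟩
        have hne : i ≠ a := fun h => hi.2 h
        -- If an earlier edge could be spared now, it could already have been spared before `a` was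
        -- deleted.
        refine hI.minimal i hi.1 (by omega) (hmono _ _ ?_ ?_ hPi)
        · exact Set.sdiff_subset_sdiff_left Set.sdiff_subset
        · exact Set.sdiff_subset.trans hI.subset

theorem minimize_spec {σ : State} {N M m : ℕ} {S D : ℕ → ℕ} {A₀ : Set ℕ} (P : Set ℕ → Prop)
    (hN : σ.var vN = N) (hM : σ.var vM = M) (hm : σ.var Var.m = m)
    (hS : σ.arr aS₀ = S) (hD : σ.arr aD₀ = D) (hA₀ : live M (σ.arr aAlive) = A₀)
    (hE : ∀ i ∈ A₀, S i < N ∧ D i < N) (hP : P A₀)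
    (hmono : ∀ A B, A ⊆ B → B ⊆ A₀ → P A → P B)
    (htest : ∀ A ⊆ A₀, P A → ∀ a ∈ A, a < m →
      (TwoConn (A \ {a}) S D (S a) (D a) ↔ P (A \ {a}))) (hmM : m ≤ M) :
    Runs minimize σ ((1000 * (N + M + 1) + 100) * (m + 1)) fun τ =>
      ∃ A, Minimized P A₀ m A ∧ live m (τ.arr Arr.out) = A ∩ {i | i < m} := by
  refine (Runs.bind (deleteLoop_spec P hN hM hm hS hD hA₀ hE hP hmono htest hmM)
    fun ρ hρ h => (runs_simpleLoop 20
      (I := fun k τ => ∀ i < k, τ.arr Arr.out i = ρ.arr aAlive i) (by simp) rfl rfl (by decide)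
      (by rw [hρ.var _ rfl, hm]) (by simp) ?_).mono le_rfl fun τ hτ => ⟨_, h, ?_⟩).mono
      (by ring_nf; omega) fun _ => id
  · intro i hi τ hτ hx hI
    have h₁ : τ.arr aAlive = ρ.arr aAlive := hτ.arr _ rfl
    simp at h₁ hI
    simp [hx, h₁]
    intro j hj
    by_cases h : j = i
    · simp [h]
    · simpa [h] using hI j (by omega)
  · ext i
    simp only [live, Set.mem_ofPred_eq, Set.mem_inter_iff]
    constructor
    · rintro ⟨h₁, h₂⟩
      rw [hτ i h₁] at h₂
      exact ⟨⟨by omega, h₂⟩, h₁⟩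
    · rintro ⟨⟨_, h₂⟩, h₁⟩
      rw [hτ i h₁]
      exact ⟨h₁, h₂⟩

/-! ## Connectivity after the deletion of an edge -/

section Graphs

variable {V : Type*} {E F : Set (V × V)}

theorem Reach.mono {u v : V} (h : Reach E u v) (hEF : E ⊆ F) : Reach F u v :=
  Relation.ReflTransGen.mono (fun _ _ h => hEF h) _ _ h

/-- Each use of the edge is replaced by the given detour. -/
theorem Reach.replace {u v : V} {a : V × V} (h : Reach E u v) (hEF : E \ {a} ⊆ F)
    (ha : Reach F a.1 a.2) : Reach F u v := by
  induction h with
  | refl => exact Relation.ReflTransGen.refl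
  | @tail x y _ hs ih =>
    by_cases hxy : (x, y) = a
    · subst hxy
      exact ih.trans ha
    · exact ih.tail (hEF ⟨hs, hxy⟩)

theorem Is2EdgeConnected.mono (h : Is2EdgeConnected E) (hEF : E ⊆ F) : Is2EdgeConnected F := by
  refine ⟨fun u hu v hv => (h.1 u hu v hv).mono hEF, fun b _ hb => hb.2 fun u hu v hv => ?_⟩
  by_cases hbE : b ∈ E
  · have : StronglyConnected (E \ {b}) := by
      by_contra hc
      exact h.2 b hbE ⟨hbE, hc⟩
    exact (this u hu v hv).mono (Set.sdiff_subset_sdiff_left hEF)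
  · exact (h.1 u hu v hv).mono fun x hx => ⟨hEF hx, fun hxb => hbE (hxb ▸ hx)⟩

/-- Even after the loss of another edge b, the graph with `a` is strongly connected, and a detour
between the ends of `a` makes `a` superfluous there. So only one pair of vertices has to be tested.
-/
theorem Is2EdgeConnected.diff_iff (h : Is2EdgeConnected F) {a : V × V} :
    Is2EdgeConnected (F \ {a}) ↔
      Reach (F \ {a}) a.1 a.2 ∧ ∀ b ∈ F \ {a}, Reach ((F \ {a}) \ {b}) a.1 a.2 := by
  constructor
  · rintro ⟨h₁, h₂⟩
    refine ⟨h₁ _ trivial _ trivial, fun b hb => ?_⟩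
    by_contra hc
    exact h₂ b hb ⟨hb, fun h => hc (h _ trivial _ trivial)⟩
  · rintro ⟨h₁, h₂⟩
    refine ⟨fun u hu v hv => (h.1 u hu v hv).replace subset_rfl h₁,
      fun b hb hb' => hb'.2 fun u hu v hv => ?_⟩
    have : StronglyConnected (F \ {b}) := by
      by_contra hc
      exact h.2 b hb.1 ⟨hb.1, hc⟩
    refine (this u hu v hv).replace ?_ (h₂ b hb)
    rintro x ⟨⟨hx₁, hx₂⟩, hx₃⟩
    exact ⟨⟨hx₁, hx₃⟩, hx₂⟩

theorem delVertex_mono (hEF : E ⊆ F) (w : V) : delVertex E w ⊆ delVertex F w :=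
  fun _ hx => ⟨hEF hx.1, hx.2⟩

theorem Is2VertexConnected.mono (h : Is2VertexConnected E) (hEF : E ⊆ F) :
    Is2VertexConnected F := by
  refine ⟨fun u hu v hv => (h.1 u hu v hv).mono hEF, h.2.1, fun w hw => hw fun u hu v hv => ?_⟩
  exact ((not_not.1 (h.2.2 w)) u hu v hv).mono (delVertex_mono hEF w)

theorem Is2VertexConnected.reach (h : Is2VertexConnected E) {w u v : V} (hu : u ≠ w) (hv : v ≠ w) :
    Reach (delVertex E w) u v :=
  (not_not.1 (h.2.2 w)) u hu v hv

theorem exists_ne_and_ne (hV : 3 ≤ Nat.card V) (u v : V) : ∃ w, w ≠ u ∧ w ≠ v := by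
  have hfin : Finite V := Nat.finite_of_card_ne_zero (by omega)
  have := Fintype.ofFinite V
  classical
  by_contra hc
  push Not at hc
  have h₁ : (Finset.univ : Finset V).card ≤ ({u, v} : Finset V).card :=
    Finset.card_le_card fun x _ => by
      by_cases hx : x = u
      · simp [hx]
      · simp [hc x hx]
  have h₂ : ({u, v} : Finset V).card ≤ 2 := Finset.card_le_two
  rw [Finset.card_univ, ← Nat.card_eq_fintype_card] at h₁
  omega

/-- For any u and v there is a third vertex w, so reachability within the graph minus w already
contains strong connectivity. -/
theorem is2VertexConnected_of_reach (hV : 3 ≤ Nat.card V)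
    (h : ∀ w u v : V, u ≠ w → v ≠ w → Reach (delVertex E w) u v) : Is2VertexConnected E := by
  refine ⟨fun u _ v _ => ?_, hV, fun w => not_not.2 fun u hu v hv => h w u v hu hv⟩
  obtain ⟨w, hwu, hwv⟩ := exists_ne_and_ne hV u v
  exact (h w u v hwu.symm hwv.symm).mono fun x hx => hx.1

/-- Loops can be dropped beforehand. The argument in the split graph needs this: the neighbour at
the other end of an edge must be a different vertex. -/
theorem Is2VertexConnected.of_loopless (h : Is2VertexConnected E) :
    Is2VertexConnected {x ∈ E | x.1 ≠ x.2} := by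
  refine is2VertexConnected_of_reach h.2.1 fun w u v hu hv => ?_
  have := h.reach hu hv
  clear hu hv
  induction this with
  | refl => exact Relation.ReflTransGen.refl
  | @tail x y _ hs ih =>
    by_cases hxy : x = y
    · exact hxy ▸ ih
    · exact ih.tail ⟨⟨hs.1, hxy⟩, hs.2⟩

end Graphs

/-! ### Edge numbers and the edge sets they describe. -/

section EdgeLists

variable {n m : ℕ} {e : Fin m → Fin n × Fin n}

/-- The edges with numbers in `A`. -/
def edgesIn (e : Fin m → Fin n × Fin n) (A : Set ℕ) : Set (Fin n × Fin n) :=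
  {x | ∃ i : Fin m, (i : ℕ) ∈ A ∧ e i = x}

theorem marked_eq (σ : State) (a : Arr) (e : Fin m → Fin n × Fin n) :
    marked σ a e = edgesIn e (live m (σ.arr a)) := by
  ext x
  simp [marked, edgesIn, live]

theorem edgesIn_subset_range (A : Set ℕ) : edgesIn e A ⊆ Set.range e :=
  fun _ ⟨i, _, h⟩ => ⟨i, h⟩

theorem edgesIn_mono {A B : Set ℕ} (h : A ⊆ B) : edgesIn e A ⊆ edgesIn e B :=
  fun _ ⟨i, hi, hx⟩ => ⟨i, h hi, hx⟩

theorem edgesIn_diff (he : Function.Injective e) (A : Set ℕ) (i : Fin m) :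
    edgesIn e (A \ {(i : ℕ)}) = edgesIn e A \ {e i} := by
  ext x
  constructor
  · rintro ⟨j, ⟨hj, hji⟩, rfl⟩
    exact ⟨⟨j, hj, rfl⟩, fun h => hji (congrArg Fin.val (he h))⟩
  · rintro ⟨⟨j, hj, rfl⟩, hji⟩
    exact ⟨j, ⟨hj, fun h => hji (congrArg e (Fin.ext h))⟩, rfl⟩

/-- `S` and `D` list the sources and the ends of the edges. -/
def Lists (e : Fin m → Fin n × Fin n) (S D : ℕ → ℕ) : Prop :=
  ∀ i : Fin m, S i = (e i).1 ∧ D i = (e i).2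

theorem conn_iff_reach {S D : ℕ → ℕ} (hL : Lists e S D) {A : Set ℕ} (hA : ∀ i ∈ A, i < m)
    (u v : Fin n) : Conn A S D u v ↔ Reach (edgesIn e A) u v := by
  constructor
  · intro h
    have : ∀ y, Conn A S D u y → ∃ v : Fin n, y = v ∧ Reach (edgesIn e A) u v := by
      intro y hy
      induction hy with
      | refl => exact ⟨u, rfl, Relation.ReflTransGen.refl⟩
      | tail _ hs ih =>
        obtain ⟨v, rfl, hv⟩ := ih
        obtain ⟨i, hi, hS, rfl⟩ := hs
        refine ⟨(e ⟨i, hA i hi⟩).2, (hL ⟨i, hA i hi⟩).2, hv.tail ⟨⟨i, hA i hi⟩, hi, ?_⟩⟩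
        have := (hL ⟨i, hA i hi⟩).1
        exact Prod.ext (Fin.ext (by rw [← this, ← hS])) rfl
    obtain ⟨v', hv', h'⟩ := this v h
    rwa [Fin.ext hv']
  · intro h
    induction h with
    | refl => exact Relation.ReflTransGen.refl
    | tail _ hs ih =>
      obtain ⟨i, hi, hx⟩ := hs
      exact ih.tail ⟨i, hi, by rw [(hL i).1, hx], by rw [(hL i).2, hx]⟩

theorem twoConn_iff_is2EdgeConnected {S D : ℕ → ℕ} (hL : Lists e S D) (he : Function.Injective e)
    {A : Set ℕ} (hA : ∀ i ∈ A, i < m) (h : Is2EdgeConnected (edgesIn e A)) {a : ℕ} (ha : a ∈ A) :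
    TwoConn (A \ {a}) S D (S a) (D a) ↔ Is2EdgeConnected (edgesIn e (A \ {a})) := by
  obtain ⟨i, rfl⟩ : ∃ i : Fin m, (i : ℕ) = a := ⟨⟨a, hA a ha⟩, rfl⟩
  rw [edgesIn_diff he, h.diff_iff, ← edgesIn_diff he, (hL i).1, (hL i).2, TwoConn,
    conn_iff_reach hL fun j hj => hA j hj.1]
  refine and_congr_right fun _ => ⟨?_, fun h b hb => ?_⟩
  · rintro h _ ⟨j, hj, rfl⟩
    rw [← edgesIn_diff he, ← conn_iff_reach hL fun j hj => hA j hj.1.1]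
    exact h j hj
  · obtain ⟨j, rfl⟩ : ∃ j : Fin m, (j : ℕ) = b := ⟨⟨b, hA b hb.1⟩, rfl⟩
    rw [conn_iff_reach hL fun j hj => hA j hj.1.1, edgesIn_diff he]
    exact h _ ⟨j, hb, rfl⟩

/-- P may demand more than Q, as for the split graph, where all vertex edges must be present. The
hypothesis `hP` says that this surplus survives the deletion of an edge numbered below m, so
minimality for P yields minimality for Q. -/
theorem isMinimalSubgraph_of_minimized {Q : Set (Fin n × Fin n) → Prop} {P : Set ℕ → Prop}
    (he : Function.Injective e) {A₀ A B : Set ℕ} (hP : ∀ a < m, ∀ A ⊆ A₀, P A →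
      Q (edgesIn e (A \ {a})) → P (A \ {a})) (hPQ : P A → Q (edgesIn e A))
    (h : Minimized P A₀ m A) (hB : B = A ∩ {i | i < m}) :
    IsMinimalSubgraph Q (Set.range e) (edgesIn e B) := by
  have hBA : edgesIn e B = edgesIn e A := by
    ext x
    constructor
    · rintro ⟨i, hi, hx⟩
      exact ⟨i, (hB ▸ hi).1, hx⟩
    · rintro ⟨i, hi, hx⟩
      exact ⟨i, hB ▸ ⟨hi, i.2⟩, hx⟩
  rw [hBA]
  refine ⟨edgesIn_subset_range A, hPQ h.prop, ?_⟩
  rintro _ ⟨i, hi, rfl⟩ hQ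
  rw [← edgesIn_diff he] at hQ
  exact h.minimal i hi i.2 (hP i i.2 A h.subset h.prop hQ)

end EdgeLists

/-- Minimal 2-edge-connected subgraph. -/
def min2EC : Cmd :=
  Cmd.seq (Cmd.seq (Cmd.assign vN (Expr.var Var.n)) (Cmd.assign vM (Expr.var Var.m)))
  (Cmd.seq (forLoop vX vM
    (Cmd.seq (Cmd.store aS₀ (Expr.var vX) (Expr.get Arr.src (Expr.var vX)))
    (Cmd.seq (Cmd.store aD₀ (Expr.var vX) (Expr.get Arr.dst (Expr.var vX)))
      (Cmd.store aAlive (Expr.var vX) (Expr.lit 1)))))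
    minimize)

theorem min2EC_spec {n m : ℕ} {e : Fin m → Fin n × Fin n} {σ : State} (he : Function.Injective e)
    (hG : HoldsGraph σ e) (h2 : Is2EdgeConnected (Set.range e)) :
    Runs min2EC σ (2000 * (n + m + 1) * (m + 1)) fun τ =>
      IsMinimalSubgraph Is2EdgeConnected (Set.range e) (marked τ Arr.out e) := by
  obtain ⟨hn, hm, hG⟩ := hG
  refine (Runs.bind (R := fun τ => τ.var vN = n ∧ τ.var vM = m)
    (Runs.simple 10 (by decide) (by simp [hn, hm])) fun σ₁ hσ₁ ⟨hN₁, hM₁⟩ =>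
    Runs.bind (runs_simpleLoop 30 (I := fun k τ => ∀ i < k, τ.arr aS₀ i = σ.arr Arr.src i ∧
      τ.arr aD₀ i = σ.arr Arr.dst i ∧ τ.arr aAlive i = 1) (by simp) rfl rfl (by decide) hM₁
      (by simp) ?_) fun σ₂ hσ₂ h =>
    (minimize_spec (σ := σ₂) (N := n) (M := m) (m := m) (A₀ := {i | i < m})
      (fun A => Is2EdgeConnected (edgesIn e A)) ?_ ?_ ?_ rfl rfl ?_ ?_ ?_ ?_ ?_ le_rfl).mono le_rfl
        fun τ ⟨A, h₁, h₂⟩ => ?_).mono ?_ fun _ => id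
  · intro i hi ρ hρ hx hI
    have h₁ : ρ.arr Arr.src = σ.arr Arr.src := by rw [hρ.arr _ rfl, hσ₁.arr _ rfl]
    have h₂ : ρ.arr Arr.dst = σ.arr Arr.dst := by rw [hρ.arr _ rfl, hσ₁.arr _ rfl]
    simp at hI hx
    simp [hx, h₁, h₂]
    intro j hj
    by_cases hji : j = i
    · simp [hji]
    · simpa [hji] using hI j (by omega)
  · rw [hσ₂.var _ rfl, hN₁]
  · rw [hσ₂.var _ rfl, hM₁]
  · rw [hσ₂.var _ rfl, hσ₁.var _ rfl, hm]
  · ext i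
    simp only [live, Set.mem_ofPred_eq, and_iff_left_iff_imp]
    intro hi
    rw [(h i hi).2.2]; simp
  · intro i hi
    rw [(h i hi).1, (h i hi).2.1, (hG ⟨i, hi⟩).1, (hG ⟨i, hi⟩).2]
    exact ⟨Fin.is_lt _, Fin.is_lt _⟩
  · refine h2.mono ?_
    rintro _ ⟨i, rfl⟩
    exact ⟨i, i.2, rfl⟩
  · exact fun A B hAB _ hA => hA.mono (edgesIn_mono hAB)
  · intro A hA hP a ha _
    refine twoConn_iff_is2EdgeConnected (fun i => ?_) he (fun i hi => hA hi) hP ha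
    rw [(h i i.2).1, (h i i.2).2.1]
    exact hG i
  · nlinarith [Nat.zero_le (n * m), Nat.zero_le (m * m)]
  · rw [marked_eq]
    exact isMinimalSubgraph_of_minimized he (fun _ _ _ _ _ h => h) (fun h => h) h₁ h₂

/-! ## Minimal 2-vertex-connected subgraphs -/

section Split

variable {n m : ℕ} {e : Fin m → Fin n × Fin n}

/-- The graph in which each vertex `x` is split into `x` and `n + x`, joined by the edge with
number `m + x`; an edge from `u` to `v` becomes an edge from `n + u` to `v`. -/
structure IsSplit (e : Fin m → Fin n × Fin n) (S D : ℕ → ℕ) : Prop where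
  edge : ∀ i : Fin m, S i = n + (e i).1 ∧ D i = (e i).2
  vertex : ∀ x < n, S (m + x) = x ∧ D (m + x) = n + x

/-- The only way from the first copy of a vertex to its second copy is the vertex edge. Without the
edge m + w a walk may enter the first copy of w, but it cannot continue from there. -/
theorem IsSplit.reach_of_conn {S D : ℕ → ℕ} (hL : IsSplit e S D) {B : Set ℕ}
    (hB : ∀ i ∈ B, i < m + n) {u w : Fin n} (hu : u ≠ w) (hw : m + (w : ℕ) ∉ B) {y : ℕ}
    (h : Conn B S D (n + u) y) :
    (∀ x : Fin n, y = x → x = w ∨ Reach (delVertex (edgesIn e B) w) u x) ∧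
      ∀ x : Fin n, y = n + x → x ≠ w ∧ Reach (delVertex (edgesIn e B) w) u x := by
  induction h with
  | refl =>
    refine ⟨fun x hx => by omega, fun x hx => ?_⟩
    obtain rfl : u = x := Fin.ext (by omega)
    exact ⟨hu, Relation.ReflTransGen.refl⟩
  | tail _ hs ih =>
    obtain ⟨i, hi, rfl, rfl⟩ := hs
    rcases Nat.lt_or_ge i m with him | him
    · obtain ⟨h₁, h₂⟩ := hL.edge ⟨i, him⟩
      simp only at h₁ h₂
      rw [h₁] at ih
      rw [h₂]
      obtain ⟨h₃, h₄⟩ := ih.2 _ rfl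
      refine ⟨fun x hx => ?_, fun x hx => by omega⟩
      obtain rfl : (e ⟨i, him⟩).2 = x := Fin.ext hx
      by_cases hxw : (e ⟨i, him⟩).2 = w
      · exact Or.inl hxw
      · exact Or.inr (h₄.tail ⟨⟨⟨i, him⟩, hi, rfl⟩, h₃, hxw⟩)
    · obtain ⟨x, rfl⟩ := Nat.exists_eq_add_of_le him
      have hxn : x < n := by have := hB _ hi; omega
      obtain ⟨h₁, h₂⟩ := hL.vertex x hxn
      rw [h₁] at ih
      rw [h₂]
      refine ⟨fun x' hx' => by omega, fun x' hx' => ?_⟩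
      have hxx' : x = x' := by omega
      subst hxx'
      rcases ih.1 x' rfl with h | h
      · exact absurd (h ▸ hi) hw
      · exact ⟨fun h => hw (h ▸ hi), h⟩

/-- B may lack any edge touching z, including the vertex edge of z. A path avoiding z therefore
lifts although one such edge has been deleted. -/
theorem IsSplit.conn_of_reach {S D : ℕ → ℕ} (hL : IsSplit e S D) {A B : Set ℕ} {z s x : Fin n}
    (hedge : ∀ i : Fin m, (i : ℕ) ∈ A → (e i).1 ≠ z → (e i).2 ≠ z → (i : ℕ) ∈ B)
    (hvert : ∀ y : Fin n, y ≠ z → m + (y : ℕ) ∈ B)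
    (h : Reach (delVertex (edgesIn e A) z) s x) :
    Conn B S D (n + s) (n + x) ∧ (s ≠ x → Conn B S D (n + s) x) := by
  induction h with
  | refl => exact ⟨Relation.ReflTransGen.refl, fun h => absurd rfl h⟩
  | @tail x y _ hs ih =>
    obtain ⟨⟨i, hi, hxy⟩, h₁, h₂⟩ := hs
    have h₃ : Conn B S D (n + s) y := ih.1.tail
      ⟨i, hedge i hi (by rwa [hxy]) (by rwa [hxy]), by rw [(hL.edge i).1, hxy],
        by rw [(hL.edge i).2, hxy]⟩
    exact ⟨h₃.tail ⟨m + y, hvert y h₂, hL.vertex y y.2⟩, fun _ => h₃⟩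

variable {S D : ℕ → ℕ}

/-- Two vertex-disjoint paths in the graph are two edge-disjoint paths in the split graph. -/
theorem IsSplit.twoConn (hL : IsSplit e S D) (hn : 3 ≤ n) {A : Set ℕ} (hA : ∀ i ∈ A, i < m + n)
    (hloop : ∀ i : Fin m, (i : ℕ) ∈ A → (e i).1 ≠ (e i).2)
    (hvert : ∀ x < n, m + x ∈ A) (h : Is2VertexConnected (edgesIn e A)) {u v : Fin n}
    (huv : u ≠ v) (hnot : (u, v) ∉ edgesIn e A) : TwoConn A S D (n + u) v := by
  have hvert' : ∀ b : ℕ, ∀ y : Fin n, m + (y : ℕ) ≠ b → m + (y : ℕ) ∈ A \ {b} :=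
    fun b y hy => ⟨hvert y y.2, hy⟩
  -- The vertex z is chosen at b, so that avoiding z avoids b. The side conditions in `hbe` cover
  -- the cases in which z is u or v and cannot simply be avoided.
  have key : ∀ z : Fin n, ∀ b, b < m + n →
      (∀ y : Fin n, y ≠ z → m + (y : ℕ) ≠ b) →
      (∀ i : Fin m, (i : ℕ) ∈ A → (i : ℕ) = b →
        ((e i).1 = z ∧ z ≠ u) ∨ ((e i).2 = z ∧ z ≠ v)) → Conn (A \ {b}) S D (n + u) v := by
    intro z b hb hbv hbe
    have hedge : ∀ i : Fin m, (i : ℕ) ∈ A → (e i).1 ≠ z → (e i).2 ≠ z → (i : ℕ) ∈ A \ {b} :=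
      fun i hi h₁ h₂ => ⟨hi, fun hib => by
        rcases hbe i hi hib with h | h
        · exact h₁ h.1
        · exact h₂ h.1⟩
    have hv' : ∀ y : Fin n, y ≠ z → m + (y : ℕ) ∈ A \ {b} := fun y hy => hvert' b y (hbv y hy)
    have hr : Reach (edgesIn e A) u v := h.1 u trivial v trivial
    -- Start with any edge from u to some y: y is not u, there being no loops, and not v, as (u,v)
    -- is absent. Then go from y to v avoiding u. The first edge is not b, since b, if it comes from
    -- an edge of the graph, ends in u.
    by_cases hzu : z = u
    · subst hzu
      rcases Relation.ReflTransGen.cases_head hr with h₁ | ⟨y, ⟨i, hi, hiy⟩, -⟩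
      · exact absurd h₁ huv
      have hyz : y ≠ z := by
        have := hloop i hi
        rw [hiy] at this
        exact this.symm
      have hyv : y ≠ v := fun hyv => hnot (hyv ▸ hiy ▸ ⟨i, hi, rfl⟩)
      have h₂ := (hL.conn_of_reach hedge hv' (h.reach hyz huv.symm)).2 hyv
      refine Relation.ReflTransGen.head (b := (y : ℕ)) ⟨i, ⟨hi, fun hib => ?_⟩, ?_, ?_⟩
        (Relation.ReflTransGen.head (b := n + (y : ℕ)) ⟨m + y, hv' y hyz, hL.vertex y y.2⟩ h₂)
      · rcases hbe i hi hib with h | h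
        · exact h.2 rfl
        · exact hyz (by rw [← h.1, hiy])
      · rw [(hL.edge i).1, hiy]
      · rw [(hL.edge i).2, hiy]
    -- Symmetrically, go to some y avoiding v and finish with an edge from y into v.
    · by_cases hzv : z = v
      · subst hzv
        rcases Relation.ReflTransGen.cases_tail hr with h₁ | ⟨y, -, ⟨i, hi, hiy⟩⟩
        · exact absurd h₁.symm huv
        have hyz : y ≠ z := by
          have := hloop i hi
          rwa [hiy] at this
        have h₂ := (hL.conn_of_reach hedge hv' (h.reach huv hyz)).1
        refine h₂.tail ⟨i, ⟨hi, fun hib => ?_⟩, ?_, ?_⟩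
        · rcases hbe i hi hib with h | h
          · exact hyz (by rw [← h.1, hiy])
          · exact h.2 rfl
        · rw [(hL.edge i).1, hiy]
        · rw [(hL.edge i).2, hiy]
      · exact (hL.conn_of_reach hedge hv' (h.reach (Ne.symm hzu) (Ne.symm hzv))).2 huv
  have key' : ∀ b ∈ A, Conn (A \ {b}) S D (n + u) v := by
    intro b hb
    rcases Nat.lt_or_ge b m with hbm | hbm
    · obtain ⟨i, rfl⟩ : ∃ i : Fin m, (i : ℕ) = b := ⟨⟨b, hbm⟩, rfl⟩
      -- An edge from u is avoided through its end, which is not v because (u,v) is absent; any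
      -- other edge is avoided through its source.
      by_cases hiu : (e i).1 = u
      · refine key (e i).2 i (by omega) (fun y _ => by omega) fun j hj hji => Or.inr ?_
        rw [Fin.ext hji]
        refine ⟨rfl, fun hiv => hnot ⟨i, hb, Prod.ext hiu hiv⟩⟩
      · refine key (e i).1 i (by omega) (fun y _ => by omega) fun j hj hji => Or.inl ?_
        rw [Fin.ext hji]
        exact ⟨rfl, hiu⟩
    · obtain ⟨x, rfl⟩ := Nat.exists_eq_add_of_le hbm
      have hxn : x < n := by have := hA _ hb; omega
      exact key ⟨x, hxn⟩ (m + x) (by omega) (fun y hy h => hy (Fin.ext (by simp; omega)))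
        fun i _ hi => by omega
  -- Connectivity itself follows from connectivity after deleting any one edge; the vertex edge of 0
  -- serves.
  exact ⟨(key' (m + 0) (hvert 0 (by omega))).mono Set.sdiff_subset, key'⟩

/-- The property that is maintained in the split graph. -/
def SplitProp (e : Fin m → Fin n × Fin n) (A : Set ℕ) : Prop :=
  (∀ x < n, m + x ∈ A) ∧ Is2VertexConnected (edgesIn e A)

/-- Deleting the vertex edge of w leaves a walk that projects to a detour around the deleted edge
avoiding w; this gives one direction. For the other, the ends of the deleted edge are no longer
adjacent, so `IsSplit.twoConn` applies. -/
theorem IsSplit.twoConn_iff (hL : IsSplit e S D) (he : Function.Injective e) (hn : 3 ≤ n)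
    {A : Set ℕ} (hA : ∀ i ∈ A, i < m + n)
    (hloop : ∀ i : Fin m, (i : ℕ) ∈ A → (e i).1 ≠ (e i).2) (h : SplitProp e A) {a : ℕ}
    (ha : a ∈ A) (ham : a < m) :
    TwoConn (A \ {a}) S D (S a) (D a) ↔ SplitProp e (A \ {a}) := by
  obtain ⟨i, rfl⟩ : ∃ i : Fin m, (i : ℕ) = a := ⟨⟨a, ham⟩, rfl⟩
  have hvert : ∀ x < n, m + x ∈ A \ {(i : ℕ)} := fun x hx => ⟨h.1 x hx, fun h => by
    have : m + x = i := h
    omega⟩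
  rw [(hL.edge i).1, (hL.edge i).2]
  constructor
  · rintro ⟨_, h₁⟩
    refine ⟨hvert, is2VertexConnected_of_reach (by simpa using hn) fun w x y hx hy => ?_⟩
    have hxy := h.2.reach hx hy
    rw [edgesIn_diff he]
    have hsub : delVertex (edgesIn e A) w \ {e i} ⊆ delVertex (edgesIn e A \ {e i}) w :=
      fun b hb => ⟨⟨hb.1.1, hb.2⟩, hb.1.2⟩
    -- An edge at w is absent from the graph minus w anyway; only the other edges need a detour.
    by_cases hw : (e i).1 = w ∨ (e i).2 = w
    · refine hxy.mono fun b hb => hsub ⟨hb, ?_⟩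
      rintro rfl
      rcases hw with hw | hw
      · exact hb.2.1 hw
      · exact hb.2.2 hw
    · rw [not_or] at hw
      refine hxy.replace hsub ?_
      have := (hL.reach_of_conn (fun j hj => hA j hj.1.1) (w := w) hw.1 (fun h => h.2 rfl)
        (h₁ (m + w) (hvert w w.2))).1 _ rfl
      rcases this with h₂ | h₂
      · exact absurd h₂ hw.2
      · refine h₂.mono (delVertex_mono ?_ w)
        rw [← edgesIn_diff he]
        exact edgesIn_mono Set.sdiff_subset
  · rintro ⟨_, h₁⟩
    refine hL.twoConn hn (fun j hj => hA j hj.1) (fun j hj => hloop j hj.1) hvert h₁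
      (hloop i ha) ?_
    rw [edgesIn_diff he]
    exact fun h => h.2 rfl

end Split

-- The entry at x is n + x. The machine cannot add, so these sums are tabulated by counting while
-- the vertices are split.
@[simp] abbrev aOut : Arr := Arr.tmp 9

def splitVertex : Cmd :=
  Cmd.seq (Cmd.store aS₀ (Expr.var vM) (Expr.var vX))
  (Cmd.seq (Cmd.store aD₀ (Expr.var vM) (Expr.var vN))
  (Cmd.seq (Cmd.store aAlive (Expr.var vM) (Expr.lit 1))
  (Cmd.seq (Cmd.store aOut (Expr.var vX) (Expr.var vN))
  (Cmd.seq (Cmd.assign vM (Expr.succ (Expr.var vM)))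
    (Cmd.assign vN (Expr.succ (Expr.var vN)))))))

def splitEdge : Cmd :=
  Cmd.seq (Cmd.store aS₀ (Expr.var vX) (Expr.get aOut (Expr.get Arr.src (Expr.var vX))))
  (Cmd.seq (Cmd.store aD₀ (Expr.var vX) (Expr.get Arr.dst (Expr.var vX)))
    (Cmd.ite (Test.eq (Expr.get Arr.src (Expr.var vX)) (Expr.get Arr.dst (Expr.var vX)))
      (Cmd.store aAlive (Expr.var vX) (Expr.lit 0))
      (Cmd.store aAlive (Expr.var vX) (Expr.lit 1))))

/-- Minimal 2-vertex-connected subgraph. -/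
def min2VC : Cmd :=
  Cmd.seq (Cmd.seq (Cmd.assign vN (Expr.var Var.n)) (Cmd.assign vM (Expr.var Var.m)))
  (Cmd.seq (forLoop vX Var.n splitVertex)
  (Cmd.seq (forLoop vX Var.m splitEdge) minimize))

theorem splitVertices_spec {σ : State} {n m : ℕ} (hn : σ.var Var.n = n) (hN : σ.var vN = n)
    (hM : σ.var vM = m) : Runs (forLoop vX Var.n splitVertex) σ (60 * (n + 1)) fun τ =>
      τ.var vN = n + n ∧ τ.var vM = m + n ∧ (∀ x < n, τ.arr aOut x = n + x) ∧
      ∀ x < n, τ.arr aS₀ (m + x) = x ∧ τ.arr aD₀ (m + x) = n + x ∧ τ.arr aAlive (m + x) = 1 := by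
  refine (runs_simpleLoop 40 (I := fun k τ => τ.var vN = n + k ∧ τ.var vM = m + k ∧
    (∀ x < k, τ.arr aOut x = n + x) ∧
      ∀ x < k, τ.arr aS₀ (m + x) = x ∧ τ.arr aD₀ (m + x) = n + x ∧ τ.arr aAlive (m + x) = 1)
    (by simp) rfl rfl (by decide) hn ?_ ?_).mono (by omega) fun _ => id
  · simp at hN hM
    simp [hN, hM]
  · rintro i hi ρ hρ hx ⟨h₁, h₂, h₃, h₄⟩
    simp at h₁ h₂ h₃ h₄ hx
    simp [splitVertex, hx, h₁, h₂]
    refine ⟨by omega, by omega, fun x hxi => ?_, fun x hxi => ?_⟩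
    · by_cases h : x = i
      · simp [h]
      · simpa [h] using h₃ x (by omega)
    · by_cases h : x = i
      · simp [h]
      · simpa [h] using h₄ x (by omega)

theorem min2VC_spec {n m : ℕ} {e : Fin m → Fin n × Fin n} {σ : State} (hn3 : 3 ≤ n)
    (he : Function.Injective e) (hG : HoldsGraph σ e) (h2 : Is2VertexConnected (Set.range e)) :
    Runs min2VC σ (4000 * (n + m + 1) * (m + 1) + 100 * (n + 1)) fun τ =>
      IsMinimalSubgraph Is2VertexConnected (Set.range e) (marked τ Arr.out e) := by
  obtain ⟨hn, hm, hG⟩ := hG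
  suffices h : Runs min2VC σ (10 + (60 * (n + 1) + ((30 + 8) * (m + 1) +
      (1000 * (n + n + (m + n) + 1) + 100) * (m + 1)))) fun τ =>
        IsMinimalSubgraph Is2VertexConnected (Set.range e) (marked τ Arr.out e) from
    h.mono (by nlinarith [Nat.zero_le (n * m), Nat.zero_le (m * m)]) fun _ => id
  refine Runs.bind (R := fun τ => τ.var vN = n ∧ τ.var vM = m)
    (Runs.simple 10 (by decide) (by simp [hn, hm])) fun σ₁ hσ₁ ⟨hN₁, hM₁⟩ =>
    Runs.bind (splitVertices_spec (by rw [hσ₁.var _ rfl, hn]) hN₁ hM₁)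
      fun σ₂ hσ₂ ⟨hN₂, hM₂, hO₂, hV₂⟩ =>
    Runs.bind (runs_simpleLoop 30 (I := fun k τ => (∀ i < k, τ.arr aS₀ i = n + σ.arr Arr.src i ∧
        τ.arr aD₀ i = σ.arr Arr.dst i ∧
        (τ.arr aAlive i ≠ 0 ↔ σ.arr Arr.src i ≠ σ.arr Arr.dst i)) ∧
      ∀ x < n, τ.arr aS₀ (m + x) = x ∧ τ.arr aD₀ (m + x) = n + x ∧ τ.arr aAlive (m + x) = 1)
      (by simp) rfl rfl (by decide) (by rw [hσ₂.var _ rfl, hσ₁.var _ rfl, hm])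
      ⟨by simp, by simpa using hV₂⟩ ?_) fun σ₃ hσ₃ ⟨hE₃, hV₃⟩ => ?_
  · rintro i hi ρ hρ hx ⟨h₁, h₂⟩
    have hs : ρ.arr Arr.src = σ.arr Arr.src := by rw [hρ.arr _ rfl, hσ₂.arr _ rfl, hσ₁.arr _ rfl]
    have hd : ρ.arr Arr.dst = σ.arr Arr.dst := by rw [hρ.arr _ rfl, hσ₂.arr _ rfl, hσ₁.arr _ rfl]
    have ho : ρ.arr aOut (σ.arr Arr.src i) = n + σ.arr Arr.src i := by
      rw [hρ.arr _ rfl]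
      refine hO₂ _ ?_
      rw [(hG ⟨i, hi⟩).1]
      exact Fin.is_lt _
    simp at h₁ h₂ hx ho
    simp only [splitEdge, Cmd.wp, Test.holds, Expr.eval]
    simp [hx, hs, hd, ho]
    have aux : ∀ a b c : ℕ, (∀ x < n, Function.update (ρ.arr (Arr.tmp 7)) i a (m + x) = x ∧
        Function.update (ρ.arr (Arr.tmp 8)) i b (m + x) = n + x ∧
        Function.update (ρ.arr (Arr.tmp 2)) i c (m + x) = 1) := fun a b c x hx => by
      rw [Function.update_of_ne (by omega), Function.update_of_ne (by omega),
        Function.update_of_ne (by omega)]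
      exact h₂ x hx
    refine ⟨fun hsd => ⟨fun j hj => ?_, aux _ _ _⟩, fun hsd => ⟨fun j hj => ?_, aux _ _ _⟩⟩
    all_goals
      by_cases hji : j = i
      · simp [hji, hsd]
      · simpa [hji] using h₁ j (by omega)
  · set A₀ := live (m + n) (σ₃.arr aAlive) with hA₀
    have hL : IsSplit e (σ₃.arr aS₀) (σ₃.arr aD₀) := by
      refine ⟨fun i => ?_, fun x hx => ⟨(hV₃ x hx).1, (hV₃ x hx).2.1⟩⟩
      rw [(hE₃ i i.2).1, (hE₃ i i.2).2.1, (hG i).1, (hG i).2]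
      exact ⟨rfl, rfl⟩
    have hlt : ∀ i ∈ A₀, i < m + n := fun i hi => hi.1
    have hloop : ∀ i : Fin m, (i : ℕ) ∈ A₀ ↔ (e i).1 ≠ (e i).2 := by
      intro i
      have := (hE₃ i i.2).2.2
      rw [(hG i).1, (hG i).2] at this
      simp only [hA₀, live, Set.mem_ofPred_eq, this, ne_eq, Fin.ext_iff]
      exact and_iff_right (by omega)
    -- The split graph has 2n vertices and m + n edge numbers, of which the first m may be deleted.
    -- Loops carry mark 0 from the start.
    refine (minimize_spec (σ := σ₃) (N := n + n) (M := m + n) (m := m) (A₀ := A₀)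
      (SplitProp e) ?_ ?_ ?_ rfl rfl rfl ?_ ?_ ?_ ?_ (by omega)).mono le_rfl
        fun τ ⟨A, h₁, h₂⟩ => ?_
    · rw [hσ₃.var _ rfl, hN₂]
    · rw [hσ₃.var _ rfl, hM₂]
    · rw [hσ₃.var _ rfl, hσ₂.var _ rfl, hσ₁.var _ rfl, hm]
    · intro i hi
      rcases Nat.lt_or_ge i m with him | him
      · have := hL.edge ⟨i, him⟩
        simp only at this
        rw [this.1, this.2]
        constructor <;> omega
      · obtain ⟨x, rfl⟩ := Nat.exists_eq_add_of_le him
        have hxn : x < n := by have := hlt _ hi; omega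
        rw [(hL.vertex x hxn).1, (hL.vertex x hxn).2]
        omega
    · refine ⟨fun x hx => ⟨by omega, by rw [(hV₃ x hx).2.2]; simp⟩, h2.of_loopless.mono ?_⟩
      rintro _ ⟨⟨i, rfl⟩, hi⟩
      exact ⟨i, (hloop i).2 hi, rfl⟩
    · exact fun A B hAB _ hA => ⟨fun x hx => hAB (hA.1 x hx), hA.2.mono (edgesIn_mono hAB)⟩
    · exact fun A hA hP a ha ham => hL.twoConn_iff he hn3 (fun i hi => hlt i (hA hi))
        (fun i hi => (hloop i).1 (hA hi)) hP ha ham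
    · rw [marked_eq]
      refine isMinimalSubgraph_of_minimized he (fun a ha B _ hB hQ => ⟨fun x hx => ?_, hQ⟩)
        (fun h => h.2) h₁ h₂
      exact ⟨hB.1 x hx, fun h => by
        have : m + x = a := h
        omega⟩

/-! ## Dominators -/

section Dominators

variable {V : Type*} {E : Set (V × V)} {r : V}

/-- `x` can be reached from `r` without passing through `z`. -/
def Avoids (E : Set (V × V)) (r z x : V) : Prop :=
  x ≠ z ∧ Reach {a ∈ E | a.1 ≠ z} r x

/-- `z` dominates `x` in the flowgraph with start vertex `r`. -/
def Dom (E : Set (V × V)) (r z x : V) : Prop :=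
  ¬ Avoids E r z x

theorem Avoids.root {z : V} (h : z ≠ r) : Avoids E r z r :=
  ⟨h.symm, Relation.ReflTransGen.refl⟩

theorem Avoids.step {z x y : V} (h : Avoids E r z x) (hxy : (x, y) ∈ E) (hy : y ≠ z) :
    Avoids E r z y :=
  ⟨hy, h.2.tail ⟨hxy, h.1⟩⟩

theorem Dom.refl (x : V) : Dom E r x x := fun h => h.1 rfl

/-- Once the edges leaving r are gone, a walk from r cannot move. -/
theorem dom_root (x : V) : Dom E r r x := by
  rintro ⟨hx, h⟩
  rcases Relation.ReflTransGen.cases_head h with h | ⟨y, hy, -⟩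
  · exact hx h.symm
  · exact hy.2 rfl

theorem Dom.of_edge {z x y : V} (h : Dom E r z y) (hxy : (x, y) ∈ E) (hy : y ≠ z) :
    Dom E r z x := fun hx => h (hx.step hxy hy)

/-- A walk avoiding a cannot meet b, which a dominates; hence it avoids b as well. -/
theorem Dom.trans {a b c : V} (hab : Dom E r a b) (hbc : Dom E r b c) : Dom E r a c := by
  rintro ⟨hc, h⟩
  have : ∀ x, Reach {e ∈ E | e.1 ≠ a} r x → x ≠ a → Avoids E r b x := by
    intro x hx
    induction hx with
    | refl =>
      intro hra
      refine Avoids.root fun hbr => hab ?_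
      rw [hbr]
      exact Avoids.root hra.symm
    | @tail x y hx hxy ih =>
      intro hya
      refine (ih hxy.2).step hxy.1 fun hyb => hab ?_
      exact hyb ▸ ⟨hya, hx.tail hxy⟩
  exact hbc (this c h hc)

/-- If a ≠ b, whichever a walk from r met first would be reached without the other. So no walk meets
either, although a is reachable. -/
theorem Dom.antisymm (hr : ∀ x, Reach E r x) {a b : V} (hab : Dom E r a b) (hba : Dom E r b a) :
    a = b := by
  by_contra hne
  have : ∀ x, Reach E r x → Avoids E r a x ∧ Avoids E r b x := by
    intro x hx
    induction hx with
    | refl =>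
      constructor
      · refine Avoids.root fun har => hba ?_
        rw [har]
        exact Avoids.root fun h => hne (har.trans h.symm)
      · refine Avoids.root fun hbr => hab ?_
        rw [hbr]
        exact Avoids.root fun h => hne (h.trans hbr.symm)
    | @tail x y _ hxy ih =>
      have hya : y ≠ a := fun h => hba (h ▸ ih.2.step hxy (h ▸ hne))
      have hyb : y ≠ b := fun h => hab (h ▸ ih.1.step hxy (h ▸ Ne.symm hne))
      exact ⟨ih.1.step hxy hya, ih.2.step hxy hyb⟩
  exact (this a (hr a)).1.1 rfl

/-- If neither dominates the other, a walk can be rerouted whenever it meets one of them, by a path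
there avoiding the other. So every vertex avoids a or avoids b, in particular x. -/
theorem Dom.total (hr : ∀ x, Reach E r x) {a b x : V} (ha : Dom E r a x) (hb : Dom E r b x) :
    Dom E r a b ∨ Dom E r b a := by
  by_contra hc
  rw [not_or] at hc
  have h₁ := not_not.1 hc.1
  have h₂ := not_not.1 hc.2
  have hne := h₁.1
  have : ∀ y, Reach E r y → Avoids E r a y ∨ Avoids E r b y := by
    intro y hy
    induction hy with
    | refl =>
      by_cases har : a = r
      · exact Or.inr (Avoids.root fun h => hne (h.trans har.symm))
      · exact Or.inl (Avoids.root har)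
    | @tail x y _ hxy ih =>
      by_cases hya : y = a
      · exact Or.inr (hya ▸ h₂)
      · by_cases hyb : y = b
        · exact Or.inl (hyb ▸ h₁)
        · exact ih.imp (fun h => h.step hxy hya) fun h => h.step hxy hyb
  exact (this x (hr x)).elim ha hb

theorem eq_root_of_dom_root (hr : ∀ x, Reach E r x) {z : V} (h : Dom E r z r) : z = r :=
  h.antisymm hr (dom_root z)

/-- `x` and `y` have the same proper dominators: they are siblings in the dominator tree. -/
def Sib (E : Set (V × V)) (r x y : V) : Prop :=
  ∀ z, (z ≠ x ∧ Dom E r z x) ↔ (z ≠ y ∧ Dom E r z y)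

theorem Sib.refl (x : V) : Sib E r x x := fun _ => Iff.rfl

theorem Sib.symm {x y : V} (h : Sib E r x y) : Sib E r y x := fun z => (h z).symm

theorem Sib.trans {x y z : V} (h : Sib E r x y) (h' : Sib E r y z) : Sib E r x z :=
  fun w => (h w).trans (h' w)

theorem Sib.eq_of_dom {x y : V} (h : Sib E r x y) (hxy : Dom E r x y) : x = y := by
  by_contra hne
  exact ((h x).2 ⟨hne, hxy⟩).1 rfl

/-- Dominators of z form a chain, and distinct siblings do not dominate each other: sibling subtrees
of the dominator tree are disjoint. -/
theorem Sib.eq_of_dom_dom (hr : ∀ x, Reach E r x) {x y z : V} (h : Sib E r x y)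
    (hx : Dom E r x z) (hy : Dom E r y z) : x = y := by
  rcases hx.total hr hy with h' | h'
  · exact h.eq_of_dom h'
  · exact (h.symm.eq_of_dom h').symm

/-- The pair marks where the branches of the dominator tree towards x and y part. If a were a proper
dominator of a', it would also dominate b' and so y, against the sibling b dominating y. -/
theorem Sib.unique (hr : ∀ x, Reach E r x) {a b a' b' x y : V} (h : Sib E r a b)
    (h' : Sib E r a' b') (hne : a ≠ b) (hne' : a' ≠ b') (hax : Dom E r a x) (hby : Dom E r b y)
    (hax' : Dom E r a' x) (hby' : Dom E r b' y) : a = a' ∧ b = b' := by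
  have haa : a = a' := by
    by_contra hc
    rcases hax.total hr hax' with h₁ | h₁
    · exact hne (h.eq_of_dom_dom hr (((h' a).1 ⟨hc, h₁⟩).2.trans hby') hby)
    · exact hne' (h'.eq_of_dom_dom hr (((h a').1 ⟨Ne.symm hc, h₁⟩).2.trans hby) hby')
  subst haa
  refine ⟨rfl, (h.symm.trans h').eq_of_dom_dom hr hby hby'⟩

/-- The order in which `x` precedes `y` if it is a proper dominator of `y`, or if it comes earlier
in the order of the siblings given by `R`. -/
def Precedes (E : Set (V × V)) (r : V) (R : V → V → Prop) (x y : V) : Prop :=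
  (x ≠ y ∧ Dom E r x y) ∨ ∃ a b, Sib E r a b ∧ R a b ∧ Dom E r a x ∧ Dom E r b y

theorem Precedes.irrefl (hr : ∀ x, Reach E r x) {R : V → V → Prop} (hR : ∀ x, ¬ R x x) (x : V) :
    ¬ Precedes E r R x x := by
  rintro (h | ⟨a, b, hab, hRab, ha, hb⟩)
  · exact h.1 rfl
  · exact hR a ((hab.eq_of_dom_dom hr ha hb) ▸ hRab)

/-- This is the preorder of the dominator tree with siblings ordered by R. Two comparisons at the
same set of siblings compose through R; otherwise the pair higher up in the tree decides. -/
theorem Precedes.trans (hr : ∀ x, Reach E r x) {R : V → V → Prop}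
    (hRt : ∀ x y z, R x y → R y z → R x z) {x y z : V}
    (h : Precedes E r R x y) (h' : Precedes E r R y z) : Precedes E r R x z := by
  rcases h with ⟨hne, hxy⟩ | ⟨a, b, hab, hRab, hax, hby⟩
  · rcases h' with ⟨hne', hyz⟩ | ⟨a, b, hab, hRab, hay, hbz⟩
    · exact Or.inl ⟨fun h => hne (hxy.antisymm hr (h ▸ hyz)), hxy.trans hyz⟩
    · by_cases hax : Dom E r a x
      · exact Or.inr ⟨a, b, hab, hRab, hax, hbz⟩
      · have hxa := (hxy.total hr hay).resolve_right hax
        have hne' : x ≠ a := fun h => hax (by rw [h]; exact Dom.refl a)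
        have hxb := (hab x).1 ⟨hne', hxa⟩
        refine Or.inl ⟨fun h => hxb.1 (hxb.2.antisymm hr (h ▸ hbz)), hxb.2.trans hbz⟩
  · rcases h' with ⟨hne', hyz⟩ | ⟨a', b', hab', hRab', hay, hbz⟩
    · exact Or.inr ⟨a, b, hab, hRab, hax, hby.trans hyz⟩
    · by_cases hba : b = a'
      · subst hba
        exact Or.inr ⟨a, b', hab.trans hab', hRt _ _ _ hRab hRab', hax, hbz⟩
      · rcases hby.total hr hay with h | h
        · exact Or.inr ⟨a, b, hab, hRab, hax, ((hab' b).1 ⟨hba, h⟩).2.trans hbz⟩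
        · exact Or.inr ⟨a', b', hab', hRab', ((hab a').2 ⟨Ne.symm hba, h⟩).2.trans hax, hbz⟩

/-- Without dominance, both comparisons take place at the same pair of siblings, and R cannot hold
in both directions. -/
theorem dom_of_precedes (hr : ∀ x, Reach E r x) {R : V → V → Prop} (hR : ∀ x, ¬ R x x)
    (hRa : ∀ x y, R x y → ¬ R y x) {x y : V} (h : Precedes E r R x y)
    (h' : Precedes E r (fun a b => R b a) x y) : Dom E r x y := by
  rcases h with h | ⟨a, b, hab, hRab, hax, hby⟩
  · exact h.2
  rcases h' with h | ⟨a', b', hab', hRab', hax', hby'⟩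
  · exact h.2
  obtain ⟨rfl, rfl⟩ := hab.unique hr hab' (fun h => hR a (h ▸ hRab)) (fun h => hR a' (h ▸ hRab'))
    hax hby hax' hby'
  exact absurd hRab' (hRa _ _ hRab)

theorem isDominator_of_dom {z x : V} (h : Dom E r z x) : IsDominator E r z x := by
  rintro p ⟨hp, hhead, hlast⟩
  by_contra hz
  refine h ?_
  clear h
  induction p using List.reverseRecOn generalizing x with
  | nil => simp at hhead
  | append_singleton l y ih =>
    obtain rfl : y = x := by simpa using hlast
    rw [List.mem_append, not_or, List.mem_singleton] at hz
    rcases List.eq_nil_or_concat l with rfl | ⟨l', x', rfl⟩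
    · obtain rfl : y = r := by simpa using hhead
      exact Avoids.root hz.2
    · rw [List.concat_eq_append] at *
      rw [List.isChain_append] at hp
      have := ih (x := x') hp.1 (by simpa using hhead) (by simp) hz.1
      exact this.step (hp.2.2 x' (by simp) y (by simp)) (Ne.symm hz.2)

/-- `c` is the topmost dominator of `p` that does not dominate `v`. -/
def IsTop (E : Set (V × V)) (r p v c : V) : Prop :=
  Dom E r c p ∧ ¬ Dom E r c v ∧ ∀ z, Dom E r z p → ¬ Dom E r z v → Dom E r c z

/-- A proper dominator of v dominates p through the edge and is comparable with c; it cannot lie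
below c, since c does not dominate v. A proper dominator of c dominates v because c is topmost. -/
theorem IsTop.sib (hr : ∀ x, Reach E r x) {p v c : V} (hpv : (p, v) ∈ E) (hvp : ¬ Dom E r v p)
    (h : IsTop E r p v c) : Sib E r c v := by
  obtain ⟨h₁, h₂, h₃⟩ := h
  intro z
  constructor
  · rintro ⟨hzc, hz⟩
    have hzv : Dom E r z v := by
      by_contra hzv
      exact hzc (hz.antisymm hr (h₃ z (hz.trans h₁) hzv))
    exact ⟨fun h => hvp (h ▸ hz.trans h₁), hzv⟩
  · rintro ⟨hzv, hz⟩
    have hzp := hz.of_edge hpv (Ne.symm hzv)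
    have hzc : z ≠ c := fun h => h₂ (h ▸ hz)
    refine ⟨hzc, (hzp.total hr h₁).resolve_right fun h => h₂ (h.trans hz)⟩

/-- `G` arises from `E` by replacing the source of each edge `(p, v)` such that `v` does not
dominate `p` by the topmost dominator of `p` that does not dominate `v`, or by the root if there is
no such dominator. -/
structure IsDerived (E : Set (V × V)) (r : V) (G : Set (V × V)) : Prop where
  exists_edge : ∀ p v, (p, v) ∈ E → ¬ Dom E r v p →
    ((∀ z, Dom E r z p → Dom E r z v) ∧ (r, v) ∈ G) ∨ ∃ c, IsTop E r p v c ∧ (c, v) ∈ G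

/-- A walk is followed through the siblings k of x that dominate its current vertex. A new such k
can appear only when the walk arrives at k itself; the derived edge of that step leads to k from the
root or from a sibling that dominated the previous vertex. The hypothesis `hF` keeps that sibling
different from a. -/
theorem IsDerived.reach_aux (hr : ∀ x, Reach E r x) {G : Set (V × V)} (hG : IsDerived E r G)
    {F : Set (V × V)} (hFE : F ⊆ E) {a x : V} (har : a ≠ r)
    (hF : ∀ y y' c, Reach F r y → (y, y') ∈ F → Sib E r c x → Dom E r c y → c ≠ a) {y : V}
    (hy : Reach F r y) : ∀ k, Sib E r k x → Dom E r k y → Reach {g ∈ G | g.1 ≠ a} r k := by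
  induction hy with
  | refl =>
    intro k _ hk
    rw [eq_root_of_dom_root hr hk]
    exact Relation.ReflTransGen.refl
  | @tail y y' hy hyy' ih =>
    intro k hkx hk
    by_cases hky : Dom E r k y
    · exact ih k hkx hky
    have hkE := hFE hyy'
    obtain rfl : y' = k := by
      by_contra hne
      exact hky (hk.of_edge hkE hne)
    rcases hG.exists_edge y y' hkE hky with ⟨_, hg⟩ | ⟨c, hc, hg⟩
    · exact Relation.ReflTransGen.single ⟨hg, har.symm⟩
    · have hcx := (hc.sib hr hkE hky).trans hkx
      exact (ih c hcx hc.1).tail ⟨hg, hF y y' c hy hyy' hcx hc.1⟩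

/-- The derived graph has only trivial dominators. -/
theorem IsDerived.reach (hr : ∀ x, Reach E r x) {G : Set (V × V)} (hG : IsDerived E r G) {a x : V}
    (har : a ≠ r) (hxa : x ≠ a) : Reach {g ∈ G | g.1 ≠ a} r x := by
  -- If a is a sibling of x, it does not dominate x, and a walk of E avoiding a can be followed.
  -- Otherwise a never occurs among the siblings of x used as sources.
  by_cases ha : Sib E r a x
  · have hav : Avoids E r a x := by
      by_contra h
      exact hxa (ha.eq_of_dom h).symm
    refine hG.reach_aux hr (F := {e ∈ E | e.1 ≠ a}) (fun _ h => h.1) har ?_ hav.2 x (Sib.refl x)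
      (Dom.refl x)
    rintro y y' c hy hyy' _ hcy rfl
    exact hcy ⟨hyy'.2, hy⟩
  · exact hG.reach_aux hr (F := E) subset_rfl har
      (fun y y' c _ _ hcx _ h => ha (h ▸ hcx)) (hr x) x (Sib.refl x) (Dom.refl x)

/-- If `a` does not separate the other neighbours of `{r} ∪ R` from `r`, then it separates no
vertex from `r`. -/
theorem reach_of_shell {G : Set (V × V)} {R : Set V} {a x : V}
    (hx : Reach {g ∈ G | g.1 ≠ a} r x) (hxR : x ∉ R) (hxa : x ≠ a)
    (hadj : ∀ k y, (k, y) ∈ G → (k = r ∨ k ∈ R) → y ∉ R → y ≠ a →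
      Reach {g ∈ G | g.2 ∉ R ∧ g.2 ≠ a} r y) :
    Reach {g ∈ G | g.2 ∉ R ∧ g.2 ≠ a} r x := by
  induction hx with
  | refl => exact Relation.ReflTransGen.refl
  | @tail y y' _ hs ih =>
    -- Each visit to the root or to R restarts the path through `hadj`; after the last visit the
    -- given path can be followed unchanged.
    by_cases hy : y = r ∨ y ∈ R
    · exact hadj y y' hs.1 hy hxR hxa
    · rw [not_or] at hy
      exact (ih hy.2 hs.2).tail ⟨hs.1, hxR, hxa⟩

/-- Parents descend in a strict order on a finite set, so the chain of parents of any vertex of S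
ends in the root. -/
theorem isSpanningTree_of_parents [Finite V] {S : Set V} {A : Set (V × V)} (hrS : r ∈ S)
    (p : V → V) (hA : ∀ a, a ∈ A ↔ a.2 ∈ S ∧ a.2 ≠ r ∧ a.1 = p a.2)
    (hE : ∀ v ∈ S, v ≠ r → (p v, v) ∈ E ∧ p v ∈ S) (lt : V → V → Prop)
    (hirr : ∀ x, ¬ lt x x) (htr : ∀ x y z, lt x y → lt y z → lt x z)
    (hlt : ∀ v ∈ S, v ≠ r → lt (p v) v) : IsSpanningTree S E r A := by
  refine ⟨hrS, fun a ha => ?_, fun a ha => ?_, fun a ha => ((hA a).1 ha).2.1, fun v hv hvr => ?_,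
    fun v hv => ?_⟩
  · obtain ⟨h₁, h₂, h₃⟩ := (hA a).1 ha
    have := (hE a.2 h₁ h₂).1
    rwa [← h₃] at this
  · obtain ⟨h₁, h₂, h₃⟩ := (hA a).1 ha
    exact ⟨h₃ ▸ (hE a.2 h₁ h₂).2, h₁⟩
  · exact ⟨p v, (hA _).2 ⟨hv, hvr, rfl⟩, fun u hu => ((hA _).1 hu).2.2⟩
  · have wf : WellFounded lt := by
      have : Std.Irrefl lt := ⟨hirr⟩
      have : IsTrans V lt := ⟨htr⟩
      exact Finite.wellFounded_of_trans_of_irrefl lt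
    induction v using wf.induction with
    | _ v ih =>
      by_cases hvr : v = r
      · rw [hvr]; exact Relation.ReflTransGen.refl
      · exact (ih _ (hlt v hv hvr) (hE v hv hvr).2).tail ((hA _).2 ⟨hv, hvr, rfl⟩)

theorem IsPath.le_last {A : Set (V × V)} {u x : V} {p : List V} (hp : IsPath A u x p)
    (lt : V → V → Prop) (htr : ∀ x y z, lt x y → lt y z → lt x z) (hA : ∀ a ∈ A, lt a.1 a.2) :
    ∀ z ∈ p, z = x ∨ lt z x := by
  obtain ⟨hc, -, hlast⟩ := hp
  induction p using List.reverseRecOn generalizing x with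
  | nil => simp
  | append_singleton l y ih =>
    obtain rfl : y = x := by simpa using hlast
    intro z hz
    rw [List.mem_append, List.mem_singleton] at hz
    rcases hz with hz | hz
    · rcases List.eq_nil_or_concat l with rfl | ⟨l', x', rfl⟩
      · simp at hz
      · rw [List.concat_eq_append] at *
        rw [List.isChain_append] at hc
        have hlt := hA _ (hc.2.2 x' (by simp) y (by simp))
        rcases ih hc.1 (x := x') (by simp) z hz with rfl | h
        · exact Or.inr hlt
        · exact Or.inr (htr _ _ _ h hlt)
    · exact Or.inl hz

/-- Two trees are independent if the parents in the one precede their children with respect to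
some order of the siblings, and the parents in the other with respect to the opposite order. -/
theorem areIndependentTrees [Finite V] (hr : ∀ x, Reach E r x) {A B : Set (V × V)} (pA pB : V → V)
    (hA : ∀ a, a ∈ A ↔ a.2 ≠ r ∧ a.1 = pA a.2) (hB : ∀ a, a ∈ B ↔ a.2 ≠ r ∧ a.1 = pB a.2)
    (hAE : ∀ v, v ≠ r → (pA v, v) ∈ E) (hBE : ∀ v, v ≠ r → (pB v, v) ∈ E) (t : V → ℕ)
    (hA' : ∀ v, v ≠ r → Precedes E r (fun a b => t a < t b) (pA v) v)
    (hB' : ∀ v, v ≠ r → Precedes E r (fun a b => t b < t a) (pB v) v) :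
    AreIndependentTrees E r A B := by
  have irA : ∀ x, ¬ Precedes E r (fun a b => t a < t b) x x :=
    Precedes.irrefl hr fun x => lt_irrefl _
  have irB : ∀ x, ¬ Precedes E r (fun a b => t b < t a) x x :=
    Precedes.irrefl hr fun x => lt_irrefl _
  have trA : ∀ x y z, Precedes E r (fun a b => t a < t b) x y →
      Precedes E r (fun a b => t a < t b) y z → Precedes E r (fun a b => t a < t b) x z :=
    fun x y z => Precedes.trans hr fun _ _ _ h h' => h.trans h'
  have trB : ∀ x y z, Precedes E r (fun a b => t b < t a) x y →
      Precedes E r (fun a b => t b < t a) y z → Precedes E r (fun a b => t b < t a) x z :=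
    fun x y z => Precedes.trans hr fun _ _ _ h h' => h'.trans h
  refine ⟨isSpanningTree_of_parents trivial pA (by simpa using hA)
      (fun v _ hv => ⟨hAE v hv, trivial⟩) _ irA trA fun v _ => hA' v,
    isSpanningTree_of_parents trivial pB (by simpa using hB)
      (fun v _ hv => ⟨hBE v hv, trivial⟩) _ irB trB fun v _ => hB' v, ?_⟩
  intro x hx p p' hp hp' z hz hz'
  refine isDominator_of_dom ?_
  rcases hp.le_last _ trA (fun a ha => by
    obtain ⟨h₁, h₂⟩ := (hA a).1 ha
    rw [h₂]; exact hA' _ h₁) z hz with rfl | h₁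
  · exact Dom.refl _
  rcases hp'.le_last _ trB (fun a ha => by
    obtain ⟨h₁, h₂⟩ := (hB a).1 ha
    rw [h₂]; exact hB' _ h₁) z hz' with rfl | h₂
  · exact Dom.refl _
  exact dom_of_precedes hr (R := fun a b => t a < t b) (fun x => lt_irrefl _)
    (fun _ _ h => lt_asymm h) h₁ h₂

end Dominators

/-! ## Spanning trees -/

/-- The root is skipped because its entry encodes no tree edge: it is a mere mark, or left over in
the workspace. -/
def markStep (p t : Arr) : Cmd :=
  Cmd.ite (Test.and (Test.not (Test.eq (Expr.var vX) (Expr.var vRoot)))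
      (Test.not (Test.eq (Expr.get p (Expr.var vX)) (Expr.lit 0))))
    (Cmd.store t (Expr.pred (Expr.get p (Expr.var vX))) (Expr.lit 1)) Cmd.skip

/-- Mark in `t` the edges that are stored (plus one) in `p` for some vertex other than the root. -/
def markTree (p t : Arr) : Cmd :=
  Cmd.seq (forLoop vX vM (Cmd.store t (Expr.var vX) (Expr.lit 0)))
    (forLoop vX vN (markStep p t))

theorem markTree_spec {σ : State} {p t : Arr} {N M r : ℕ} (hpt : p ≠ t) (hN : σ.var vN = N)
    (hM : σ.var vM = M) (hr : σ.var vRoot = r) :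
    Runs (markTree p t) σ (100 * (N + M + 1)) fun τ =>
      ∀ i < M, τ.arr t i ≠ 0 ↔ ∃ x < N, x ≠ r ∧ σ.arr p x = i + 1 := by
  refine (Runs.bind (runs_simpleLoop 20 (I := fun k τ => ∀ i < k, τ.arr t i = 0) (by simp) rfl rfl
      (Nat.le_of_lt_succ (by simp [Cmd.bound, Expr.cost])) hM (by simp) ?_) fun ρ hρ h =>
    (runs_simpleLoop 40 (I := fun k τ => ∀ i < M, τ.arr t i ≠ 0 ↔
      ∃ x < k, x ≠ r ∧ σ.arr p x = i + 1) (by simp) rfl rfl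
      (Nat.le_of_lt_succ (by simp [markStep, Cmd.bound, Expr.cost, Test.cost]))
      (by rw [hρ.var _ rfl, hN]) ?_ ?_)).mono (by omega) fun _ => id
  · intro i hi ρ hρ hx hI
    simp at hx
    simp [hx]
    intro j hj
    by_cases hji : j = i
    · simp [hji]
    · simpa [hji] using hI j (by omega)
  · simpa using h
  · intro x hx τ hτ hvx hI
    have h₁ : τ.arr p = σ.arr p := by
      rw [hτ.arr _ (by simp [forLoop, markStep, Cmd.writesArr, hpt]),
        hρ.arr _ (by simp [forLoop, Cmd.writesArr, hpt])]
    have h₂ : τ.var vRoot = r := by rw [hτ.var _ rfl, hρ.var _ rfl, hr]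
    simp at h₂ hvx
    simp [markStep, hvx, h₁, h₂]
    have aux : ∀ i, (∃ y ≤ x, ¬ y = r ∧ σ.arr p y = i + 1) ↔
        (∃ y < x, ¬ y = r ∧ σ.arr p y = i + 1) ∨ (¬ x = r ∧ σ.arr p x = i + 1) := by
      intro i
      constructor
      · rintro ⟨y, hy, h⟩
        rcases Nat.lt_or_eq_of_le hy with hy | rfl
        · exact Or.inl ⟨y, hy, h⟩
        · exact Or.inr h
      · rintro (⟨y, hy, h⟩ | h)
        · exact ⟨y, by omega, h⟩
        · exact ⟨x, by omega, h⟩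
    refine ⟨fun hxr hpx i hi => ?_, fun hc i hi => ?_⟩
    · have h' := hI i hi
      simp only [ne_eq] at h'
      rw [aux, ← h']
      by_cases hip : i = σ.arr p x - 1
      · subst hip
        simp only [Function.update_self, one_ne_zero, not_false_eq_true, true_iff]
        exact Or.inr ⟨hxr, (Nat.sub_add_cancel (Nat.pos_of_ne_zero hpx)).symm⟩
      · rw [Function.update_of_ne hip]
        have : σ.arr p x ≠ i + 1 := by omega
        simp [this]
    · have h' := hI i hi
      simp only [ne_eq] at h'
      rw [aux, ← h', or_iff_left]
      rintro ⟨h₁, h₂⟩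
      have := hc h₁
      omega

section

variable {n m : ℕ} {e : Fin m → Fin n × Fin n}

/-- The set of edges found by `markTree`, in terms of a choice of edges. -/
theorem mem_marked_iff {τ : State} {t : Arr} {P : ℕ → ℕ} {r : Fin n}
    (ht : ∀ i < m, τ.arr t i ≠ 0 ↔ ∃ x < n, x ≠ (r : ℕ) ∧ P x = i + 1) {S : Set (Fin n)}
    (c : Fin n → Fin m) (hc : ∀ v, v ≠ r → v ∈ S → P v = c v + 1 ∧ (e (c v)).2 = v)
    (hS : ∀ v, v ≠ r → v ∉ S → P v = 0) (a : Fin n × Fin n) :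
    a ∈ marked τ t e ↔ a.2 ∈ S ∧ a.2 ≠ r ∧ a.1 = (e (c a.2)).1 := by
  constructor
  · rintro ⟨i, hi, rfl⟩
    obtain ⟨x, hx, hxr, hP⟩ := (ht i i.2).1 hi
    have hxr' : (⟨x, hx⟩ : Fin n) ≠ r := fun h => hxr (congrArg Fin.val h)
    have hxS : (⟨x, hx⟩ : Fin n) ∈ S := by
      by_contra h
      have := hS _ hxr' h
      simp only at this
      omega
    obtain ⟨h₁, h₂⟩ := hc _ hxr' hxS
    have hci : c ⟨x, hx⟩ = i := Fin.ext (by simp only at h₁; omega)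
    rw [hci] at h₂
    rw [h₂]
    exact ⟨hxS, hxr', by rw [hci]⟩
  · rintro ⟨h₁, h₂, h₃⟩
    obtain ⟨h₄, h₅⟩ := hc _ h₂ h₁
    refine ⟨c a.2, (ht _ (c a.2).2).2 ⟨a.2, a.2.2, fun h => h₂ (Fin.ext h), h₄⟩, ?_⟩
    exact Prod.ext h₃.symm h₅

def loadStep (s d : Arr) : Cmd :=
  Cmd.seq (Cmd.store aS (Expr.var vX) (Expr.get s (Expr.var vX)))
  (Cmd.seq (Cmd.store aD (Expr.var vX) (Expr.get d (Expr.var vX)))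
    (Cmd.ite (Test.eq (Expr.get s (Expr.var vX)) (Expr.var Var.y))
      (Cmd.store aAlive (Expr.var vX) (Expr.lit 0))
      (Cmd.ite (Test.eq (Expr.get d (Expr.var vX)) (Expr.var Var.y))
        (Cmd.store aAlive (Expr.var vX) (Expr.lit 0))
        (Cmd.store aAlive (Expr.var vX) (Expr.lit 1)))))

/-- A spanning tree rooted at `q` of the graph without `y`, where the edges are listed in the arrays
`s` and `d`. -/
def treeAvoiding (s d t : Arr) : Cmd :=
  Cmd.seq (Cmd.seq (Cmd.assign vN (Expr.var Var.n))
    (Cmd.seq (Cmd.assign vM (Expr.var Var.m)) (Cmd.assign vRoot (Expr.var Var.q))))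
  (Cmd.seq (forLoop vX vM (loadStep s d)) (Cmd.seq search (markTree aPar t)))

/-- With all edges at y disabled, the search finds every vertex except y. The tree order is the
order of the queue. -/
theorem treeAvoiding_spec {σ : State} {s d t : Arr} (hs : ∀ k, s ≠ Arr.tmp k)
    (hd : ∀ k, d ≠ Arr.tmp k) (ht : ∀ k, t ≠ Arr.tmp k) {y q : Fin n} (hn3 : 3 ≤ n)
    (hn : σ.var Var.n = n) (hm : σ.var Var.m = m) (hL : Lists e (σ.arr s) (σ.arr d))
    (hy : σ.var Var.y = y) (hq : σ.var Var.q = q) (hqy : q ≠ y)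
    (hr : ∀ v, v ≠ y → Reach (delVertex (Set.range e) y) q v) :
    Runs (treeAvoiding s d t) σ (1000 * (n + m + 1)) fun τ =>
      IsSpanningTree {y}ᶜ (delVertex (Set.range e) y) q (marked τ t e) := by
  suffices h : Runs (treeAvoiding s d t) σ (20 + ((40 + 8) * (m + 1) + (300 * (n + m + 1) +
      100 * (n + m + 1)))) fun τ =>
      IsSpanningTree {y}ᶜ (delVertex (Set.range e) y) q (marked τ t e) from
    h.mono (by omega) fun _ => id
  refine Runs.bind (R := fun τ => τ.var vN = n ∧ τ.var vM = m ∧ τ.var vRoot = q)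
    (Runs.simple 20 (by decide) (by simp [hn, hm, hq])) fun σ₁ hσ₁ ⟨hN₁, hM₁, hq₁⟩ =>
    Runs.bind (runs_simpleLoop 40 (I := fun k τ => ∀ i < k, τ.arr aS i = σ.arr s i ∧
      τ.arr aD i = σ.arr d i ∧ (τ.arr aAlive i ≠ 0 ↔ σ.arr s i ≠ y ∧ σ.arr d i ≠ y)) (by simp)
      rfl rfl (Nat.le_of_lt_succ (by simp [loadStep, Cmd.bound, Expr.cost, Test.cost])) hM₁
      (by simp) ?_) fun σ₂ hσ₂ h₂ =>
    Runs.bind (search_spec (σ := σ₂) (N := n) (M := m) (r := q) ?_ ?_ ?_ q.2 ?_)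
      fun σ₃ hσ₃ h₃ => (markTree_spec (N := n) (M := m) (r := q) (ht 5).symm ?_ ?_ ?_).mono
        le_rfl fun τ h₄ => ?_
  · intro i hi ρ hρ hx hI
    have h₁ : ρ.arr s = σ.arr s := by
      rw [hρ.arr _ (by simp [forLoop, loadStep, Cmd.writesArr, hs]),
        hσ₁.arr _ (by simp [Cmd.writesArr])]
    have h₂ : ρ.arr d = σ.arr d := by
      rw [hρ.arr _ (by simp [forLoop, loadStep, Cmd.writesArr, hd]),
        hσ₁.arr _ (by simp [Cmd.writesArr])]
    have h₃ : ρ.var Var.y = y := by rw [hρ.var _ rfl, hσ₁.var _ rfl, hy]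
    simp at hI hx
    simp [loadStep, hx, h₁, h₂, h₃, hs, hd]
    refine ⟨fun hsy j hj => ?_, fun hsy => ⟨fun hdy j hj => ?_, fun hdy j hj => ?_⟩⟩
    all_goals
      by_cases hji : j = i
      · simp [*]
      · simpa [hji] using hI j (by omega)
  · rw [hσ₂.var _ rfl, hN₁]
  · rw [hσ₂.var _ rfl, hM₁]
  · rw [hσ₂.var _ rfl, hq₁]
  · intro i hi _
    rw [(h₂ i hi).1, (h₂ i hi).2.1, (hL ⟨i, hi⟩).1, (hL ⟨i, hi⟩).2]
    exact ⟨Fin.is_lt _, Fin.is_lt _⟩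
  · rw [hσ₃.var _ rfl, hσ₂.var _ rfl, hN₁]
  · rw [hσ₃.var _ rfl, hσ₂.var _ rfl, hM₁]
  · rw [hσ₃.var _ rfl, hσ₂.var _ rfl, hq₁]
  · have hL₂ : Lists e (σ₂.arr aS) (σ₂.arr aD) := fun i => by
      rw [(h₂ i i.2).1, (h₂ i i.2).2.1]; exact hL i
    have hal : ∀ i : Fin m, σ₂.arr aAlive i ≠ 0 ↔ (e i).1 ≠ y ∧ (e i).2 ≠ y := fun i => by
      rw [(h₂ i i.2).2.2, (hL i).1, (hL i).2, ne_eq, ne_eq, Fin.val_inj, Fin.val_inj]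
    have hE : edgesIn e (live m (σ₂.arr aAlive)) = delVertex (Set.range e) y := by
      ext x
      constructor
      · rintro ⟨i, hi, rfl⟩
        exact ⟨⟨i, rfl⟩, (hal i).1 hi.2⟩
      · rintro ⟨⟨i, rfl⟩, hi⟩
        exact ⟨i, ⟨i.2, (hal i).2 hi⟩, rfl⟩
    have hfound : ∀ v : Fin n, v ≠ y → ∃ j < σ₃.var vCount, σ₃.arr aQueue j = v := fun v hv => by
      rw [← h₃.par_iff v v.2, h₃.par_ne_zero_iff v.2, conn_iff_reach hL₂ fun i hi => hi.1, hE]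
      exact hr v hv
    have hnot : ∀ v : Fin n, v ≠ q → v ∉ ({y}ᶜ : Set (Fin n)) → σ₃.arr aPar v = 0 := by
      intro v hvq hv
      obtain rfl : v = y := by simpa using hv
      by_contra h
      have := (h₃.par_ne_zero_iff v.2).1 h
      rw [conn_iff_reach hL₂ fun i hi => hi.1, hE] at this
      rcases Relation.ReflTransGen.cases_tail this with h | ⟨x, -, h⟩
      · exact hvq h
      · exact h.2.2 rfl
    have hpar : ∀ v : Fin n, ∃ i : Fin m, v ≠ q → v ≠ y → σ₃.arr aPar v = i + 1 ∧ (e i).2 = v ∧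
        e i ∈ delVertex (Set.range e) y ∧ ∃ j j', j < j' ∧ j' < σ₃.var vCount ∧
          σ₃.arr aQueue j = (e i).1 ∧ σ₃.arr aQueue j' = v := by
      intro v
      by_cases hv : v ≠ q ∧ v ≠ y
      · obtain ⟨j, hj, hqj⟩ := hfound v hv.2
        have hj0 : 0 < j := by
          rcases Nat.eq_zero_or_pos j with rfl | h
          · exact absurd (Fin.ext (by rw [← hqj, h₃.root])) hv.1
          · exact h
        obtain ⟨i, hi, h₅, h₆, h₇, j', h₈, h₉⟩ := h₃.tree j hj0 hj
        refine ⟨⟨i, hi⟩, fun _ _ => ⟨by rw [← hqj, h₅], Fin.ext ?_, ?_, j', j, h₈, hj, ?_, hqj⟩⟩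
        · rw [← (hL₂ ⟨i, hi⟩).2, ← hqj]; exact h₇
        · exact ⟨⟨_, rfl⟩, (hal ⟨i, hi⟩).1 h₆⟩
        · rw [← (hL₂ ⟨i, hi⟩).1]; exact h₉.symm
      -- For q and y some default edge number is needed; the third vertex guarantees that an edge
      -- exists.
      · have hm : 0 < m := by
          obtain ⟨x, hxq, hxy⟩ := exists_ne_and_ne (by simpa using hn3) q y
          rcases Relation.ReflTransGen.cases_tail (hr x hxy) with h | ⟨_, -, ⟨i, _⟩, _⟩
          · exact absurd h hxq
          · exact i.pos
        exact ⟨⟨0, hm⟩, fun h h' => absurd ⟨h, h'⟩ hv⟩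
    choose c hc using hpar
    refine isSpanningTree_of_parents hqy (fun v => (e (c v)).1)
      (mem_marked_iff h₄ c (fun v hv hvy => ⟨(hc v hv hvy).1, (hc v hv hvy).2.1⟩) hnot)
      (fun v hvy hv => ?_) (fun u v => ∃ j j', j < j' ∧ j' < σ₃.var vCount ∧
          σ₃.arr aQueue j = u ∧ σ₃.arr aQueue j' = v) ?_ ?_ fun v hvy hv => (hc v hv hvy).2.2.2
    · obtain ⟨-, h₅, h₆, -⟩ := hc v hv hvy
      refine ⟨?_, h₆.2.1⟩
      have : e (c v) = ((e (c v)).1, v) := Prod.ext rfl h₅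
      rwa [← this]
    · rintro x ⟨j, j', h₅, h₆, h₇, h₈⟩
      have := h₃.inj j (by omega) j' h₆ (by rw [h₇, h₈])
      omega
    · rintro x y z ⟨i, i', h₅, h₆, h₇, h₈⟩ ⟨j, j', h₉, h₁₀, h₁₁, h₁₂⟩
      have := h₃.inj i' h₆ j (by omega) (by rw [h₈, h₁₁])
      exact ⟨i, j', by omega, h₁₀, h₇, h₁₂⟩

end

/-! ## The derived graph -/

@[simp] abbrev vZ : Var := Var.tmp 13
@[simp] abbrev vK : Var := Var.tmp 14
@[simp] abbrev vLast : Var := Var.tmp 15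
@[simp] abbrev vBest : Var := Var.tmp 16
@[simp] abbrev aCand : Arr := Arr.tmp 10
@[simp] abbrev aKill : Arr := Arr.tmp 11
@[simp] abbrev aTime : Arr := Arr.tmp 12
@[simp] abbrev aAdj : Arr := Arr.tmp 13
@[simp] abbrev aFst : Arr := Arr.tmp 14
@[simp] abbrev aSnd : Arr := Arr.tmp 15

def avoidStep : Cmd :=
  Cmd.ite (Test.eq (Expr.get aS (Expr.var vX)) (Expr.var vZ))
    (Cmd.store aAlive (Expr.var vX) (Expr.lit 0)) (Cmd.store aAlive (Expr.var vX) (Expr.lit 1))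

/-- Compute which vertices `vZ` dominates: those with `aPar x = 0`. -/
def dominated : Cmd :=
  Cmd.seq (forLoop vX vM avoidStep)
    (Cmd.seq search (Cmd.store aPar (Expr.var vZ) (Expr.lit 0)))

/-- Update the topmost dominator of the source of the edge `vX` that does not dominate its end. -/
def deriveStep : Cmd :=
  Cmd.ite (Test.eq (Expr.get aPar (Expr.get aD (Expr.var vX))) (Expr.lit 0))
    (Cmd.ite (Test.and (Test.eq (Expr.get aD (Expr.var vX)) (Expr.var vZ))
        (Test.eq (Expr.get aPar (Expr.get aS (Expr.var vX))) (Expr.lit 0)))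
      (Cmd.store aKill (Expr.var vX) (Expr.lit 1)) Cmd.skip)
    (Cmd.ite (Test.eq (Expr.get aPar (Expr.get aS (Expr.var vX))) (Expr.lit 0))
      (Cmd.ite (Test.eq (Expr.get aCand (Expr.var vX)) (Expr.lit 0))
        (Cmd.store aCand (Expr.var vX) (Expr.succ (Expr.var vZ)))
        (Cmd.ite (Test.eq (Expr.get aPar (Expr.pred (Expr.get aCand (Expr.var vX)))) (Expr.lit 0))
          (Cmd.store aCand (Expr.var vX) (Expr.succ (Expr.var vZ))) Cmd.skip))
      Cmd.skip)

/-- For each edge, find the topmost dominator of its source that does not dominate its end. -/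
def derive : Cmd :=
  forLoop vZ vN (Cmd.seq dominated (forLoop vX vM deriveStep))

section

variable {n m : ℕ} {e : Fin m → Fin n × Fin n} {r : Fin n}

/-- Only edges leaving z are disabled, so the search may still find z itself. Since z dominates z,
its entry is cleared separately. -/
theorem dominated_spec {σ : State} {z : Fin n} (hN : σ.var vN = n) (hM : σ.var vM = m)
    (hr : σ.var vRoot = r) (hz : σ.var vZ = z) (hL : Lists e (σ.arr aS) (σ.arr aD)) :
    Runs dominated σ (400 * (n + m + 1)) fun τ =>
      ∀ x : Fin n, τ.arr aPar x = 0 ↔ Dom (Set.range e) r z x := by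
  refine (Runs.bind (runs_simpleLoop 30 (I := fun k τ => ∀ i < k,
      (τ.arr aAlive i ≠ 0 ↔ σ.arr aS i ≠ z)) (by simp) rfl rfl (by decide) hM (by simp) ?_)
      fun σ₁ hσ₁ h₁ => Runs.bind (search_spec (σ := σ₁) (N := n) (M := m) (r := r) ?_ ?_ ?_ r.2 ?_)
        fun σ₂ hσ₂ h₂ => Runs.simple 10 (by decide) ?_).mono (by omega) fun _ => id
  · intro i hi ρ hρ hx hI
    have h₁ : ρ.arr aS = σ.arr aS := hρ.arr _ rfl
    have h₂ : ρ.var vZ = z := by rw [hρ.var _ rfl, hz]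
    simp at hI hx h₁ h₂
    simp [avoidStep, hx, h₁, h₂]
    refine ⟨fun hsy j hj => ?_, fun hsy j hj => ?_⟩
    all_goals
      by_cases hji : j = i
      · simp [*]
      · simpa [hji] using hI j (by omega)
  · rw [hσ₁.var _ rfl, hN]
  · rw [hσ₁.var _ rfl, hM]
  · rw [hσ₁.var _ rfl, hr]
  · intro i hi _
    rw [hσ₁.arr _ rfl, hσ₁.arr _ rfl, (hL ⟨i, hi⟩).1, (hL ⟨i, hi⟩).2]
    exact ⟨Fin.is_lt _, Fin.is_lt _⟩
  · have hz₂ : σ₂.var vZ = z := by rw [hσ₂.var _ rfl, hσ₁.var _ rfl, hz]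
    have hE : edgesIn e (live m (σ₁.arr aAlive)) = {a ∈ Set.range e | a.1 ≠ z} := by
      ext x
      constructor
      · rintro ⟨i, hi, rfl⟩
        refine ⟨⟨i, rfl⟩, fun h => (h₁ i i.2).1 hi.2 ?_⟩
        rw [(hL i).1, h]
      · rintro ⟨⟨i, rfl⟩, hi⟩
        refine ⟨i, ⟨i.2, (h₁ i i.2).2 fun h => hi (Fin.ext ?_)⟩, rfl⟩
        rw [← (hL i).1, h]
    simp at hz₂
    simp only [Cmd.wp, State.setArr_arr, Expr.eval]
    simp [hz₂]
    intro x
    by_cases hxz : x = z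
    · subst hxz
      simp [Dom.refl]
    · rw [Function.update_of_ne fun h => hxz (Fin.ext h)]
      have := h₂.par_ne_zero_iff x.2
      rw [hσ₁.arr aS rfl, hσ₁.arr aD rfl, conn_iff_reach hL fun i hi => hi.1, hE] at this
      rw [Dom, Avoids, ← this]
      simp [hxz]

/-- The invariant of `derive` for an edge from `p` to `v`, after the vertices below `k` have been
considered. -/
structure DeriveInv (E : Set (Fin n × Fin n)) (r : Fin n) (p v : Fin n) (k c b : ℕ) : Prop where
  cand : (c = 0 ∧ ∀ z : Fin n, (z : ℕ) < k → Dom E r z p → Dom E r z v) ∨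
    ∃ c' : Fin n, c = c' + 1 ∧ Dom E r c' p ∧ ¬ Dom E r c' v ∧
      ∀ z : Fin n, (z : ℕ) < k → Dom E r z p → ¬ Dom E r z v → Dom E r c' z
  kill : b ≠ 0 ↔ (v : ℕ) < k ∧ Dom E r v p

theorem DeriveInv.succ_of_imp {E : Set (Fin n × Fin n)} {p v z : Fin n} {c b b' : ℕ}
    (h : DeriveInv E r p v z c b) (hz : Dom E r z p → Dom E r z v)
    (hb : b' ≠ 0 ↔ b ≠ 0 ∨ (v = z ∧ Dom E r z p)) : DeriveInv E r p v (z + 1) c b' := by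
  have aux : ∀ x : Fin n, (x : ℕ) < z + 1 → (x : ℕ) < z ∨ x = z := fun x hx => by
    rcases Nat.lt_succ_iff_lt_or_eq.1 hx with h | h
    · exact Or.inl h
    · exact Or.inr (Fin.ext h)
  constructor
  · rcases h.cand with ⟨hc, h₁⟩ | ⟨c', hc, h₁, h₂, h₃⟩
    · refine Or.inl ⟨hc, fun x hx hxp => ?_⟩
      rcases aux x hx with hx | rfl
      · exact h₁ x hx hxp
      · exact hz hxp
    · refine Or.inr ⟨c', hc, h₁, h₂, fun x hx hxp hxv => ?_⟩
      rcases aux x hx with hx | rfl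
      · exact h₃ x hx hxp hxv
      · exact absurd (hz hxp) hxv
  · rw [hb, h.kill]
    constructor
    · rintro (⟨h₁, h₂⟩ | ⟨rfl, h₂⟩)
      · exact ⟨by omega, h₂⟩
      · exact ⟨by omega, h₂⟩
    · rintro ⟨h₁, h₂⟩
      rcases aux v h₁ with h | rfl
      · exact Or.inl ⟨h, h₂⟩
      · exact Or.inr ⟨rfl, h₂⟩

theorem DeriveInv.kill_succ {E : Set (Fin n × Fin n)} {p v z : Fin n} {c b : ℕ}
    (h : DeriveInv E r p v z c b) (hzv : ¬ Dom E r z v) :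
    b ≠ 0 ↔ (v : ℕ) < z + 1 ∧ Dom E r v p := by
  have hvz : (v : ℕ) ≠ z := fun h => hzv (by rw [Fin.ext h]; exact Dom.refl z)
  rw [h.kill]
  exact and_congr_left fun _ => by omega

/-- A z that dominates the old candidate dominates, by transitivity, all that the old candidate did.
-/
theorem DeriveInv.succ_new {E : Set (Fin n × Fin n)} {p v z : Fin n} {c b : ℕ}
    (h : DeriveInv E r p v z c b) (hzp : Dom E r z p) (hzv : ¬ Dom E r z v)
    (hc : ∀ c' : Fin n, c = c' + 1 → Dom E r z c') : DeriveInv E r p v (z + 1) (z + 1) b := by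
  refine ⟨Or.inr ⟨z, rfl, hzp, hzv, fun x hx hxp hxv => ?_⟩, h.kill_succ hzv⟩
  rcases Nat.lt_succ_iff_lt_or_eq.1 hx with hx | hx
  · rcases h.cand with ⟨-, h₁⟩ | ⟨c', hc', h₁, h₂, h₃⟩
    · exact absurd (h₁ x hx hxp) hxv
    · exact (hc c' hc').trans (h₃ x hx hxp hxv)
  · rw [Fin.ext hx]
    exact Dom.refl z

/-- Both z and the candidate dominate p, hence are comparable; so the candidate stays on top. -/
theorem DeriveInv.succ_old {E : Set (Fin n × Fin n)} (hr : ∀ x, Reach E r x) {p v z c' : Fin n}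
    {c b : ℕ} (h : DeriveInv E r p v z c b) (hzp : Dom E r z p) (hzv : ¬ Dom E r z v)
    (hcc : c = c' + 1) (hc : ¬ Dom E r z c') : DeriveInv E r p v (z + 1) c b := by
  refine ⟨?_, h.kill_succ hzv⟩
  rcases h.cand with ⟨h₀, -⟩ | ⟨c'', hc', h₁, h₂, h₃⟩
  · omega
  · obtain rfl : c' = c'' := Fin.ext (by omega)
    refine Or.inr ⟨c', hc', h₁, h₂, fun x hx hxp hxv => ?_⟩
    rcases Nat.lt_succ_iff_lt_or_eq.1 hx with hx | hx
    · exact h₃ x hx hxp hxv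
    · rw [Fin.ext hx]
      exact (h₁.total hr hzp).resolve_right hc

theorem derive_spec {σ : State} (hr : ∀ x, Reach (Set.range e) r x) (hN : σ.var vN = n)
    (hM : σ.var vM = m) (hroot : σ.var vRoot = r) (hL : Lists e (σ.arr aS) (σ.arr aD))
    (hc : ∀ i < m, σ.arr aCand i = 0) (hk : ∀ i < m, σ.arr aKill i = 0) :
    Runs derive σ ((500 * (n + m + 1) + 8) * (n + 1)) fun τ => ∀ i : Fin m,
      DeriveInv (Set.range e) r (e i).1 (e i).2 n (τ.arr aCand i) (τ.arr aKill i) := by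
  refine runs_forLoop (I := fun k τ => ∀ i : Fin m,
      DeriveInv (Set.range e) r (e i).1 (e i).2 k (τ.arr aCand i) (τ.arr aKill i)) (by simp) rfl
      rfl hN ?_ ?_
  · intro i
    simp only [State.setVar_arr]
    rw [hc i i.2, hk i i.2]
    exact ⟨Or.inl ⟨rfl, by simp⟩, by simp⟩
  · intro z hz ρ hρ hvz hI
    have hL' : Lists e (ρ.arr aS) (ρ.arr aD) := by rwa [hρ.arr _ rfl, hρ.arr _ rfl]
    have hM' : ρ.var vM = m := by rw [hρ.var _ rfl, hM]
    refine (Runs.bind (dominated_spec (z := ⟨z, hz⟩) (e := e) (r := r) (by rw [hρ.var _ rfl, hN])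
      hM' (by rw [hρ.var _ rfl, hroot]) hvz hL') fun ρ₁ hρ₁ h₁ =>
      -- During the pass for z, the edges numbered below k have already taken z into account, the
      -- others not yet.
      runs_simpleLoop 50 (I := fun k τ => ∀ i : Fin m,
        DeriveInv (Set.range e) r (e i).1 (e i).2 (if (i : ℕ) < k then z + 1 else z)
          (τ.arr aCand i) (τ.arr aKill i)) (by simp) rfl rfl (by decide)
        (by rw [hρ₁.var _ rfl, hM']) ?_ ?_).mono (by omega) fun τ hτ i => ?_
    · intro i
      simp only [State.setVar_arr, Nat.not_lt_zero, if_false]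
      rw [hρ₁.arr _ rfl, hρ₁.arr _ rfl]
      exact hI i
    · intro i hi τ hτ hx hI
      have hS : τ.arr aS i = (e ⟨i, hi⟩).1 := by
        rw [hτ.arr _ rfl, hρ₁.arr _ rfl]; exact (hL' ⟨i, hi⟩).1
      have hD : τ.arr aD i = (e ⟨i, hi⟩).2 := by
        rw [hτ.arr _ rfl, hρ₁.arr _ rfl]; exact (hL' ⟨i, hi⟩).2
      have hP : τ.arr aPar = ρ₁.arr aPar := hτ.arr _ rfl
      have hZ : τ.var vZ = z := by rw [hτ.var _ rfl, hρ₁.var _ rfl, hvz]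
      have hi' := hI ⟨i, hi⟩
      simp only [lt_irrefl, if_false] at hi'
      have upd : ∀ c b, DeriveInv (Set.range e) r (e ⟨i, hi⟩).1 (e ⟨i, hi⟩).2 (z + 1) c b →
          ∀ j : Fin m, DeriveInv (Set.range e) r (e j).1 (e j).2
            (if (j : ℕ) < i + 1 then z + 1 else z) (Function.update (τ.arr aCand) i c j)
              (Function.update (τ.arr aKill) i b j) := by
        intro c b h j
        by_cases hji : j = ⟨i, hi⟩
        · subst hji
          simpa using h
        · have hji' : (j : ℕ) ≠ i := fun h => hji (Fin.ext h)
          rw [Function.update_of_ne hji', Function.update_of_ne hji']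
          have := hI j
          by_cases hlt : (j : ℕ) < i
          · simpa [hlt, Nat.lt_succ_of_lt hlt] using this
          · simpa [hlt, show ¬ (j : ℕ) < i + 1 by omega] using this
      have updc := fun c h => upd c (τ.arr aKill i) h
      have updb := fun b h => upd (τ.arr aCand i) b h
      have upd0 := upd (τ.arr aCand i) (τ.arr aKill i)
      simp only [Function.update_eq_self] at updc updb upd0
      have hv := h₁ (e ⟨i, hi⟩).2
      have hp := h₁ (e ⟨i, hi⟩).1
      simp at hx hS hD hP hZ hv hp h₁ updc updb upd0 hi'
      simp only [deriveStep, Cmd.wp, Test.holds, Expr.eval, aCand, aKill, aPar, aS, aD, vX, vZ, hx,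
        hS, hD, hP, hZ, hv, hp, State.setVar_arr, State.setArr_arr]
      simp
      refine ⟨fun hzv => ⟨fun hvz hzp => ?_, fun hcon => ?_⟩, fun hzv => ⟨fun hzp =>
        ⟨fun hc0 => ?_, fun hc0 => ⟨fun hcp => ?_, fun hcp => ?_⟩⟩, fun hzp => ?_⟩⟩
      · exact updb 1 (hi'.succ_of_imp (z := ⟨z, hz⟩) (fun _ => hzv) (by
          simp [Fin.ext_iff, hvz, hzp]))
      · refine upd0 (hi'.succ_of_imp (z := ⟨z, hz⟩) (fun _ => hzv) ?_)
        rw [iff_self_or]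
        rintro ⟨h, h'⟩
        exact absurd h' (hcon (congrArg Fin.val h))
      · exact updc (z + 1) (hi'.succ_new (z := ⟨z, hz⟩) hzp hzv fun c' hc' => by omega)
      · refine updc (z + 1) (hi'.succ_new (z := ⟨z, hz⟩) hzp hzv fun c' hc' => ?_)
        rw [← h₁, ← hcp, hc']
        simp
      · obtain ⟨c', hc'⟩ : ∃ c' : Fin n, τ.arr (Arr.tmp 10) i = c' + 1 := by
          rcases hi'.cand with ⟨h, -⟩ | ⟨c', h, -⟩
          · exact absurd h hc0
          · exact ⟨c', h⟩
        refine upd0 (hi'.succ_old (z := ⟨z, hz⟩) hr hzp hzv hc' fun h => hcp ?_)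
        rw [← h₁] at h
        rw [hc']
        simpa using h
      · exact upd0 (hi'.succ_of_imp (z := ⟨z, hz⟩) (fun h => absurd h hzp) (by simp [hzp]))
    · have := hτ i
      simpa using this

end

/-! ## Ordering the vertices -/

section

variable {n m : ℕ} {e₁ : Fin m → Fin n × Fin n} {K : Fin m → Prop} {r : Fin n}

/-- The kept edges that do not end in a vertex that has been removed. -/
def remaining (e₁ : Fin m → Fin n × Fin n) (K : Fin m → Prop) (time : ℕ → ℕ) :
    Set (Fin n × Fin n) :=
  {g | ∃ i, K i ∧ e₁ i = g ∧ time g.2 = 0}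

/-- The state of the ordering algorithm after `k` vertices have been removed: `time v` is the number
of the step in which `v` was removed, `adj v` is an edge to `v` from the root or a removed vertex,
and `fst v` and `snd v` are the parent edges of `v` in the two trees. -/
structure ShellInv (e₁ : Fin m → Fin n × Fin n) (K : Fin m → Prop) (r : Fin n) (k : ℕ)
    (time adj fst snd : ℕ → ℕ) : Prop where
  time_le : ∀ v : Fin n, time v ≤ k
  time_root : time r = 0
  card : (Finset.univ.filter fun v : Fin n => time v ≠ 0).card = k
  reach : ∀ x : Fin n, time x = 0 → Reach (remaining e₁ K time) r x
  adj_edge : ∀ v : Fin n, time v = 0 → adj v ≠ 0 →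
    ∃ i : Fin m, K i ∧ adj v = i + 1 ∧ (e₁ i).2 = v ∧ ((e₁ i).1 = r ∨ time (e₁ i).1 ≠ 0)
  adj_ne : ∀ i : Fin m, K i → ((e₁ i).1 = r ∨ time (e₁ i).1 ≠ 0) → adj (e₁ i).2 ≠ 0
  fst_edge : ∀ v : Fin n, time v ≠ 0 → ∃ i : Fin m, K i ∧ fst v = i + 1 ∧ (e₁ i).2 = v ∧
    ((e₁ i).1 = r ∨ (time (e₁ i).1 ≠ 0 ∧ time (e₁ i).1 < time v))
  snd_edge : ∀ v : Fin n, time v ≠ 0 → ∃ i : Fin m, K i ∧ snd v = i + 1 ∧ (e₁ i).2 = v ∧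
    ((e₁ i).1 = r ∨ time (e₁ i).1 = 0 ∨ time v < time (e₁ i).1)

variable {k : ℕ} {time adj fst snd S D al q par : ℕ → ℕ} {c : ℕ}

theorem ShellInv.reach_iff (hL : Lists e₁ S D)
    (hal : ∀ i : Fin m, al i ≠ 0 ↔ K i ∧ time (e₁ i).2 = 0)
    (hs : Searched n m S D al r q c par) (x : Fin n) :
    (∃ j < c, q j = x) ↔ Reach (remaining e₁ K time) r x := by
  have hE : edgesIn e₁ (live m al) = remaining e₁ K time := by
    ext g
    constructor
    · rintro ⟨i, hi, rfl⟩
      exact ⟨i, ((hal i).1 hi.2).1, rfl, ((hal i).1 hi.2).2⟩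
    · rintro ⟨i, hi, rfl, ht⟩
      exact ⟨i, ⟨i.2, (hal i).2 ⟨hi, ht⟩⟩, rfl⟩
  rw [← hs.par_iff x x.2, hs.par_ne_zero_iff x.2, conn_iff_reach hL fun i hi => hi.1, hE]

/-- Some vertex other than the root remains. The first edge on a path to it leads from the root to a
remaining vertex, which is a candidate for removal. -/
theorem ShellInv.exists_adj (H : ShellInv e₁ K r k time adj fst snd) (hk : k + 1 < n)
    (hL : Lists e₁ S D) (hal : ∀ i : Fin m, al i ≠ 0 ↔ K i ∧ time (e₁ i).2 = 0)
    (hs : Searched n m S D al r q c par) : ∃ j < c, adj (q j) ≠ 0 := by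
  classical
  obtain ⟨x, hx⟩ : ∃ x, x ∉ insert r (Finset.univ.filter fun v : Fin n => time v ≠ 0) := by
    by_contra hc
    push Not at hc
    have h₁ := Finset.card_le_card (s := (Finset.univ : Finset (Fin n))) fun x _ => hc x
    have h₂ := Finset.card_insert_le r (Finset.univ.filter fun v : Fin n => time v ≠ 0)
    rw [H.card] at h₂
    rw [Finset.card_univ, Fintype.card_fin] at h₁
    omega
  simp only [Finset.mem_insert, Finset.mem_filter, Finset.mem_univ, true_and, not_or,
    ne_eq, not_not] at hx
  rcases Relation.ReflTransGen.cases_head (H.reach x hx.2) with h | ⟨y, ⟨i, hi, hiy, ht⟩, -⟩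
  · exact absurd h.symm hx.1
  · have hy := (ShellInv.reach_iff hL hal hs y).2 (H.reach y ht)
    obtain ⟨j, hj, hqj⟩ := hy
    refine ⟨j, hj, ?_⟩
    have := H.adj_ne i hi (Or.inl (by rw [hiy]))
    rwa [hiy, ← hqj] at this

/-- The point is that removing b disconnects nothing. Any other remaining candidate precedes b in
search order, so its search tree path avoids b. By `hstar` any remaining x has a path avoiding b in
the derived graph; behind its last visit to the root or a removed vertex it continues from such a
candidate through remaining vertices. -/
theorem ShellInv.step (H : ShellInv e₁ K r k time adj fst snd)
    (hstar : ∀ a x, a ≠ r → x ≠ a → Reach {g | (∃ i, K i ∧ e₁ i = g) ∧ g.1 ≠ a} r x)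
    (hroot : ∀ i, K i → (e₁ i).2 ≠ r)
    (hL : Lists e₁ S D) (hal : ∀ i : Fin m, al i ≠ 0 ↔ K i ∧ time (e₁ i).2 = 0)
    (hs : Searched n m S D al r q c par) {b : Fin n} {jb : ℕ} (hjb : jb < c) (hqb : q jb = b)
    (hadj : adj b ≠ 0) (hlast : ∀ j < c, jb < j → adj (q j) = 0) {adj' : ℕ → ℕ}
    (hadj' : ∀ v : Fin n, (adj' v = adj v ∧ ∀ i, K i → (e₁ i).1 = b → (e₁ i).2 ≠ v) ∨
      ∃ i : Fin m, K i ∧ (e₁ i).1 = b ∧ (e₁ i).2 = v ∧ adj' v = i + 1) :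
    ShellInv e₁ K r (k + 1) (Function.update time b (k + 1)) adj'
      (Function.update fst b (adj b)) (Function.update snd b (par b)) := by
  classical
  have htime : ∀ v : Fin n, Function.update time b (k + 1) v = if v = b then k + 1 else time v := by
    intro v
    by_cases h : v = b
    · simp [h]
    · rw [Function.update_of_ne fun h' => h (Fin.ext h'), if_neg h]
  have hqtime : ∀ j < c, ∀ x : Fin n, q j = x → time x = 0 := by
    intro j hj x hjx
    have := (ShellInv.reach_iff hL hal hs x).1 ⟨j, hj, hjx⟩
    rcases Relation.ReflTransGen.cases_tail this with h | ⟨_, -, ⟨_, _, _, h⟩⟩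
    · rw [h]; exact H.time_root
    · exact h
  have hb0 : time b = 0 := hqtime jb hjb b hqb
  obtain ⟨ib, hib, hib₁, hib₂, hib₃⟩ := H.adj_edge b hb0 hadj
  have hbr : b ≠ r := fun h => hroot ib hib (hib₂.trans h)
  have hjb0 : 0 < jb := by
    rcases Nat.eq_zero_or_pos jb with rfl | h
    · exact absurd (Fin.ext (by rw [← hqb, hs.root])) hbr
    · exact h
  refine ⟨fun v => ?_, ?_, ?_, fun x hx => ?_, fun v hv hav => ?_, fun i hi hsrc => ?_,
    fun v hv => ?_, fun v hv => ?_⟩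
  · rw [htime]
    split_ifs
    · exact le_rfl
    · exact (H.time_le v).trans (Nat.le_succ k)
  · rw [htime, if_neg hbr.symm, H.time_root]
  · have : (Finset.univ.filter fun v : Fin n => Function.update time b (k + 1) v ≠ 0) =
        insert b (Finset.univ.filter fun v : Fin n => time v ≠ 0) := by
      ext v
      simp only [Finset.mem_filter, Finset.mem_univ, true_and, Finset.mem_insert, htime]
      by_cases h : v = b <;> simp [h]
    rw [this, Finset.card_insert_of_notMem (by simp [hb0]), H.card]
  · rw [htime] at hx
    have hxb : x ≠ b := by
      rintro rfl
      simp at hx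
    rw [if_neg hxb] at hx
    -- Tree paths to vertices found before b use only vertices found before b.
    have key : ∀ j < c, j < jb → ∀ y : Fin n, q j = y →
        Reach {g | (∃ i, K i ∧ e₁ i = g) ∧ g.2 ∉ {v : Fin n | time v ≠ 0} ∧ g.2 ≠ b} r y := by
      intro j
      induction j using Nat.strong_induction_on with
      | _ j ih =>
        intro hj hjj y hy
        rcases Nat.eq_zero_or_pos j with rfl | hpos
        · rw [show y = r from Fin.ext (by rw [← hy, hs.root])]
          exact Relation.ReflTransGen.refl
        · obtain ⟨i, hi, -, hali, hDi, j', hj', hSi⟩ := hs.tree j hpos hj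
          obtain ⟨h₁, h₂⟩ := (hal ⟨i, hi⟩).1 hali
          have h₃ := (hL ⟨i, hi⟩).1
          have h₄ : (e₁ ⟨i, hi⟩).2 = y := Fin.ext (by rw [← (hL ⟨i, hi⟩).2, ← hy]; exact hDi)
          have hyb : y ≠ b := by
            rintro rfl
            have := hs.inj j hj jb hjb (by rw [hy, hqb])
            omega
          refine (ih j' hj' (by omega) (by omega) (e₁ ⟨i, hi⟩).1 (by rw [← hSi]; exact h₃)).tail
            ⟨⟨⟨i, hi⟩, h₁, by rw [← h₄]⟩, ?_, hyb⟩
          simpa [← h₄] using h₂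
    have hshell := reach_of_shell (r := r) (G := {g | ∃ i, K i ∧ e₁ i = g})
      (R := {v : Fin n | time v ≠ 0}) (hstar b x hbr hxb) (by simpa using hx) hxb ?_
    · refine hshell.mono ?_
      rintro g ⟨⟨i, hi, hg⟩, h₁, h₂⟩
      refine ⟨i, hi, hg, ?_⟩
      rw [htime, if_neg h₂]
      simpa using h₁
    · rintro a y ⟨i, hi, hiy⟩ ha hyR hyb
      have hy0 : time y = 0 := by simpa using hyR
      obtain ⟨j, hj, hqj⟩ := (ShellInv.reach_iff hL hal hs y).2 (H.reach y hy0)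
      have hadjy : adj y ≠ 0 := by
        have := H.adj_ne i hi (by rw [hiy]; exact ha)
        rwa [hiy] at this
      refine key j hj ?_ y hqj
      by_contra hle
      rcases Nat.lt_or_ge jb j with h | h
      · exact hadjy (by rw [← hqj]; exact hlast j hj h)
      · obtain rfl : j = jb := by omega
        exact hyb (Fin.ext (by rw [← hqj, hqb]))
  · rw [htime] at hv
    have hvb : v ≠ b := by
      rintro rfl
      simp at hv
    rw [if_neg hvb] at hv
    rcases hadj' v with ⟨h₁, -⟩ | ⟨i, hi, h₁, h₂, h₃⟩
    · rw [h₁] at hav ⊢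
      obtain ⟨i, h₂, h₃, h₄, h₅⟩ := H.adj_edge v hv hav
      refine ⟨i, h₂, h₃, h₄, h₅.imp_right fun h => ?_⟩
      rw [htime]
      split_ifs
      · omega
      · exact h
    · refine ⟨i, hi, h₃, h₂, Or.inr ?_⟩
      rw [htime, if_pos h₁]
      omega
  · rcases hadj' (e₁ i).2 with ⟨h₁, h₂⟩ | ⟨i', _, _, _, h₃⟩
    · rw [h₁]
      refine H.adj_ne i hi (hsrc.imp_right fun h => ?_)
      rwa [htime, if_neg fun h => h₂ i hi h rfl] at h
    · omega
  · by_cases hvb : v = b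
    · subst hvb
      -- The first parent of b is the root or was removed before, hence has a smaller time.
      refine ⟨ib, hib, by simpa using hib₁, hib₂, hib₃.imp_right fun h => ?_⟩
      have hne : (e₁ ib).1 ≠ v := fun h' => h (h' ▸ hb0)
      rw [htime, htime, if_neg hne, if_pos rfl]
      exact ⟨h, Nat.lt_succ_of_le (H.time_le _)⟩
    · rw [htime, if_neg hvb] at hv
      rw [Function.update_of_ne fun h => hvb (Fin.ext h)]
      obtain ⟨i, h₁, h₂, h₃, h₄⟩ := H.fst_edge v hv
      refine ⟨i, h₁, h₂, h₃, h₄.imp_right fun h => ?_⟩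
      have hne : (e₁ i).1 ≠ b := fun h' => h.1 (h' ▸ hb0)
      rwa [htime, htime, if_neg hne, if_neg hvb]
  · by_cases hvb : v = b
    · subst hvb
      obtain ⟨i, hi, h₁, hali, hDi, j', hj', hSi⟩ := hs.tree jb hjb0 hjb
      obtain ⟨h₂, h₃⟩ := (hal ⟨i, hi⟩).1 hali
      have h₄ := (hL ⟨i, hi⟩).1
      have h₅ : (e₁ ⟨i, hi⟩).2 = v := Fin.ext (by rw [← (hL ⟨i, hi⟩).2, ← hqb]; exact hDi)
      have h₆ : q j' = (e₁ ⟨i, hi⟩).1 := by rw [← hSi]; exact h₄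
      -- The second parent is the search tree parent of b. It has not been removed, so it is the
      -- root or will get a larger time.
      refine ⟨⟨i, hi⟩, h₂, ?_, h₅, Or.inr (Or.inl ?_)⟩
      · rw [Function.update_self, ← hqb]; exact h₁
      · have hne : (e₁ ⟨i, hi⟩).1 ≠ v := by
          intro h
          have := hs.inj j' (by omega) jb hjb (by rw [h₆, hqb, h])
          omega
        rw [htime, if_neg hne]
        exact hqtime j' (by omega) _ h₆
    · rw [htime, if_neg hvb] at hv
      rw [Function.update_of_ne fun h => hvb (Fin.ext h)]
      obtain ⟨i, h₁, h₂, h₃, h₄⟩ := H.snd_edge v hv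
      refine ⟨i, h₁, h₂, h₃, h₄.imp_right fun h => ?_⟩
      rw [htime, htime, if_neg hvb]
      have := H.time_le v
      split_ifs
      · exact Or.inr (by omega)
      · exact h

/-- The root is never removed, so n - 1 removals exhaust the other vertices. -/
theorem ShellInv.time_ne_zero (H : ShellInv e₁ K r k time adj fst snd) (hk : k + 1 = n)
    {v : Fin n} (hv : v ≠ r) : time v ≠ 0 := by
  classical
  have hsub : (Finset.univ.filter fun v : Fin n => time v ≠ 0) ⊆ Finset.univ.erase r := by
    intro x hx
    simp only [Finset.mem_filter, Finset.mem_univ, true_and] at hx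
    simp only [Finset.mem_erase, Finset.mem_univ, and_true]
    rintro rfl
    exact hx H.time_root
  have heq := Finset.eq_of_subset_of_card_le hsub (by
    rw [H.card, Finset.card_erase_of_mem (Finset.mem_univ r), Finset.card_univ, Fintype.card_fin]
    omega)
  have : v ∈ Finset.univ.erase r := by simp [hv]
  rw [← heq] at this
  simpa using this

end

/-- Sources are overwritten in place and edge numbers kept. Thus parent edges found in the derived
graph are directly numbers of original edges. -/
def setupStep : Cmd :=
  Cmd.ite (Test.eq (Expr.get aCand (Expr.var vX)) (Expr.lit 0))
    (Cmd.seq (Cmd.store aS (Expr.var vX) (Expr.var vRoot))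
      (Cmd.ite (Test.eq (Expr.get aKill (Expr.var vX)) (Expr.lit 0))
        (Cmd.store aAdj (Expr.get aD (Expr.var vX)) (Expr.succ (Expr.var vX))) Cmd.skip))
    (Cmd.store aS (Expr.var vX) (Expr.pred (Expr.get aCand (Expr.var vX))))

/-- Replace the graph by the derived graph. -/
def setupOrder : Cmd :=
  Cmd.seq (forLoop vX vN (Cmd.seq (Cmd.store aTime (Expr.var vX) (Expr.lit 0))
      (Cmd.store aAdj (Expr.var vX) (Expr.lit 0))))
    (forLoop vX vM setupStep)

def aliveStep : Cmd :=
  Cmd.ite (Test.eq (Expr.get aKill (Expr.var vX)) (Expr.lit 0))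
    (Cmd.ite (Test.eq (Expr.get aTime (Expr.get aD (Expr.var vX))) (Expr.lit 0))
      (Cmd.store aAlive (Expr.var vX) (Expr.lit 1)) (Cmd.store aAlive (Expr.var vX) (Expr.lit 0)))
    (Cmd.store aAlive (Expr.var vX) (Expr.lit 0))

def bestStep : Cmd :=
  Cmd.ite (Test.eq (Expr.get aAdj (Expr.get aQueue (Expr.var vX))) (Expr.lit 0)) Cmd.skip
    (Cmd.assign vBest (Expr.get aQueue (Expr.var vX)))

/-- Times start at 1, so that 0 keeps meaning "not removed". -/
def recordBest : Cmd :=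
  Cmd.seq (Cmd.store aFst (Expr.var vBest) (Expr.get aAdj (Expr.var vBest)))
  (Cmd.seq (Cmd.store aSnd (Expr.var vBest) (Expr.get aPar (Expr.var vBest)))
    (Cmd.store aTime (Expr.var vBest) (Expr.succ (Expr.var vK))))

def adjStep : Cmd :=
  Cmd.ite (Test.eq (Expr.get aKill (Expr.var vX)) (Expr.lit 0))
    (Cmd.ite (Test.eq (Expr.get aS (Expr.var vX)) (Expr.var vBest))
      (Cmd.store aAdj (Expr.get aD (Expr.var vX)) (Expr.succ (Expr.var vX))) Cmd.skip)
    Cmd.skip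

/-- Remove the last vertex found by a search that has an edge from the root or a removed vertex. -/
def shellStep : Cmd :=
  Cmd.seq (forLoop vX vM aliveStep)
  (Cmd.seq search
  (Cmd.seq (forLoop vX vCount bestStep)
  (Cmd.seq recordBest (forLoop vX vM adjStep))))

section

variable {n m : ℕ} {e₁ : Fin m → Fin n × Fin n} {r : Fin n}

theorem shellStep_spec {σ : State} {k : ℕ} (hN : σ.var vN = n) (hM : σ.var vM = m)
    (hroot : σ.var vRoot = r) (hK : σ.var vK = k) (hL : Lists e₁ (σ.arr aS) (σ.arr aD))
    (hkn : k + 1 < n)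
    (hstar : ∀ a x, a ≠ r → x ≠ a →
      Reach {g | (∃ i : Fin m, σ.arr aKill i = 0 ∧ e₁ i = g) ∧ g.1 ≠ a} r x)
    (hnr : ∀ i : Fin m, σ.arr aKill i = 0 → (e₁ i).2 ≠ r)
    (H : ShellInv e₁ (fun i => σ.arr aKill i = 0) r k (σ.arr aTime) (σ.arr aAdj) (σ.arr aFst)
      (σ.arr aSnd)) :
    Runs shellStep σ (500 * (n + m + 1)) fun τ =>
      ShellInv e₁ (fun i => τ.arr aKill i = 0) r (k + 1) (τ.arr aTime) (τ.arr aAdj) (τ.arr aFst)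
        (τ.arr aSnd) := by
  suffices h : Runs shellStep σ ((30 + 8) * (m + 1) + (300 * (n + m + 1) + ((20 + 8) * (n + 1) +
      (20 + (30 + 8) * (m + 1))))) fun τ =>
      ShellInv e₁ (fun i => τ.arr aKill i = 0) r (k + 1) (τ.arr aTime) (τ.arr aAdj) (τ.arr aFst)
        (τ.arr aSnd) from h.mono (by omega) fun _ => id
  refine Runs.bind (runs_simpleLoop 30 (I := fun k τ => ∀ i < k, (τ.arr aAlive i ≠ 0 ↔
      σ.arr aKill i = 0 ∧ σ.arr aTime (σ.arr aD i) = 0)) (by simp) rfl rfl (by decide) hM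
      (by simp) ?_) fun σ₁ hσ₁ h₁ =>
    Runs.bind (search_spec (σ := σ₁) (N := n) (M := m) (r := r) ?_ ?_ ?_ r.2 ?_)
      fun σ₂ hσ₂ hs => ?_
  · intro i hi ρ hρ hx hI
    have h₁ : ρ.arr aKill = σ.arr aKill := hρ.arr _ rfl
    have h₂ : ρ.arr aTime = σ.arr aTime := hρ.arr _ rfl
    have h₃ : ρ.arr aD = σ.arr aD := hρ.arr _ rfl
    simp at hI hx h₁ h₂ h₃
    simp [aliveStep, hx, h₁, h₂, h₃]
    refine ⟨fun hk => ⟨fun ht j hj => ?_, fun ht j hj => ?_⟩, fun hk j hj => ?_⟩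
    all_goals
      by_cases hji : j = i
      · simp [*]
      · simpa [hji] using hI j (by omega)
  · rw [hσ₁.var _ rfl, hN]
  · rw [hσ₁.var _ rfl, hM]
  · rw [hσ₁.var _ rfl, hroot]
  · intro i hi _
    rw [hσ₁.arr _ rfl, hσ₁.arr _ rfl, (hL ⟨i, hi⟩).1, (hL ⟨i, hi⟩).2]
    exact ⟨Fin.is_lt _, Fin.is_lt _⟩
  have hkill₂ : σ₂.arr aKill = σ.arr aKill := by rw [hσ₂.arr _ rfl, hσ₁.arr _ rfl]
  have htime₂ : σ₂.arr aTime = σ.arr aTime := by rw [hσ₂.arr _ rfl, hσ₁.arr _ rfl]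
  have hadj₂ : σ₂.arr aAdj = σ.arr aAdj := by rw [hσ₂.arr _ rfl, hσ₁.arr _ rfl]
  have hfst₂ : σ₂.arr aFst = σ.arr aFst := by rw [hσ₂.arr _ rfl, hσ₁.arr _ rfl]
  have hsnd₂ : σ₂.arr aSnd = σ.arr aSnd := by rw [hσ₂.arr _ rfl, hσ₁.arr _ rfl]
  have hS₂ : σ₂.arr aS = σ.arr aS := by rw [hσ₂.arr _ rfl, hσ₁.arr _ rfl]
  have hD₂ : σ₂.arr aD = σ.arr aD := by rw [hσ₂.arr _ rfl, hσ₁.arr _ rfl]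
  have hM₂ : σ₂.var vM = m := by rw [hσ₂.var _ rfl, hσ₁.var _ rfl, hM]
  have hK₂ : σ₂.var vK = k := by rw [hσ₂.var _ rfl, hσ₁.var _ rfl, hK]
  have hal : ∀ i : Fin m, σ₁.arr aAlive i ≠ 0 ↔
      σ.arr aKill i = 0 ∧ σ.arr aTime (e₁ i).2 = 0 := fun i => by
    rw [h₁ i i.2, (hL i).2]
  rw [hσ₁.arr aS rfl, hσ₁.arr aD rfl] at hs
  have hcn := hs.count_le
  obtain ⟨j₀, hj₀, hadj₀⟩ := H.exists_adj hkn hL hal hs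
  -- Overwriting `vBest` during the scan leaves the last suitable vertex of the queue.
  refine Runs.bind ((runs_simpleLoop 20 (B := σ₂.var vCount) (I := fun k τ =>
      (∀ j < k, σ.arr aAdj (σ₂.arr aQueue j) = 0) ∨
      ∃ jb < k, τ.var vBest = σ₂.arr aQueue jb ∧ σ.arr aAdj (σ₂.arr aQueue jb) ≠ 0 ∧
        ∀ j < k, jb < j → σ.arr aAdj (σ₂.arr aQueue j) = 0) (by simp) rfl rfl (by decide) rfl
      (by simp) ?_).mono (L := (20 + 8) * (n + 1)) (by omega) fun _ => id) fun σ₃ hσ₃ h₃ => ?_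
  · intro i hi ρ hρ hx hI
    have h₁ : ρ.arr aQueue = σ₂.arr aQueue := hρ.arr _ rfl
    have h₂ : ρ.arr aAdj = σ.arr aAdj := by rw [hρ.arr _ rfl, hadj₂]
    simp at hI hx h₁ h₂
    simp [bestStep, hx, h₁, h₂]
    refine ⟨fun h => ?_, fun h => Or.inr ⟨i, le_rfl, rfl, h, fun j h₁ h₂ => by omega⟩⟩
    rcases hI with hI | ⟨jb, h₃, h₄, h₅, h₆⟩
    · refine Or.inl fun j hj => ?_
      rcases Nat.lt_or_eq_of_le hj with hj | rfl
      · exact hI j hj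
      · exact h
    · refine Or.inr ⟨jb, by omega, h₄, h₅, fun j hj hjb => ?_⟩
      rcases Nat.lt_or_eq_of_le hj with hj | rfl
      · exact h₆ j hj hjb
      · exact h
  obtain ⟨jb, hjb, hbest, hadjb, hlast⟩ := h₃.resolve_left fun h => hadj₀ (h j₀ hj₀)
  have hbn : σ₂.arr aQueue jb < n := hs.lt jb hjb
  set b : Fin n := ⟨σ₂.arr aQueue jb, hbn⟩ with hb
  have hbest' : σ₃.var vBest = b := hbest
  refine Runs.bind (R := fun τ =>
      τ.arr aTime = Function.update (σ.arr aTime) b (k + 1) ∧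
      τ.arr aFst = Function.update (σ.arr aFst) b (σ.arr aAdj b) ∧
      τ.arr aSnd = Function.update (σ.arr aSnd) b (σ₂.arr aPar b))
    (Runs.simple 20 (by decide) ?_) fun σ₄ hσ₄ ⟨ht₄, hf₄, hs₄⟩ => ?_
  · have h₁ : σ₃.arr aTime = σ.arr aTime := by rw [hσ₃.arr _ rfl, htime₂]
    have h₂ : σ₃.arr aFst = σ.arr aFst := by rw [hσ₃.arr _ rfl, hfst₂]
    have h₃ : σ₃.arr aSnd = σ.arr aSnd := by rw [hσ₃.arr _ rfl, hsnd₂]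
    have h₄ : σ₃.arr aAdj = σ.arr aAdj := by rw [hσ₃.arr _ rfl, hadj₂]
    have h₅ : σ₃.arr aPar = σ₂.arr aPar := hσ₃.arr _ rfl
    have h₆ : σ₃.var vK = k := by rw [hσ₃.var _ rfl, hK₂]
    simp at h₁ h₂ h₃ h₄ h₅ h₆ hbest'
    simp [recordBest, h₁, h₂, h₃, h₄, h₅, h₆, hbest']
  have hkill₄ : σ₄.arr aKill = σ.arr aKill := by rw [hσ₄.arr _ rfl, hσ₃.arr _ rfl, hkill₂]
  have hadj₄ : σ₄.arr aAdj = σ.arr aAdj := by rw [hσ₄.arr _ rfl, hσ₃.arr _ rfl, hadj₂]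
  have hS₄ : σ₄.arr aS = σ.arr aS := by rw [hσ₄.arr _ rfl, hσ₃.arr _ rfl, hS₂]
  have hD₄ : σ₄.arr aD = σ.arr aD := by rw [hσ₄.arr _ rfl, hσ₃.arr _ rfl, hD₂]
  have hbest₄ : σ₄.var vBest = b := by rw [hσ₄.var _ rfl, hbest']
  refine (runs_simpleLoop 30 (I := fun k τ => ∀ v : Fin n,
      (τ.arr aAdj v = σ.arr aAdj v ∧ ∀ i : Fin m, (i : ℕ) < k → σ.arr aKill i = 0 →
        (e₁ i).1 = b → (e₁ i).2 ≠ v) ∨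
      ∃ i : Fin m, σ.arr aKill i = 0 ∧ (e₁ i).1 = b ∧ (e₁ i).2 = v ∧ τ.arr aAdj v = i + 1)
      (by simp) rfl rfl (by decide) (by rw [hσ₄.var _ rfl, hσ₃.var _ rfl, hM₂]) ?_ ?_).consequence
      le_rfl fun τ hτ h₅ => ?_
  · intro v
    refine Or.inl ⟨?_, fun i hi => by omega⟩
    rw [State.setVar_arr, hadj₄]
  · intro i hi ρ hρ hx hI
    have h₁ : ρ.arr aKill = σ.arr aKill := by rw [hρ.arr _ rfl, hkill₄]
    have h₂ : ρ.arr aS i = (e₁ ⟨i, hi⟩).1 := by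
      rw [hρ.arr _ rfl, hS₄]; exact (hL ⟨i, hi⟩).1
    have h₃ : ρ.arr aD i = (e₁ ⟨i, hi⟩).2 := by
      rw [hρ.arr _ rfl, hD₄]; exact (hL ⟨i, hi⟩).2
    have h₄ : ρ.var vBest = b := by rw [hρ.var _ rfl, hbest₄]
    have old : ¬ (σ.arr aKill i = 0 ∧ (e₁ ⟨i, hi⟩).1 = b) → ∀ v : Fin n,
        (ρ.arr aAdj v = σ.arr aAdj v ∧ ∀ i' : Fin m, (i' : ℕ) < i + 1 → σ.arr aKill i' = 0 →
          (e₁ i').1 = b → (e₁ i').2 ≠ v) ∨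
        ∃ i : Fin m, σ.arr aKill i = 0 ∧ (e₁ i).1 = b ∧ (e₁ i).2 = v ∧
          ρ.arr aAdj v = i + 1 := by
      intro hno v
      rcases hI v with ⟨h₅, h₆⟩ | h
      · refine Or.inl ⟨h₅, fun i' hi' hk hb => ?_⟩
        rcases Nat.lt_succ_iff_lt_or_eq.1 hi' with hlt | heq
        · exact h₆ i' hlt hk hb
        · obtain rfl : i' = ⟨i, hi⟩ := Fin.ext heq
          exact absurd ⟨hk, hb⟩ hno
      · exact Or.inr h
    simp only [adjStep, Cmd.wp, Test.holds, Expr.eval, hx, h₁, h₂, h₃, h₄, State.setVar_arr,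
      State.setArr_arr]
    refine ⟨fun hk => ⟨fun hsb => ?_, fun hsb => ?_⟩, fun hk => ?_⟩
    · have hsb' : (e₁ ⟨i, hi⟩).1 = b := Fin.ext hsb
      intro v
      by_cases hv : (e₁ ⟨i, hi⟩).2 = v
      · refine Or.inr ⟨⟨i, hi⟩, hk, hsb', hv, ?_⟩
        simp [← hv]
      · have hv' : (v : ℕ) ≠ (e₁ ⟨i, hi⟩).2 := fun h => hv (Fin.ext h.symm)
        rw [if_true, Function.update_of_ne hv']
        rcases hI v with ⟨h₅, h₆⟩ | h
        · refine Or.inl ⟨h₅, fun i' hi' hk hb => ?_⟩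
          rcases Nat.lt_succ_iff_lt_or_eq.1 hi' with hlt | heq
          · exact h₆ i' hlt hk hb
          · obtain rfl : i' = ⟨i, hi⟩ := Fin.ext heq
            exact hv
        · exact Or.inr h
    · exact old fun h => hsb (congrArg Fin.val h.2)
    · exact old fun h => hk h.1
  · have := H.step hstar hnr hL hal hs hjb (b := b) rfl hadjb hlast (adj' := τ.arr aAdj)
      fun v => (h₅ v).imp_left fun h => ⟨h.1, fun i => h.2 i i.2⟩
    rw [hτ.arr aKill rfl, hkill₄, hτ.arr aTime rfl, ht₄, hτ.arr aFst rfl, hf₄, hτ.arr aSnd rfl,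
      hs₄]
    exact this

theorem setupOrder_spec {e : Fin m → Fin n × Fin n} {σ : State} (hN : σ.var vN = n)
    (hM : σ.var vM = m) (hroot : σ.var vRoot = r)
    (hD : ∀ i : Fin m, σ.arr aD i = (e i).2)
    (he₁ : ∀ i, (e₁ i).2 = (e i).2 ∧ ((σ.arr aCand i = 0 ∧ (e₁ i).1 = r) ∨
      σ.arr aCand i = (e₁ i).1 + 1 ∧ (σ.arr aKill i = 0 → (e₁ i).1 ≠ r)))
    (hreach : ∀ x, Reach {g | ∃ i : Fin m, σ.arr aKill i = 0 ∧ e₁ i = g} r x) :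
    Runs setupOrder σ (100 * (n + m + 1)) fun τ =>
      Lists e₁ (τ.arr aS) (τ.arr aD) ∧
      ShellInv e₁ (fun i => τ.arr aKill i = 0) r 0 (τ.arr aTime) (τ.arr aAdj) (τ.arr aFst)
        (τ.arr aSnd) := by
  suffices h : Runs setupOrder σ ((20 + 8) * (n + 1) + (40 + 8) * (m + 1)) fun τ =>
      Lists e₁ (τ.arr aS) (τ.arr aD) ∧
      ShellInv e₁ (fun i => τ.arr aKill i = 0) r 0 (τ.arr aTime) (τ.arr aAdj) (τ.arr aFst)
        (τ.arr aSnd) from h.mono (by omega) fun _ => id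
  refine Runs.bind (runs_simpleLoop 20 (I := fun k τ => ∀ x < k, τ.arr aTime x = 0 ∧
      τ.arr aAdj x = 0) (by simp) rfl rfl (by decide) hN (by simp) ?_) fun σ₁ hσ₁ h₁ =>
    (runs_simpleLoop 40 (I := fun k τ => (∀ i : Fin m, (i : ℕ) < k → τ.arr aS i = (e₁ i).1) ∧
      (∀ v : Fin n, τ.arr aAdj v ≠ 0 → ∃ i : Fin m, σ.arr aKill i = 0 ∧ τ.arr aAdj v = i + 1 ∧
        (e₁ i).2 = v ∧ (e₁ i).1 = r) ∧
      ∀ i : Fin m, (i : ℕ) < k → σ.arr aKill i = 0 → (e₁ i).1 = r → τ.arr aAdj (e₁ i).2 ≠ 0)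
      (by simp) rfl rfl (by decide) (by rw [hσ₁.var _ rfl, hM]) ?_ ?_).consequence le_rfl
      fun τ hτ ⟨h₂, h₃, h₄⟩ => ?_
  · intro i hi ρ hρ hx hI
    simp at hI hx
    simp [hx]
    intro j hj
    by_cases hji : j = i
    · simp [hji]
    · simpa [hji] using hI j (by omega)
  · refine ⟨by simp, fun v hv => ?_, by simp⟩
    exact absurd (h₁ v v.2).2 hv
  · rintro i hi ρ hρ hx ⟨hI₁, hI₂, hI₃⟩
    have hk : ρ.arr aKill = σ.arr aKill := by rw [hρ.arr _ rfl, hσ₁.arr _ rfl]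
    have hc : ρ.arr aCand = σ.arr aCand := by rw [hρ.arr _ rfl, hσ₁.arr _ rfl]
    have hd : ρ.arr aD i = (e₁ ⟨i, hi⟩).2 := by
      rw [hρ.arr _ rfl, hσ₁.arr _ rfl, (he₁ ⟨i, hi⟩).1]
      exact hD ⟨i, hi⟩
    have hr : ρ.var vRoot = r := by rw [hρ.var _ rfl, hσ₁.var _ rfl, hroot]
    have hS : ∀ c, c = ((e₁ ⟨i, hi⟩).1 : ℕ) → ∀ j : Fin m, (j : ℕ) < i + 1 →
        Function.update (ρ.arr aS) i c j = (e₁ j).1 := by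
      rintro c rfl j hj
      by_cases hji : j = ⟨i, hi⟩
      · subst hji; simp
      · have hji' : (j : ℕ) ≠ i := fun h => hji (Fin.ext h)
        rw [Function.update_of_ne hji']
        exact hI₁ j (by omega)
    have aux : ∀ j : Fin m, (j : ℕ) < i + 1 → (j : ℕ) < i ∨ j = ⟨i, hi⟩ := fun j hj => by
      rcases Nat.lt_succ_iff_lt_or_eq.1 hj with h | h
      · exact Or.inl h
      · exact Or.inr (Fin.ext h)
    obtain ⟨-, he⟩ := he₁ ⟨i, hi⟩
    simp only [setupStep, Cmd.wp, Test.holds, Expr.eval, hx, hk, hc, hr, State.setVar_arr,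
      State.setArr_arr, State.setArr_var]
    simp only [aS, aD, aAdj, aKill, aCand, Arr.tmp.injEq, if_true, OfNat.ofNat_ne_zero,
      OfNat.zero_ne_ofNat, one_ne_zero, if_false] at *
    refine ⟨fun hc0 => ⟨fun hk0 => ?_, fun hk0 => ?_⟩, fun hc0 => ?_⟩
    · have hsr : (e₁ ⟨i, hi⟩).1 = r := by
        rcases he with h | h
        · exact h.2
        · omega
      rw [hd]
      refine ⟨hS _ (by rw [hsr]), fun v hv => ?_, fun j hj hkj hjr => ?_⟩
      · by_cases hvd : v = (e₁ ⟨i, hi⟩).2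
        · exact ⟨⟨i, hi⟩, hk0, by simp [hvd], hvd.symm, hsr⟩
        · have hvd' : (v : ℕ) ≠ (e₁ ⟨i, hi⟩).2 := fun h => hvd (Fin.ext h)
          rw [Function.update_of_ne hvd'] at hv ⊢
          exact hI₂ v hv
      · by_cases hvd : ((e₁ j).2 : ℕ) = (e₁ ⟨i, hi⟩).2
        · rw [hvd]; simp
        · rw [Function.update_of_ne hvd]
          rcases aux j hj with h | rfl
          · exact hI₃ j h hkj hjr
          · exact absurd rfl hvd
    · have hsr : (e₁ ⟨i, hi⟩).1 = r := by
        rcases he with h | h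
        · exact h.2
        · omega
      refine ⟨hS _ (by rw [hsr]), hI₂, fun j hj hkj hjr => ?_⟩
      rcases aux j hj with h | rfl
      · exact hI₃ j h hkj hjr
      · exact absurd hkj hk0
    · rcases he with h | ⟨h, h'⟩
      · exact absurd h.1 hc0
      · refine ⟨hS _ (by omega), hI₂, fun j hj hkj hjr => ?_⟩
        rcases aux j hj with h'' | rfl
        · exact hI₃ j h'' hkj hjr
        · exact absurd hjr (h' hkj)
  · have hk : τ.arr aKill = σ.arr aKill := by rw [hτ.arr _ rfl, hσ₁.arr _ rfl]
    have ht : ∀ v : Fin n, τ.arr aTime v = 0 := fun v => by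
      rw [hτ.arr _ rfl]; exact (h₁ v v.2).1
    refine ⟨fun i => ⟨h₂ i i.2, ?_⟩, ⟨fun v => (ht v).le, ht r, ?_, fun x _ => ?_,
      fun v _ hv => ?_, fun i hi hsrc => ?_, fun v hv => absurd (ht v) hv,
      fun v hv => absurd (ht v) hv⟩⟩
    · rw [hτ.arr _ rfl, hσ₁.arr _ rfl, hD i, (he₁ i).1]
    · rw [Finset.card_eq_zero, Finset.filter_eq_empty_iff]
      exact fun v _ h => h (ht v)
    · refine (hreach x).mono ?_
      rintro g ⟨i, hi, hg⟩
      exact ⟨i, by rwa [hk], hg, ht _⟩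
    · obtain ⟨i, h₅, h₆, h₇, h₈⟩ := h₃ v hv
      exact ⟨i, by rwa [hk], h₆, h₇, Or.inl h₈⟩
    · rw [hk] at hi
      exact h₄ i i.2 hi (hsrc.resolve_right fun h => h (ht _))

end

/-! ## Independent trees -/

def loadFlow (s d : Arr) : Cmd :=
  Cmd.seq (Cmd.store aS (Expr.var vX) (Expr.get s (Expr.var vX)))
  (Cmd.seq (Cmd.store aD (Expr.var vX) (Expr.get d (Expr.var vX)))
  (Cmd.seq (Cmd.store aCand (Expr.var vX) (Expr.lit 0))
    (Cmd.store aKill (Expr.var vX) (Expr.lit 0))))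

/-- Two independent trees rooted at `Var.w`, where the edges are listed in the arrays `s` and `d`. -/
def independentTrees (s d t₁ t₂ : Arr) : Cmd :=
  Cmd.seq (Cmd.seq (Cmd.assign vN (Expr.var Var.n)) (Cmd.seq (Cmd.assign vM (Expr.var Var.m))
    (Cmd.seq (Cmd.assign vRoot (Expr.var Var.w)) (Cmd.assign vLast (Expr.pred (Expr.var Var.n))))))
  (Cmd.seq (forLoop vX vM (loadFlow s d))
  (Cmd.seq derive
  (Cmd.seq setupOrder
  (Cmd.seq (forLoop vK vLast shellStep)
  (Cmd.seq (markTree aFst t₁) (markTree aSnd t₂))))))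

section

variable {n m : ℕ} {e : Fin m → Fin n × Fin n} {r : Fin n}

/-- The edge of the derived graph that corresponds to the edge `a`, as encoded by `c`. -/
def DerivedEdge (E : Set (Fin n × Fin n)) (r : Fin n) (a : Fin n × Fin n) (c : ℕ)
    (g : Fin n × Fin n) : Prop :=
  g.2 = a.2 ∧ ((c = 0 ∧ g.1 = r ∧ ∀ z, Dom E r z a.1 → Dom E r z a.2) ∨
    (c = g.1 + 1 ∧ g.1 ≠ r ∧ IsTop E r a.1 a.2 g.1))

theorem DeriveInv.exists_derivedEdge {E : Set (Fin n × Fin n)} {a : Fin n × Fin n} {c b : ℕ}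
    (h : DeriveInv E r a.1 a.2 n c b) : ∃ g, DerivedEdge E r a c g := by
  rcases h.cand with ⟨hc, h₁⟩ | ⟨c', hc, h₁, h₂, h₃⟩
  · exact ⟨(r, a.2), rfl, Or.inl ⟨hc, rfl, fun z => h₁ z z.2⟩⟩
  · exact ⟨(c', a.2), rfl, Or.inr ⟨hc, fun hcr => h₂ (hcr ▸ dom_root _), h₁, h₂,
      fun z => h₃ z z.2⟩⟩

/-- The original source is dominated by the derived source, a sibling of the end, so the sibling
comparison passes to it. In the remaining case the original source itself properly dominates the
end. -/
theorem DerivedEdge.precedes {E : Set (Fin n × Fin n)} (hr : ∀ x, Reach E r x)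
    {a g : Fin n × Fin n} {c : ℕ} (h : DerivedEdge E r a c g) (ha : a ∈ E)
    (hd : ¬ Dom E r a.2 a.1) {R : Fin n → Fin n → Prop} (hR : g.1 ≠ r → R g.1 a.2) :
    Precedes E r R a.1 a.2 := by
  rcases h.2 with ⟨-, -, h₁⟩ | ⟨-, h₁, h₂⟩
  · exact Or.inl ⟨fun h => hd (h ▸ Dom.refl _), h₁ _ (Dom.refl _)⟩
  · exact Or.inr ⟨g.1, a.2, h₂.sib hr ha hd, hR h₁, h₂.1, Dom.refl _⟩

theorem isDerived_of_derivedEdge {e₁ : Fin m → Fin n × Fin n} {cand kill : ℕ → ℕ}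
    (he₁ : ∀ i : Fin m, DerivedEdge (Set.range e) r (e i) (cand i) (e₁ i))
    (hk : ∀ i : Fin m, kill i = 0 ↔ ¬ Dom (Set.range e) r (e i).2 (e i).1) :
    IsDerived (Set.range e) r {g | ∃ i : Fin m, kill i = 0 ∧ e₁ i = g} := by
  refine ⟨?_⟩
  rintro p v ⟨i, hi⟩ hd
  have h₁ : (e i).1 = p := by rw [hi]
  have h₂ : (e i).2 = v := by rw [hi]
  subst h₁ h₂
  have hmem : ∀ c, (e₁ i).1 = c →
      (c, (e i).2) ∈ {g | ∃ i : Fin m, kill i = 0 ∧ e₁ i = g} := fun c hc =>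
    ⟨i, (hk i).2 hd, Prod.ext hc (he₁ i).1⟩
  rcases (he₁ i).2 with ⟨-, h₁, h₂⟩ | ⟨-, -, h₁⟩
  · exact Or.inl ⟨h₂, hmem r h₁⟩
  · exact Or.inr ⟨_, h₁, hmem _ rfl⟩

/-- Removal times order the siblings: first parents come from the root or an earlier sibling, second
parents from the root or a later one. -/
theorem areIndependentTrees_of_shellInv {e₁ : Fin m → Fin n × Fin n} {K : Fin m → Prop}
    {cand time adj fst snd : ℕ → ℕ} {k : ℕ} (hr : ∀ x, Reach (Set.range e) r x)
    (he₁ : ∀ i : Fin m, DerivedEdge (Set.range e) r (e i) (cand i) (e₁ i))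
    (hK : ∀ i : Fin m, K i → ¬ Dom (Set.range e) r (e i).2 (e i).1)
    (H : ShellInv e₁ K r k time adj fst snd) (hk : k + 1 = n) (hm : 0 < m) {τ : State}
    {t₁ t₂ : Arr} (h₁ : ∀ i < m, τ.arr t₁ i ≠ 0 ↔ ∃ x < n, x ≠ (r : ℕ) ∧ fst x = i + 1)
    (h₂ : ∀ i < m, τ.arr t₂ i ≠ 0 ↔ ∃ x < n, x ≠ (r : ℕ) ∧ snd x = i + 1) :
    AreIndependentTrees (Set.range e) r (marked τ t₁ e) (marked τ t₂ e) := by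
  have hF : ∀ v : Fin n, ∃ i : Fin m, v ≠ r → K i ∧ fst v = i + 1 ∧ (e₁ i).2 = v ∧
      ((e₁ i).1 = r ∨ (time (e₁ i).1 ≠ 0 ∧ time (e₁ i).1 < time v)) := fun v => by
    by_cases hv : v = r
    · exact ⟨⟨0, hm⟩, fun h => absurd hv h⟩
    · obtain ⟨i, hi⟩ := H.fst_edge v (H.time_ne_zero hk hv)
      exact ⟨i, fun _ => hi⟩
  have hS : ∀ v : Fin n, ∃ i : Fin m, v ≠ r → K i ∧ snd v = i + 1 ∧ (e₁ i).2 = v ∧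
      ((e₁ i).1 = r ∨ time v < time (e₁ i).1) := fun v => by
    by_cases hv : v = r
    · exact ⟨⟨0, hm⟩, fun h => absurd hv h⟩
    · obtain ⟨i, hi₁, hi₂, hi₃, hi₄⟩ := H.snd_edge v (H.time_ne_zero hk hv)
      refine ⟨i, fun _ => ⟨hi₁, hi₂, hi₃, ?_⟩⟩
      rcases hi₄ with h | h | h
      · exact Or.inl h
      -- After all n - 1 rounds, a source that was never removed can only be the root.
      · exact Or.inl (by_contra fun h' => H.time_ne_zero hk h' h)
      · exact Or.inr h
  choose f hf using hF
  choose s hs using hS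
  have hf₂ : ∀ v, v ≠ r → (e (f v)).2 = v := fun v hv =>
    (he₁ (f v)).1.symm.trans (hf v hv).2.2.1
  have hs₂ : ∀ v, v ≠ r → (e (s v)).2 = v := fun v hv =>
    (he₁ (s v)).1.symm.trans (hs v hv).2.2.1
  refine areIndependentTrees hr (fun v => (e (f v)).1) (fun v => (e (s v)).1) (fun a => ?_)
    (fun a => ?_) (fun v hv => ⟨f v, Prod.ext rfl (hf₂ v hv)⟩)
    (fun v hv => ⟨s v, Prod.ext rfl (hs₂ v hv)⟩) (fun v => time v) (fun v hv => ?_)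
    fun v hv => ?_
  · simpa using mem_marked_iff h₁ (S := Set.univ) f (fun v hv _ => ⟨(hf v hv).2.1, hf₂ v hv⟩)
      (by simp) a
  · simpa using mem_marked_iff h₂ (S := Set.univ) s (fun v hv _ => ⟨(hs v hv).2.1, hs₂ v hv⟩)
      (by simp) a
  · have := (he₁ (f v)).precedes hr ⟨_, rfl⟩ (hK _ (hf v hv).1) (R := fun a b => time a < time b)
      fun h => by
        rw [hf₂ v hv]
        exact ((hf v hv).2.2.2.resolve_left h).2
    rwa [hf₂ v hv] at this
  · have := (he₁ (s v)).precedes hr ⟨_, rfl⟩ (hK _ (hs v hv).1) (R := fun a b => time b < time a)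
      fun h => by
        rw [hs₂ v hv]
        exact (hs v hv).2.2.2.resolve_left h
    rwa [hs₂ v hv] at this

/-- Both the computation of dominators and the ordering make one linear-time round for each of about
n vertices. The arrays t₁ and t₂ must differ, or the second tree would overwrite the first. -/
theorem independentTrees_spec {σ : State} {s d t₁ t₂ : Arr} (hs : ∀ k, s ≠ Arr.tmp k)
    (hd : ∀ k, d ≠ Arr.tmp k) (ht₁ : ∀ k, t₁ ≠ Arr.tmp k) (ht₂ : ∀ k, t₂ ≠ Arr.tmp k)
    (ht : t₁ ≠ t₂) (hn3 : 3 ≤ n) (hn : σ.var Var.n = n) (hm : σ.var Var.m = m)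
    (hL : Lists e (σ.arr s) (σ.arr d)) (hw : σ.var Var.w = r)
    (hr : ∀ v, Reach (Set.range e) r v) :
    Runs (independentTrees s d t₁ t₂) σ (4000 * (n + m + 1) * (n + 1)) fun τ =>
      AreIndependentTrees (Set.range e) r (marked τ t₁ e) (marked τ t₂ e) := by
  suffices h : Runs (independentTrees s d t₁ t₂) σ (30 + ((40 + 8) * (m + 1) +
      ((500 * (n + m + 1) + 8) * (n + 1) + (100 * (n + m + 1) +
      ((500 * (n + m + 1) + 8) * (n - 1 + 1) + (100 * (n + m + 1) + 100 * (n + m + 1))))))) fun τ =>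
      AreIndependentTrees (Set.range e) r (marked τ t₁ e) (marked τ t₂ e) from
    h.mono (by
      rw [Nat.sub_add_cancel (by omega)]
      nlinarith [Nat.zero_le (n * m), Nat.zero_le (n * n)]) fun _ => id
  have hm0 : 0 < m := by
    obtain ⟨x, hxr, -⟩ := exists_ne_and_ne (by simpa using hn3) r r
    rcases Relation.ReflTransGen.cases_tail (hr x) with h | ⟨_, -, ⟨i, _⟩⟩
    · exact absurd h hxr
    · exact i.pos
  refine Runs.bind (R := fun τ => τ.var vN = n ∧ τ.var vM = m ∧ τ.var vRoot = r ∧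
      τ.var vLast = n - 1)
    (Runs.simple 30 (by decide) (by simp [hn, hm, hw])) fun σ₁ hσ₁ ⟨hN₁, hM₁, hr₁, hl₁⟩ =>
    Runs.bind (runs_simpleLoop 40 (I := fun k τ => ∀ i < k, τ.arr aS i = σ.arr s i ∧
      τ.arr aD i = σ.arr d i ∧ τ.arr aCand i = 0 ∧ τ.arr aKill i = 0) (by simp)
      rfl rfl (Nat.le_of_lt_succ (by simp [loadFlow, Cmd.bound, Expr.cost])) hM₁
      (by simp) ?_) fun σ₂ hσ₂ h₂ =>
    Runs.bind (derive_spec hr (by rw [hσ₂.var _ rfl, hN₁]) (by rw [hσ₂.var _ rfl, hM₁])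
      (by rw [hσ₂.var _ rfl, hr₁]) (fun i => ?_) (fun i hi => (h₂ i hi).2.2.1)
      (fun i hi => (h₂ i hi).2.2.2)) fun σ₃ hσ₃ h₃ => ?_
  · intro i hi ρ hρ hx hI
    have h₁ : ρ.arr s = σ.arr s := by
      rw [hρ.arr _ (by simp [forLoop, loadFlow, Cmd.writesArr, hs]),
        hσ₁.arr _ (by simp [Cmd.writesArr])]
    have h₂ : ρ.arr d = σ.arr d := by
      rw [hρ.arr _ (by simp [forLoop, loadFlow, Cmd.writesArr, hd]),
        hσ₁.arr _ (by simp [Cmd.writesArr])]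
    simp at hI hx
    simp [loadFlow, hx, h₁, h₂, hd]
    intro j hj
    by_cases hji : j = i
    · simp [hji]
    · simpa [hji] using hI j (by omega)
  · rw [(h₂ i i.2).1, (h₂ i i.2).2.1]
    exact hL i
  have hkill : ∀ i : Fin m, σ₃.arr aKill i = 0 ↔ ¬ Dom (Set.range e) r (e i).2 (e i).1 :=
    fun i => by
      rw [← not_iff_not, not_not, ← ne_eq, (h₃ i).kill]
      exact and_iff_right (e i).2.2
  choose e₁ he₁ using fun i => (h₃ i).exists_derivedEdge
  have hG := isDerived_of_derivedEdge he₁ hkill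
  have hreach : ∀ x, Reach {g | ∃ i : Fin m, σ₃.arr aKill i = 0 ∧ e₁ i = g} r x := fun x => by
    -- Reachability in the whole derived graph follows from reachability avoiding any third vertex.
    obtain ⟨a, hax, har⟩ := exists_ne_and_ne (by simpa using hn3) x r
    exact (hG.reach hr har hax.symm).mono fun g hg => hg.1
  refine Runs.bind (setupOrder_spec (e := e) (e₁ := e₁) (n := n) (m := m) (r := r)
    (by rw [hσ₃.var _ rfl, hσ₂.var _ rfl, hN₁]) (by rw [hσ₃.var _ rfl, hσ₂.var _ rfl, hM₁])
    (by rw [hσ₃.var _ rfl, hσ₂.var _ rfl, hr₁]) (fun i => ?_) (fun i => ⟨(he₁ i).1, ?_⟩) hreach)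
    fun σ₄ hσ₄ ⟨hL₄, h₄⟩ => ?_
  · rw [hσ₃.arr _ rfl, (h₂ i i.2).2.1]
    exact (hL i).2
  · exact (he₁ i).2.imp (fun h => ⟨h.1, h.2.1⟩) fun h => ⟨h.1, fun _ => h.2.1⟩
  have hkill₄ : σ₄.arr aKill = σ₃.arr aKill := hσ₄.arr _ rfl
  have hN₄ : σ₄.var vN = n := by rw [hσ₄.var _ rfl, hσ₃.var _ rfl, hσ₂.var _ rfl, hN₁]
  have hM₄ : σ₄.var vM = m := by rw [hσ₄.var _ rfl, hσ₃.var _ rfl, hσ₂.var _ rfl, hM₁]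
  have hr₄ : σ₄.var vRoot = r := by rw [hσ₄.var _ rfl, hσ₃.var _ rfl, hσ₂.var _ rfl, hr₁]
  have hl₄ : σ₄.var vLast = n - 1 := by rw [hσ₄.var _ rfl, hσ₃.var _ rfl, hσ₂.var _ rfl, hl₁]
  refine Runs.bind (runs_forLoop (B := n - 1) (I := fun k τ =>
    ShellInv e₁ (fun i => τ.arr aKill i = 0) r k (τ.arr aTime) (τ.arr aAdj) (τ.arr aFst)
        (τ.arr aSnd)) (by simp) rfl rfl hl₄ h₄ ?_) fun σ₅ hσ₅ h₅ => ?_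
  · intro k hk ρ hρ hρk hI
    have hk' : ρ.arr aKill = σ₃.arr aKill := by rw [hρ.arr _ rfl, hkill₄]
    refine shellStep_spec (by rw [hρ.var _ rfl, hN₄]) (by rw [hρ.var _ rfl, hM₄])
      (by rw [hρ.var _ rfl, hr₄]) hρk ?_ (by omega) ?_ ?_ hI
    · rw [hρ.arr _ rfl, hρ.arr _ rfl]
      exact hL₄
    · rw [hk']
      exact fun a x har hxa => hG.reach hr har hxa
    · rw [hk']
      intro i hi hir
      refine (hkill i).1 hi ?_
      rw [← (he₁ i).1, hir]
      exact dom_root _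
  · have hN₅ : σ₅.var vN = n := by rw [hσ₅.var _ rfl, hN₄]
    have hM₅ : σ₅.var vM = m := by rw [hσ₅.var _ rfl, hM₄]
    have hr₅ : σ₅.var vRoot = r := by rw [hσ₅.var _ rfl, hr₄]
    refine Runs.bind (markTree_spec (ht₁ _).symm hN₅ hM₅ hr₅) fun σ₆ hσ₆ h₆ =>
      (markTree_spec (ht₂ _).symm (by rw [hσ₆.var _ rfl, hN₅]) (by rw [hσ₆.var _ rfl, hM₅])
        (by rw [hσ₆.var _ rfl, hr₅])).consequence le_rfl fun τ hτ h₇ => ?_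
    have e₁' : τ.arr t₁ = σ₆.arr t₁ :=
      hτ.arr _ (by simp [markTree, markStep, forLoop, Cmd.writesArr, ht])
    have e₂' : σ₆.arr aSnd = σ₅.arr aSnd :=
      hσ₆.arr _ (by simp [markTree, markStep, forLoop, Cmd.writesArr, (ht₁ _).symm])
    rw [← e₁'] at h₆
    rw [e₂'] at h₇
    refine areIndependentTrees_of_shellInv hr he₁ (fun i hi => (hkill i).1 ?_) h₅ (by omega) hm0
      h₆ h₇
    rw [← hkill₄, ← hσ₅.arr aKill rfl]
    exact hi

end

/-! ## The subroutines -/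

/-- A vertex other than `Var.y`. -/
def otherVertex : Cmd :=
  Cmd.ite (Test.eq (Expr.var Var.y) (Expr.lit 0)) (Cmd.assign Var.q (Expr.lit 1))
    (Cmd.assign Var.q (Expr.lit 0))

/-- A vertex that is not listed in `Arr.ter`. -/
def nonterminal : Cmd :=
  Cmd.seq (forLoop vX Var.n (Cmd.store aAlive (Expr.var vX) (Expr.lit 0)))
  (Cmd.seq (forLoop vX Var.t (Cmd.store aAlive (Expr.get Arr.ter (Expr.var vX)) (Expr.lit 1)))
    (forLoop vX Var.n (Cmd.ite (Test.eq (Expr.get aAlive (Expr.var vX)) (Expr.lit 0))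
      (Cmd.assign Var.w (Expr.var vX)) Cmd.skip)))

def subroutines : Subroutines where
  min2EC := min2EC
  min2VC := min2VC
  chooseQ := otherVertex
  tree := treeAvoiding Arr.src Arr.dst Arr.tree₁
  treeRev := treeAvoiding Arr.dst Arr.src Arr.tree₂
  chooseW := nonterminal
  indep := independentTrees Arr.src Arr.dst Arr.tree₁ Arr.tree₂
  indepRev := independentTrees Arr.dst Arr.src Arr.rtree₁ Arr.rtree₂

theorem Runs.achieves {c : Cmd} {σ : State} {K : ℕ} {Q : State → Prop} (h : Runs c σ K Q)
    {X : Set Var} {A : Set Arr} (hX : ∀ x, x ∉ X → (∀ k, x ≠ Var.tmp k) → c.writesVar x = false)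
    (hA : ∀ a, a ∉ A → (∀ k, a ≠ Arr.tmp k) → c.writesArr a = false) : Achieves c X A σ Q := by
  obtain ⟨k, τ, h₁, -, h₂⟩ := h
  exact ⟨k, τ, h₁, onlyChanges_of_frame h₁.frame hX hA, h₂⟩

section

variable {n m t : ℕ} {e : Fin m → Fin n × Fin n} {T : Fin t → Fin n} {σ : State}

theorem HoldsGraph.lists (h : HoldsGraph σ e) : Lists e (σ.arr Arr.src) (σ.arr Arr.dst) := h.2.2

theorem HoldsGraph.lists_rev (h : HoldsGraph σ e) :
    Lists (rev e) (σ.arr Arr.dst) (σ.arr Arr.src) := fun i => (h.2.2 i).symm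

theorem HoldsGraph.of_frame {c : Cmd} {τ : State} (h : HoldsGraph σ e) (hf : Frame c σ τ)
    (hn : c.writesVar Var.n = false) (hm : c.writesVar Var.m = false)
    (hs : c.writesArr Arr.src = false) (hd : c.writesArr Arr.dst = false) : HoldsGraph τ e := by
  unfold HoldsGraph
  rw [hf.var _ hn, hf.var _ hm, hf.arr _ hs, hf.arr _ hd]
  exact h

theorem otherVertex_spec {y : Fin n} (hn3 : 3 ≤ n) (hy : σ.var Var.y = y) :
    Runs otherVertex σ 10 fun τ => ∃ q : Fin n, q ≠ y ∧ τ.var Var.q = q := by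
  refine Runs.simple 10 (by decide) ?_
  simp only [otherVertex, Cmd.wp, Test.holds, Expr.eval, hy, State.setVar_var, if_true]
  refine ⟨fun h => ⟨⟨1, by omega⟩, fun hq => ?_, rfl⟩, fun h => ⟨⟨0, by omega⟩, fun hq => ?_, rfl⟩⟩
  · rw [← hq] at h
    exact one_ne_zero h
  · exact h (congrArg Fin.val hq.symm)

theorem nonterminal_spec (hG : HoldsGraph σ e) (hT : HoldsTerminals σ T) (htn : t ≤ n)
    (hne : Set.range T ≠ Set.univ) :
    Runs nonterminal σ (100 * (n + 1)) fun τ =>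
      ∃ w : Fin n, w ∉ Set.range T ∧ τ.var Var.w = w := by
  suffices h : Runs nonterminal σ ((10 + 8) * (n + 1) + ((10 + 8) * (t + 1) +
      (20 + 8) * (n + 1))) fun τ => ∃ w : Fin n, w ∉ Set.range T ∧ τ.var Var.w = w from
    h.mono (by omega) fun _ => id
  refine Runs.bind (runs_simpleLoop 10 (I := fun k τ => ∀ v < k, τ.arr aAlive v = 0) (by simp) rfl
      rfl (by decide) hG.1 (by simp) ?_) fun σ₁ hσ₁ h₁ =>
    Runs.bind (runs_simpleLoop 10 (I := fun k τ => ∀ v : Fin n, τ.arr aAlive v = 0 ↔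
      ∀ i : Fin t, (i : ℕ) < k → T i ≠ v) (by simp) rfl rfl (by decide)
      (by rw [hσ₁.var _ rfl, hT.1]) ?_ ?_) fun σ₂ hσ₂ h₂ =>
    (runs_simpleLoop 20 (I := fun k τ => (∀ v : Fin n, (v : ℕ) < k → v ∈ Set.range T) ∨
      ∃ w : Fin n, w ∉ Set.range T ∧ τ.var Var.w = w) (by simp) rfl rfl (by decide)
      (by rw [hσ₂.var _ rfl, hσ₁.var _ rfl, hG.1]) (by simp) ?_).mono le_rfl fun τ h₃ => ?_
  · intro i hi ρ hρ hx hI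
    simp at hI hx
    simp [hx]
    intro j hj
    by_cases hji : j = i
    · simp [hji]
    · simpa [hji] using hI j (by omega)
  · simpa using fun v : Fin n => h₁ v v.2
  · intro i hi ρ hρ hx hI v
    have h₃ : ρ.arr Arr.ter i = T ⟨i, hi⟩ := by
      rw [hρ.arr _ rfl, hσ₁.arr _ rfl]
      exact hT.2 ⟨i, hi⟩
    simp only [Expr.eval, hx, h₃, State.setVar_arr, State.setArr_arr, if_true]
    by_cases hv : T ⟨i, hi⟩ = v
    · rw [← hv, Function.update_self]
      exact iff_of_false one_ne_zero fun h => h ⟨i, hi⟩ (Nat.lt_succ_self _) rfl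
    · rw [Function.update_of_ne (fun h => hv (Fin.ext h.symm)), hI v]
      refine ⟨fun h j hj => ?_, fun h j hj => h j (by omega)⟩
      rcases Nat.lt_succ_iff_lt_or_eq.1 hj with hj | hj
      · exact h j hj
      · obtain rfl : j = ⟨i, hi⟩ := Fin.ext hj
        exact hv
  · intro i hi ρ hρ hx hI
    have h₃ : ρ.arr aAlive i = 0 ↔ ∀ j, T j ≠ ⟨i, hi⟩ := by
      rw [hρ.arr _ rfl, h₂ ⟨i, hi⟩]
      exact ⟨fun h j => h j j.2, fun h j _ => h j⟩
    simp only [Cmd.wp, Test.holds, Expr.eval, hx, h₃]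
    refine ⟨fun h => Or.inr ⟨⟨i, hi⟩, fun ⟨j, hj⟩ => h j hj, by simp⟩, fun h => ?_⟩
    rcases hI with hI | ⟨w, hw, hw'⟩
    · refine Or.inl fun v hv => ?_
      rcases Nat.lt_succ_iff_lt_or_eq.1 hv with hv | hv
      · exact hI v hv
      · obtain rfl : v = ⟨i, hi⟩ := Fin.ext hv
        simpa using h
    · exact Or.inr ⟨w, hw, by simpa using hw'⟩
  · exact h₃.resolve_left fun h => hne (Set.eq_univ_of_forall fun v => h v v.2)

theorem le_of_injective (hT : Function.Injective T) : t ≤ n := by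
  simpa using Fintype.card_le_of_injective T hT

theorem subroutines_correct : subroutines.Correct where
  min2EC e σ _ he hG h2 := (min2EC_spec he hG h2).achieves
    (fun x h₁ h₂ => by cases x <;> first | rfl | exact absurd rfl (h₂ _))
    (fun a h₁ h₂ => by cases a <;> first | rfl | exact absurd rfl h₁ | exact absurd rfl (h₂ _))
  min2VC e σ hn3 he hG h2 := (min2VC_spec hn3 he hG h2).achieves
    (fun x h₁ h₂ => by cases x <;> first | rfl | exact absurd rfl (h₂ _))
    (fun a h₁ h₂ => by cases a <;> first | rfl | exact absurd rfl h₁ | exact absurd rfl (h₂ _))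
  chooseQ e σ y hn3 _ hy := (otherVertex_spec hn3 hy).achieves
    (fun x h₁ _ => by cases x <;> first | rfl | exact absurd rfl h₁)
    (fun a _ _ => by cases a <;> rfl)
  tree e σ y q hn3 _ hG hy hq hqy hr := (treeAvoiding_spec (by simp) (by simp) (by simp) hn3 hG.1
    hG.2.1 hG.lists hy hq hqy hr).achieves
    (fun x h₁ h₂ => by cases x <;> first | rfl | exact absurd rfl (h₂ _))
    (fun a h₁ h₂ => by cases a <;> first | rfl | exact absurd rfl h₁ | exact absurd rfl (h₂ _))
  treeRev e σ y q hn3 _ hG hy hq hqy hr := (treeAvoiding_spec (by simp) (by simp) (by simp) hn3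
    hG.1 hG.2.1 hG.lists_rev hy hq hqy hr).achieves
    (fun x h₁ h₂ => by cases x <;> first | rfl | exact absurd rfl (h₂ _))
    (fun a h₁ h₂ => by cases a <;> first | rfl | exact absurd rfl h₁ | exact absurd rfl (h₂ _))
  chooseW e T σ _ hT hG hT' hne := (nonterminal_spec hG hT' (le_of_injective hT) hne).achieves
    (fun x h₁ h₂ => by cases x <;> first | rfl | exact absurd rfl h₁ | exact absurd rfl (h₂ _))
    (fun a _ h₂ => by cases a <;> first | rfl | exact absurd rfl (h₂ _))
  indep e σ w hn3 _ hG hw hr := (independentTrees_spec (by simp) (by simp) (by simp) (by simp)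
    (by simp) hn3 hG.1 hG.2.1 hG.lists hw hr).achieves
    (fun x h₁ h₂ => by cases x <;> first | rfl | exact absurd rfl (h₂ _))
    (fun a h₁ h₂ => by cases a <;> first | rfl | exact absurd rfl (h₂ _) | simp at h₁)
  indepRev e σ w hn3 _ hG hw hr := (independentTrees_spec (by simp) (by simp) (by simp) (by simp)
    (by simp) hn3 hG.1 hG.2.1 hG.lists_rev hw hr).achieves
    (fun x h₁ h₂ => by cases x <;> first | rfl | exact absurd rfl (h₂ _))
    (fun a h₁ h₂ => by cases a <;> first | rfl | exact absurd rfl (h₂ _) | simp at h₁)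

/-! ## The running time -/

theorem Reach.swap {V : Type*} {E F : Set (V × V)} (hEF : ∀ a ∈ E, a.swap ∈ F) {u v : V}
    (h : Reach E u v) : Reach F v u := by
  induction h with
  | refl => exact Relation.ReflTransGen.refl
  | tail _ h ih => exact Relation.ReflTransGen.head (hEF _ h) ih

theorem swap_mem_range_rev {a : Fin n × Fin n} (h : a ∈ Set.range e) :
    a.swap ∈ Set.range (rev e) := by
  obtain ⟨i, rfl⟩ := h
  exact ⟨i, rfl⟩

/-- Every vertex has an outgoing edge, so taking sources maps edge numbers onto the vertices. -/
theorem StronglyConnected.le_card_edges (hn : 2 ≤ n) (h : StronglyConnected (Set.range e)) :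
    n ≤ m := by
  have : Nontrivial (Fin n) := Fin.nontrivial_iff_two_le.2 hn
  have hs : Function.Surjective fun i => (e i).1 := fun u => by
    obtain ⟨v, hv⟩ := exists_ne u
    rcases Relation.ReflTransGen.cases_head (h u trivial v trivial) with h | ⟨x, ⟨i, hi⟩, -⟩
    · exact absurd h.symm hv
    · exact ⟨i, congrArg Prod.fst hi⟩
  simpa using Fintype.card_le_of_surjective _ hs

theorem addEdges_spec (a : Arr) (hm : σ.var Var.m = m) :
    Runs (addEdges a) σ (20 * (m + 1)) fun _ => True :=
  (runs_simpleLoop 12 (I := fun _ _ => True) (by simp) rfl rfl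
    (Nat.le_of_lt_succ (by simp [Cmd.bound, Expr.cost, Test.cost])) hm trivial
    (by simp)).mono (by omega) fun _ => id

theorem smallCase_spec (hn3 : 3 ≤ n) (hG : HoldsGraph σ e) (hT : HoldsTerminals σ T)
    (h2 : Is2TConnected (Set.range e) (Set.range T)) :
    Runs (smallCase subroutines) σ ((3000 * (n + m + 1) + 8) * (t + 1)) fun _ => True := by
  refine runs_forLoop (fun _ _ => True) (by simp) rfl rfl hT.1 trivial fun i hi ρ hρ hρi _ => ?_
  have hGρ : HoldsGraph ρ e := hG.of_frame hρ rfl rfl rfl rfl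
  have hTρ : ρ.arr Arr.ter i = T ⟨i, hi⟩ := by
    rw [hρ.arr _ rfl]
    exact hT.2 ⟨i, hi⟩
  have hc := not_not.1 (h2.2 (T ⟨i, hi⟩) ⟨_, rfl⟩)
  generalize T ⟨i, hi⟩ = y at hTρ hc
  suffices h : Runs (Cmd.seq (Cmd.assign Var.y (Expr.get Arr.ter (Expr.var Var.i)))
      (Cmd.seq subroutines.chooseQ (Cmd.seq subroutines.tree (Cmd.seq (addEdges Arr.tree₁)
      (Cmd.seq subroutines.treeRev (addEdges Arr.tree₂)))))) ρ (10 + (10 + (1000 * (n + m + 1) +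
      (20 * (m + 1) + (1000 * (n + m + 1) + 20 * (m + 1)))))) fun _ => True from
    h.mono (by omega) fun _ => id
  refine Runs.bind (R := fun τ => τ.var Var.y = y) (Runs.simple 10 (by decide) ?_)
    fun σ₁ h₁ hy₁ => ?_
  · simp [hρi, hTρ]
  have hG₁ : HoldsGraph σ₁ e := hGρ.of_frame h₁ rfl rfl rfl rfl
  refine Runs.bind (otherVertex_spec hn3 hy₁) fun σ₂ h₂ ⟨q, hqy, hq₂⟩ => ?_
  have hG₂ : HoldsGraph σ₂ e := hG₁.of_frame h₂ rfl rfl rfl rfl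
  have hy₂ : σ₂.var Var.y = y := by rw [h₂.var _ rfl, hy₁]
  refine Runs.bind (treeAvoiding_spec (by simp) (by simp) (by simp) hn3 hG₂.1 hG₂.2.1 hG₂.lists
    hy₂ hq₂ hqy fun v hv => hc q hqy v hv) fun σ₃ h₃ _ => ?_
  have hG₃ : HoldsGraph σ₃ e := hG₂.of_frame h₃ rfl rfl rfl rfl
  refine Runs.bind (addEdges_spec _ hG₃.2.1) fun σ₄ h₄ _ => ?_
  have hG₄ : HoldsGraph σ₄ e := hG₃.of_frame h₄ rfl rfl rfl rfl
  refine Runs.bind (treeAvoiding_spec (by simp) (by simp) (by simp) hn3 hG₄.1 hG₄.2.1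
    hG₄.lists_rev (by rw [h₄.var _ rfl, h₃.var _ rfl, hy₂])
    (by rw [h₄.var _ rfl, h₃.var _ rfl, hq₂]) hqy fun v hv =>
      Reach.swap (F := delVertex (Set.range (rev e)) y)
        (fun a (ha : a ∈ delVertex (Set.range e) y) => ⟨swap_mem_range_rev ha.1, ha.2.2, ha.2.1⟩) (hc v hv q hqy))
    fun σ₅ h₅ _ => ?_
  have hG₅ : HoldsGraph σ₅ e := hG₄.of_frame h₅ rfl rfl rfl rfl
  exact addEdges_spec _ hG₅.2.1

theorem largeCase_spec (hn3 : 3 ≤ n) (hT' : Function.Injective T) (hG : HoldsGraph σ e)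
    (hT : HoldsTerminals σ T) (hne : Set.range T ≠ Set.univ)
    (h2 : StronglyConnected (Set.range e)) :
    Runs (largeCase subroutines) σ (9000 * (n + m + 1) * (n + 1)) fun _ => True := by
  suffices h : Runs (largeCase subroutines) σ (100 * (n + 1) + (4000 * (n + m + 1) * (n + 1) +
      ((20 * (m + 1) + 20 * (m + 1)) + (4000 * (n + m + 1) * (n + 1) +
      ((20 * (m + 1) + 20 * (m + 1)) + (20 * (m + 1) + 20 * (m + 1))))))) fun _ => True from
    h.mono (by nlinarith [Nat.zero_le (n * m), Nat.zero_le (n * n)]) fun _ => id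
  refine Runs.bind (nonterminal_spec hG hT (le_of_injective hT') hne)
    fun σ₁ h₁ ⟨w, _, hw₁⟩ => ?_
  have hG₁ : HoldsGraph σ₁ e := hG.of_frame h₁ rfl rfl rfl rfl
  refine Runs.bind (independentTrees_spec (by simp) (by simp) (by simp) (by simp) (by simp) hn3
    hG₁.1 hG₁.2.1 hG₁.lists hw₁ fun v => h2 w trivial v trivial) fun σ₂ h₂ _ => ?_
  have hG₂ : HoldsGraph σ₂ e := hG₁.of_frame h₂ rfl rfl rfl rfl
  refine Runs.bind (Runs.bind (addEdges_spec _ hG₂.2.1) fun ρ hρ _ =>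
    addEdges_spec _ (hG₂.of_frame hρ rfl rfl rfl rfl).2.1) fun σ₃ h₃ _ => ?_
  have hG₃ : HoldsGraph σ₃ e := hG₂.of_frame h₃ rfl rfl rfl rfl
  refine Runs.bind (independentTrees_spec (r := w) (by simp) (by simp) (by simp) (by simp)
    (by simp) hn3 hG₃.1 hG₃.2.1 hG₃.lists_rev (by rw [h₃.var _ rfl, h₂.var _ rfl, hw₁])
    fun v => (h2 v trivial w trivial).swap fun a => swap_mem_range_rev) fun σ₄ h₄ _ => ?_
  have hG₄ : HoldsGraph σ₄ e := hG₃.of_frame h₄ rfl rfl rfl rfl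
  refine Runs.bind (Runs.bind (addEdges_spec _ hG₄.2.1) fun ρ hρ _ =>
    addEdges_spec _ (hG₄.of_frame hρ rfl rfl rfl rfl).2.1) fun σ₅ h₅ _ => ?_
  have hG₅ : HoldsGraph σ₅ e := hG₄.of_frame h₅ rfl rfl rfl rfl
  exact Runs.bind (addEdges_spec _ hG₅.2.1) fun ρ hρ _ =>
    addEdges_spec _ (hG₅.of_frame hρ rfl rfl rfl rfl).2.1

/-- The inequality n ≤ m absorbs all terms in n, and the branch with a factor t + 1 is taken only
for t ≤ 2. -/
theorem algorithm1_spec (hn3 : 3 ≤ n) (he : Function.Injective e) (hT' : Function.Injective T)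
    (h2 : Is2TConnected (Set.range e) (Set.range T)) (hG : HoldsGraph σ e)
    (hT : HoldsTerminals σ T) :
    Runs (algorithm1 subroutines) σ (100000 * (m * m)) fun _ => True := by
  have hnm : n ≤ m := h2.1.1.le_card_edges (by omega)
  have htn : t ≤ n := le_of_injective hT'
  have hm₁ : m ≤ m * m := Nat.le_mul_self m
  have hnm' : n * m ≤ m * m := Nat.mul_le_mul_right m hnm
  have hnn : n * n ≤ m * m := Nat.mul_le_mul hnm hnm
  have hm2 : 3 ≤ m := hn3.trans hnm
  have hEC : Runs min2EC σ (20000 * (m * m)) fun _ => True :=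
    (min2EC_spec he hG h2.1).mono (by nlinarith) fun _ _ => trivial
  refine (Runs.ite (K := 90000 * (m * m)) (fun _ => hEC.mono (by omega) fun _ => id) fun ht0 =>
    (Runs.ite (K := 80000 * (m * m)) (fun htn' => ?_) fun htn' => ?_).mono ?_ fun _ => id).mono ?_
    fun _ => id
  · have htn' : t = n := by simpa [hT.1, hG.1] using htn'
    subst htn'
    -- An injective list of n terminals contains every vertex, so 2-T-connectivity becomes the
    -- 2-vertex-connectivity that the subroutine requires.
    have hsurj : Function.Surjective T := Finite.surjective_of_injective hT'
    exact (min2VC_spec hn3 he hG ⟨h2.1.1, by simpa using hn3,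
      fun w => h2.2 w (hsurj w)⟩).mono (by nlinarith) fun _ _ => trivial
  · have htn' : t ≠ n := by simpa [hT.1, hG.1] using htn'
    suffices h : Runs (Cmd.seq subroutines.min2EC (Cmd.ite
        (Test.and (Test.lt (Expr.lit 0) (Expr.var Var.t))
          (Test.not (Test.lt (Expr.lit 2) (Expr.var Var.t))))
        (smallCase subroutines) (largeCase subroutines))) σ
        (20000 * (m * m) + (8 + 50000 * (m * m))) fun _ => True from
      h.mono (by omega) fun _ => id
    refine Runs.bind hEC fun σ₁ h₁ _ => ?_
    have hG₁ : HoldsGraph σ₁ e := hG.of_frame h₁ rfl rfl rfl rfl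
    have hT₁ : HoldsTerminals σ₁ T := by
      unfold HoldsTerminals
      rw [h₁.var _ rfl, h₁.arr _ rfl]
      exact hT
    refine Runs.ite (fun hb => ?_) fun hb => ?_
    · have ht2 : t ≤ 2 := by simpa [hT₁.1] using hb.2
      refine (smallCase_spec hn3 hG₁ hT₁ h2).mono ?_ fun _ => id
      calc (3000 * (n + m + 1) + 8) * (t + 1) ≤ (3000 * (n + m + 1) + 8) * 3 :=
            Nat.mul_le_mul_left _ (by omega)
        _ ≤ _ := by omega
    · refine (largeCase_spec hn3 hT' hG₁ hT₁ (fun h => htn' ?_) h2.1.1).mono ?_ fun _ => id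
      · have := Fintype.card_of_bijective ⟨hT', Set.range_eq_univ.1 h⟩
        simpa using this
      · nlinarith
  · simp [Test.cost, Expr.cost]; omega
  · simp [Test.cost, Expr.cost]; omega

end

end TwoT

theorem mainTheorem5 :
    ∃ (S : TwoT.Subroutines) (C : ℕ), S.Correct ∧
      ∀ (n m t : ℕ) (e : Fin m → Fin n × Fin n) (T : Fin t → Fin n) (σ : TwoT.State),
        3 ≤ n → Function.Injective e → Function.Injective T →
        TwoT.Is2TConnected (Set.range e) (Set.range T) →
        TwoT.HoldsGraph σ e → TwoT.HoldsTerminals σ T →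
        ∃ (k : ℕ) (τ : TwoT.State), TwoT.Exec (TwoT.algorithm1 S) σ k τ ∧ k ≤ C * m ^ 2 := by
  refine ⟨TwoT.subroutines, 100000, TwoT.subroutines_correct, ?_⟩
  intro n m t e T σ hn3 he hT' h2 hG hT
  obtain ⟨k, τ, h, hk, -⟩ := TwoT.algorithm1_spec hn3 he hT' h2 hG hT
  exact ⟨k, τ, h, by rwa [pow_two]⟩
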